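/- **Setting.** Let $\mathcal W$ (contexts) and $\mathcal S$ (states) be measurable spaces, $\mathcal A$ a finite non-empty action set, $H\ge 1$ a horizon, $s_1\in\mathcal S$ a fixed initial state, $q$ a probability distribution on $\mathcal W$, and $ds$ a $\sigma$-finite reference measure on $\mathcal S$. In each episode a context $w\sim q$ is drawn, and the agent plays the $H$-step MDP $\mathcal M(w)$ with transition densities $P_h(s'|s,a,w)$ and deterministic rewards $r_h(s,a,w)\in[0,1]$ from $s_1$. A policy $\pi$ assigns to each step and state a distribution on $\mathcal A$; $V^\pi_{\mathcal M(w)}$ is its expected total reward in $\mathcal M(w)$, and $\pi_w^*$ maximizes $V^\pi_{\mathcal M(w)}$. *Model I.* There are known features $\phi_h,\psi_h:\mathcal S\times\mathcal A\times\mathcal W\to\mathbb R^d$ and unknown weights $\mu_h:\mathcal S\to\mathbb R^d$, $\eta_h\in\mathbb R^d$ with $$P_h(s'|s,a,w)=\langle\phi_h(s,a,w),\mu_h(s')\rangle,\qquad r_h(s,a,w)=\langle\psi_h(s,a,w),\eta_h\rangle,$$ $\|\phi_h\|_2\le1$, $\|\psi_h\|_2\le1$, $\|\eta_h\|_2\le\sqrt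 d$, and $\|\int\mu_h(s)g(s)\,ds\|_2\le\sqrt d$ for every $g:\mathcal S\to[0,1]$. A finite class $\Psi_1$ of functions $\mathcal S\to\mathbb R^d$ is given that contains every $\mu_h$, and each $m\in\Psi_1$ is admissible: for every $h$, $\langle\phi_h(s,a,w),m(\cdot)\rangle$ is a probability density for all $(s,a,w)$, and $\|\int m(s)g(s)\,ds\|_2\le\sqrt d$ for every $g:\mathcal S\to[0,1]$. *Algorithm.* Let $\delta\in(0,1)$, $\gamma_1,\gamma_2>0$, $\lambda_n=\gamma_1d\log(2nH/\delta)$, $\xi_n=\gamma_2d\log(2nH/\delta)$, $\alpha_n=5H\sqrt{2\lambda_nd+4\log(2nH|\Psi_1|/\delta)}$, $\beta_n=\sqrt{d\xi_n}$, and write $\|x\|_B=\sqrt{x^\top Bx}$. In episode $1$ an arbitrary policy is played. In episode $n\ge2$, with data $(w_\tau,(s^\tau_h,a^\tau_h,r^\tau_h,s^\tau_{h+1})_{h\le H})_{\tau<n}$ and $\phi_h^\tau=\phi_h(s_h^\tau,a_h^\tau,w_\tau)$, $\psi_h^\tau=\psi_h(s_h^\tau,a_h^\tau,w_\tau)$,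 put $$\hat\Sigma_h^n=\sum_{\tau<n}\phi_h^\tau(\phi_h^\tau)^\top+\lambda_nI,\quad \hat\Lambda_h^n=\sum_{\tau<n}\psi_h^\tau(\psi_h^\tau)^\top+\xi_nI,\quad \hat\eta_h^n=(\hat\Lambda_h^n)^{-1}\sum_{\tau<n}\psi_h^\tau r_h^\tau,$$ $$\hat\mu_h^n\in\operatorname*{argmax}_{m\in\Psi_1}\sum_{\tau<n}\log\langle\phi_h^\tau,m(s_{h+1}^\tau)\rangle\quad(\log 0=-\infty),$$ $$\hat r_h^n=\max\{0,\min\{1,\langle\hat\eta_h^n,\psi_h\rangle\}\}+\min\{\alpha_n\|\phi_h\|_{(\hat\Sigma_h^n)^{-1}},H\}+\min\{\beta_n\|\psi_h\|_{(\hat\Lambda_h^n)^{-1}},1\}.$$ For every context $w$, the policy $\pi_w^n$ maximizes over $\pi$ the truncated value $\bar{\bar V}^\pi_1(s_1)$, defined by $\bar{\bar V}^\pi_{H+1}=0$ and $$\bar{\bar V}^\pi_h(s)=\mathbb E_{a\sim\pi_h(s)}\min\Big\{3H,\ \hat r_h^n(s,a,w)+\int\langle\phi_h(s,a,w),\hat\mu_h^n(s')\rangle\,\bar{\bar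 V}^\pi_{h+1}(s')\,ds'\Big\}.$$ Then $w_n\sim q$ is drawn and $\pi^n_{w_n}$ is executed. Ties are broken arbitrarily (measurably in data, context and state). **Theorem.** There is an absolute constant $\gamma_0>0$ such that for all constants $\gamma_1,\gamma_2\ge\gamma_0$ the following holds in every such setting and for every $\delta\in(0,1)$. (1) For every $N\ge1$, with probability at least $1-3\delta/2$, $$\frac1N\sum_{n=1}^N\mathbb E_{w\sim q}\big[V^{\pi^*_w}_{\mathcal M(w)}-V^{\pi^n_w}_{\mathcal M(w)}\big]\le\Big(42H\sqrt{2d\lambda_N+4\log(2HN|\Psi_1|/\delta)}+6\sqrt{d\xi_N}\Big)\,H\sqrt{\frac{2d}N}\,\sqrt{\log\Big(1+\frac N{d\lambda}\Big)},$$ where $\lambda=\min\{\lambda_1,\xi_1\}$. (2) Consequently $\tilde{\mathcal O}\big(H^4d^3\log(|\Psi_1|/\delta)/\epsilon^2\big)$ episodes suffice for an average gap below $\epsilon$: there is a constant $C>0$, depending only on $\gamma_1,\gamma_2$, such that for every $\epsilon>0$, with $X=H^4d^3\log(|\Psi_1|/\delta)/\epsilon^2$, and every $N\ge1$ with $N\ge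 C\,X\log^2(2+X)$, with probability at least $1-3\delta/2$ the average gap on the left-hand side of (1) is less than $\epsilon$. -/

import Mathlib

open MeasureTheory ProbabilityTheory
open scoped ENNReal

noncomputable section

namespace CMDPModelI

/-- `ℝ^d` with the Euclidean norm. -/
abbrev Vec (d : ℕ) : Type := EuclideanSpace ℝ (Fin d)

/-- A (Markov, possibly stochastic) policy of horizon `H`: at each step a Markov kernel from states
to actions. The steps `1, …, H` are numbered `0, …, H - 1`. -/
structure Policy (H : ℕ) (S A : Type*) [MeasurableSpace S] [MeasurableSpace A] where
  kernel : Fin H → Kernel S A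
  markov : ∀ h, IsMarkovKernel (kernel h)

/-- A contextual Markov decision process of horizon `H`: initial state `s₁`, context distribution
`q`, context-dependent transition kernels `P h (s, a, w)` and deterministic rewards
`r h (s, a, w) ∈ [0, 1]`. -/
structure CMDP (H : ℕ) (W S A : Type*) [MeasurableSpace W] [MeasurableSpace S]
    [MeasurableSpace A] where
  s₁ : S
  q : Measure W
  q_prob : IsProbabilityMeasure q
  P : Fin H → Kernel (S × A × W) S
  P_markov : ∀ h, IsMarkovKernel (P h)
  r : Fin H → S × A × W → ℝ
  r_measurable : ∀ h, Measurable (r h)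
  r_mem : ∀ h x, r h x ∈ Set.Icc (0 : ℝ) 1

/-- The list of the transitions `(s_h, a_h, s_{h+1})` of an episode. -/
abbrev Traj (H : ℕ) (S A : Type*) : Type _ := Fin H → S × A × S

/-- An episode: its context and its transitions. -/
abbrev Episode (H : ℕ) (W S A : Type*) : Type _ := W × Traj H S A

section Values

variable {W S A : Type*} [MeasurableSpace W] [MeasurableSpace S] [MeasurableSpace A]

/-- The law of the trajectory that starts in `s` and follows, at each step, first the policy and
then the transition kernel: `a ∼ π_h(s)`, `s' ∼ P_h(s, a)`. -/
def trajLaw : (H : ℕ) → (P : Fin H → Kernel (S × A) S) → (π : Fin H → Kernel S A) → S →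
    Measure (Traj H S A)
  | 0, _, _, _ => Measure.dirac Fin.elim0
  | H + 1, P, π, s =>
      (π 0 s).bind fun a =>
        (P 0 (s, a)).bind fun s' =>
          (trajLaw H (fun h => P h.succ) (fun h => π h.succ) s').map fun τ =>
            (Fin.cons (s, a, s') τ : Fin (H + 1) → S × A × S)

/-- The truncated value function `V̿` of a policy for rewards `r`, transition densities `p` with
respect to `ν`, and truncation level `B`:
`Q̿_h(s, a) = min {B, r_h(s, a) + ∫ p_h(s' | s, a) V̿_{h+1}(s') dν(s')}`,
`V̿_h(s) = E_{a ∼ π_h(s)} Q̿_h(s, a)`, and `V̿ = 0` after the last step. -/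
def truncValue (ν : Measure S) (B : ℝ) : (H : ℕ) → (r : Fin H → S → A → ℝ) →
    (p : Fin H → S → A → S → ℝ) → (π : Fin H → Kernel S A) → S → ℝ
  | 0, _, _, _, _ => 0
  | H + 1, r, p, π, s =>
      ∫ a, min B (r 0 s a +
        ∫ s', p 0 s a s' *
          truncValue ν B H (fun h => r h.succ) (fun h => p h.succ) (fun h => π h.succ) s' ∂ν)
        ∂(π 0 s)

variable {H : ℕ}

/-- The transition kernels of the MDP `M(w)`. -/
def CMDP.transAt (M : CMDP H W S A) (w : W) (h : Fin H) : Kernel (S × A) S :=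
  (M.P h).comap (fun x : S × A => (x.1, x.2, w)) (by fun_prop)

/-- The law of the trajectory of an episode with context `w` under the policy `π`. -/
def CMDP.episodeLaw (M : CMDP H W S A) (w : W) (π : Policy H S A) : Measure (Traj H S A) :=
  trajLaw H (M.transAt w) π.kernel M.s₁

/-- The value `V^π_{M(w)}`: expected total reward of `π` in `M(w)` from the initial state. -/
def CMDP.value (M : CMDP H W S A) (w : W) (π : Policy H S A) : ℝ :=
  ∫ τ, ∑ h, M.r h ((τ h).1, (τ h).2.1, w) ∂(M.episodeLaw w π)

/-- The optimal value `max_π V^π_{M(w)}` (the values lie in `[0, H]`). -/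
def CMDP.optValue (M : CMDP H W S A) (w : W) : ℝ :=
  ⨆ π : Policy H S A, M.value w π

end Values

section ModelOne

variable {H d : ℕ} {W S A : Type*} [MeasurableSpace W] [MeasurableSpace S] [MeasurableSpace A]

/-- `m` is an admissible weight function for the feature map `φ`: `⟨φ(s, a, w), m(·)⟩` is a
probability density with respect to `ν` for all `(s, a, w)`, and `‖∫ m g dν‖₂ ≤ √d` for every
`g` with values in `[0, 1]`. -/
structure IsWeight (ν : Measure S) (φ : S × A × W → Vec d) (m : S → Vec d) : Prop where
  measurable : Measurable m
  integrable : Integrable m ν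
  nonneg : ∀ x s', 0 ≤ inner ℝ (φ x) (m s')
  integral_eq_one : ∀ x, ∫ s', inner ℝ (φ x) (m s') ∂ν = 1
  norm_integral_le : ∀ g : S → ℝ, Measurable g → (∀ s, g s ∈ Set.Icc (0 : ℝ) 1) →
    ‖∫ s, g s • m s ∂ν‖ ≤ √(d : ℝ)

/-- The CMDP `M` has varying representation: features `φ`, `ψ` that depend on the context, and
weights `μ`, `η` common to all contexts. `ν` is the reference measure on the states, with respect
to which transition densities are taken. -/
structure IsModelI (M : CMDP H W S A) (ν : Measure S) (φ ψ : Fin H → S × A × W → Vec d)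
    (μ : Fin H → S → Vec d) (η : Fin H → Vec d) : Prop where
  φ_measurable : ∀ h, Measurable (φ h)
  ψ_measurable : ∀ h, Measurable (ψ h)
  φ_norm_le : ∀ h x, ‖φ h x‖ ≤ 1
  ψ_norm_le : ∀ h x, ‖ψ h x‖ ≤ 1
  weight : ∀ h, IsWeight ν (φ h) (μ h)
  trans_eq : ∀ h x, M.P h x = ν.withDensity fun s' => ENNReal.ofReal (inner ℝ (φ h x) (μ h s'))
  reward_eq : ∀ h x, M.r h x = inner ℝ (ψ h x) (η h)
  η_norm_le : ∀ h, ‖η h‖ ≤ √(d : ℝ)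

/-- The finite model class `Ψ` consists of admissible weight functions and contains the true
`μ_h` for every step `h`. -/
structure IsModelClass (ν : Measure S) (φ : Fin H → S × A × W → Vec d) (μ : Fin H → S → Vec d)
    (Ψ : Finset (S → Vec d)) : Prop where
  admissible : ∀ m ∈ Ψ, ∀ h, IsWeight ν (φ h) m
  realizable : ∀ h, μ h ∈ Ψ

end ModelOne

section Parameters

/-- The regularizer `γ d log(2 n H / δ)`: `λ_n` for `γ = γ₁` and `ξ_n` for `γ = γ₂`. -/
def reg (γ : ℝ) (d H : ℕ) (δ : ℝ) (n : ℕ) : ℝ :=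
  γ * d * Real.log (2 * n * H / δ)

/-- `α_n = 5 H √(2 λ_n d + 4 log(2 n H K / δ))`, where `K` is the size of the model class. -/
def alpha (γ₁ : ℝ) (d H K : ℕ) (δ : ℝ) (n : ℕ) : ℝ :=
  5 * H * √(2 * reg γ₁ d H δ n * d + 4 * Real.log (2 * n * H * K / δ))

/-- `β_n = √(d ξ_n)`. -/
def beta (γ₂ : ℝ) (d H : ℕ) (δ : ℝ) (n : ℕ) : ℝ :=
  √(d * reg γ₂ d H δ n)

/-- The regularized Gram matrix `∑_τ v_τ v_τᵀ + c I`. -/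
def gram {n d : ℕ} (v : Fin n → Vec d) (c : ℝ) : Matrix (Fin d) (Fin d) ℝ :=
  ∑ τ, Matrix.vecMulVec (v τ).ofLp (v τ).ofLp + c • (1 : Matrix (Fin d) (Fin d) ℝ)

/-- `‖x‖_B = √(xᵀ B x)`. -/
def matNorm {d : ℕ} (B : Matrix (Fin d) (Fin d) ℝ) (x : Vec d) : ℝ :=
  √(x.ofLp ⬝ᵥ B.mulVec x.ofLp)

end Parameters

section Algorithm

variable {H d : ℕ} {W S A : Type*} [MeasurableSpace W] [MeasurableSpace S] [MeasurableSpace A]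

/-- `(s_h, a_h, w)` of an episode. -/
def visit (e : Episode H W S A) (h : Fin H) : S × A × W :=
  ((e.2 h).1, (e.2 h).2.1, e.1)

/-- The log-likelihood `∑_{(s,a,s',w)} log ⟨φ_h(s,a,w), m(s')⟩` of `m` on the data of step `h`;
it takes values in `[-∞, ∞)`, with `log 0 = -∞`. -/
def logLik (φ : Fin H → S × A × W → Vec d) {i : ℕ} (D : Fin i → Episode H W S A) (h : Fin H)
    (m : S → Vec d) : EReal :=
  ∑ τ, ENNReal.log (ENNReal.ofReal (inner ℝ (φ h (visit (D τ) h)) (m ((D τ).2 h).2.2)))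

/-- `‖v_h(x)‖` in the norm of the inverse regularized Gram matrix of the feature map `v` along the
data `D`, for the regularizer `c`. -/
def featNorm (v : Fin H → S × A × W → Vec d) (c : ℝ) {i : ℕ} (D : Fin i → Episode H W S A)
    (h : Fin H) (x : S × A × W) : ℝ :=
  matNorm (gram (fun τ => v h (visit (D τ) h)) c)⁻¹ (v h x)

/-- Ridge-regression estimate `η̂_h` of the reward weights, with regularizer `c`; the observed
reward is `r_h(s_h, a_h, w)`. -/
def ridge (M : CMDP H W S A) (ψ : Fin H → S × A × W → Vec d) (c : ℝ) {i : ℕ}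
    (D : Fin i → Episode H W S A) (h : Fin H) : Vec d :=
  WithLp.toLp 2 ((gram (fun τ => ψ h (visit (D τ) h)) c)⁻¹.mulVec
    (∑ τ, M.r h (visit (D τ) h) • (ψ h (visit (D τ) h)).ofLp))

/-- The optimistic reward `r̂ = f̂ + b̂ + ĉ` of episode `n = i + 1`, computed from the data `D` of
the first `i` episodes. Here `f̂` is the ridge estimate clipped to `[0, 1]`,
`b̂ = min {α_n ‖φ‖, H}` and `ĉ = min {β_n ‖ψ‖, 1}`, in the norms of the inverse Gram matrices. -/
def optReward (M : CMDP H W S A) (φ ψ : Fin H → S × A × W → Vec d) (K : ℕ) (γ₁ γ₂ δ : ℝ)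
    {i : ℕ} (D : Fin i → Episode H W S A) (h : Fin H) (x : S × A × W) : ℝ :=
  max 0 (min 1 (inner ℝ (ridge M ψ (reg γ₂ d H δ (i + 1)) D h) (ψ h x)))
    + min (alpha γ₁ d H K δ (i + 1) * featNorm φ (reg γ₁ d H δ (i + 1)) D h x) H
    + min (beta γ₂ d H δ (i + 1) * featNorm ψ (reg γ₂ d H δ (i + 1)) D h x) 1

/-- What a learner does: before episode `i + 1` it computes from the data of the first `i`
episodes a weight estimate `μ̂_h` for each step and a policy for each context. The policy depends
measurably on the data, the context and the state. -/
structure Learner (H d : ℕ) (W S A : Type*) [MeasurableSpace W] [MeasurableSpace S]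
    [MeasurableSpace A] where
  muHat : (i : ℕ) → (Fin i → Episode H W S A) → Fin H → S → Vec d
  kernel : (i : ℕ) → Fin H → Kernel (((Fin i → Episode H W S A) × W) × S) A
  markov : ∀ i h, IsMarkovKernel (kernel i h)

/-- The policy `π^{i+1}_w` that is chosen on the data `D` for the context `w`. -/
def Learner.policy (L : Learner H d W S A) (i : ℕ) (D : Fin i → Episode H W S A) (w : W) :
    Policy H S A where
  kernel h := (L.kernel i h).comap (fun s : S => ((D, w), s)) (by fun_prop)
  markov h := by
    have := L.markov i h
    infer_instance

/-- The truncated value `V̿^π` of the estimated MDP for the context `w` in episode `i + 1`: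
optimistic reward, transition density `⟨φ_h(s, a, w), m_h(s')⟩`, truncation level `3 H`. -/
def plannedValue (M : CMDP H W S A) (ν : Measure S) (φ ψ : Fin H → S × A × W → Vec d) (K : ℕ)
    (γ₁ γ₂ δ : ℝ) {i : ℕ} (D : Fin i → Episode H W S A) (m : Fin H → S → Vec d) (w : W)
    (π : Policy H S A) : ℝ :=
  truncValue ν (3 * H) H (fun h s a => optReward M φ ψ K γ₁ γ₂ δ D h (s, a, w))
    (fun h s a s' => inner ℝ (φ h (s, a, w)) (m h s')) π.kernel M.s₁

/-- The learner runs the model-based UCB algorithm: the policy of the first episode is arbitrary;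
in every later episode `μ̂_h` is a maximum likelihood estimate over the model class, and the policy
for each context maximizes the truncated value of the estimated optimistic MDP. Ties are broken
arbitrarily. -/
structure Learner.RunsUCB (L : Learner H d W S A) (M : CMDP H W S A) (ν : Measure S)
    (φ ψ : Fin H → S × A × W → Vec d) (Ψ : Finset (S → Vec d)) (γ₁ γ₂ δ : ℝ) : Prop where
  mle_mem : ∀ i, 1 ≤ i → ∀ D h, L.muHat i D h ∈ Ψ
  mle_max : ∀ i, 1 ≤ i → ∀ D h, ∀ m ∈ Ψ, logLik φ D h m ≤ logLik φ D h (L.muHat i D h)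
  planning : ∀ i, 1 ≤ i → ∀ D w, ∀ π : Policy H S A,
    plannedValue M ν φ ψ Ψ.card γ₁ γ₂ δ D (L.muHat i D) w π ≤
      plannedValue M ν φ ψ Ψ.card γ₁ γ₂ δ D (L.muHat i D) w (L.policy i D w)

/-- The law of the first `n` episodes: in each episode the context is drawn from `q`,
independently of the past, and the chosen policy is executed in the MDP of that context. -/
def Learner.runLaw (L : Learner H d W S A) (M : CMDP H W S A) :
    (n : ℕ) → Measure (Fin n → Episode H W S A)
  | 0 => Measure.dirac Fin.elim0
  | n + 1 =>
      (L.runLaw M n).bind fun D =>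
        M.q.bind fun w =>
          (M.episodeLaw w (L.policy n D w)).map fun τ =>
            (Fin.snoc D (w, τ) : Fin (n + 1) → Episode H W S A)

/-- The average sub-optimality gap `(1/N) ∑_{n ≤ N} E_{w ∼ q} [V^{π*_w}_{M(w)} - V^{π^n_w}_{M(w)}]`
of the policies chosen along the run `x`. -/
def Learner.avgGap (L : Learner H d W S A) (M : CMDP H W S A) {N : ℕ}
    (x : Fin N → Episode H W S A) : ℝ :=
  (1 / N : ℝ) * ∑ i : Fin N,
    ∫ w, (M.optValue w -
      M.value w (L.policy i (fun j : Fin i => x (j.castLE i.isLt.le)) w)) ∂M.q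

end Algorithm

end CMDPModelI

end

/-! The proof combines optimism with an elliptic potential argument, and measures every model error
on the visited points themselves. Two confidence statements drive it. The rewards `⟨ψ, η⟩` are
observed without noise, so the ridge estimate has only its regularization bias, at most `β_n ‖ψ‖`
(`abs_inner_ridge_sub_le`). For the transitions, let `p` be the true and `q` a candidate density.
Under the adaptive law of the run, the product over past episodes of `√(q/p) · exp(Hellinger²)` has
mean at most 1, because the conditional mean of `√(q/p)` is at most `1 - Hellinger² ≤
exp(-Hellinger²)`. For a candidate at least as likely as the truth, the likelihood part of this
product is at least 1. Markov's inequality and a union bound therefore control the summed Hellinger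
error on the data of all such candidates, the maximum likelihood estimate among them
(`Learner.measure_mle_bad_le`).

The prediction error against a value function `V` is `⟨φ, θ⟩` with a single vector `θ = ∫ V (μ -
μ̂)`. Since the Hellinger distance dominates the `L¹` distance, `θ` is small on the data, and
Cauchy–Schwarz in the Gram norm turns this into a bound by a multiple of `‖φ‖` at every point
(`IsWeight.abs_integral_sub_le`). Hence the planned value dominates the optimal value, while the
planned value of the chosen policy exceeds its true value by at most the expected sum of bonuses
along its own trajectories (`Learner.gap_le_expSum_bonus`). Truncation at `3H` keeps the planned
value functions within the range of the error bound.

Averaged over contexts, that expectation is the conditional mean of the bonuses in the next episode.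
A Bernstein-type supermartingale replaces conditional means of squared feature norms by realized
ones, up to a factor 2 and a logarithm (`Learner.measure_sum_integral_gt_le`). The realized ones
telescope through the log-determinants of the Gram matrices (`elliptic_potential`). Cauchy–Schwarz,
in expectation and over the episodes, then gives the rate `1/√N`. Three bad events of probability
`δ/2` each are discarded.

For (2) the bound is squared and `N` is written as `t · X log²(2 + X)`; a large constant `t` beats
the remaining `log² t` (`regretBound_lt`). -/

namespace CMDPModelI

/-! ### Gram matrices, ridge regression and the elliptic potential -/

section LinearAlgebra

open Matrix

variable {n d : ℕ}

/-- This bilinear form is the interface between the matrix definitions and Euclidean inner products;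
the norm estimates below rest on it. -/
lemma dotProduct_gram_mulVec (v : Fin n → Vec d) (c : ℝ) (x y : Vec d) :
    x.ofLp ⬝ᵥ (gram v c).mulVec y.ofLp =
      c * inner ℝ x y + ∑ τ, inner ℝ (v τ) x * inner ℝ (v τ) y := by
  have h : ∀ a b : Vec d, inner ℝ a b = b.ofLp ⬝ᵥ a.ofLp := fun a b => by
    simp [EuclideanSpace.inner_eq_star_dotProduct]
  simp only [gram, Matrix.add_mulVec, Matrix.sum_mulVec, Matrix.smul_mulVec, Matrix.one_mulVec,
    dotProduct_add, dotProduct_sum, Matrix.vecMulVec_mulVec, dotProduct_smul, h]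
  rw [add_comm]
  congr 1
  · rw [dotProduct_comm]; rfl
  · refine Finset.sum_congr rfl fun τ _ => ?_
    simp [dotProduct_comm]

lemma gram_isHermitian (v : Fin n → Vec d) (c : ℝ) : (gram v c).IsHermitian := by
  ext i j
  simp [gram, Matrix.sum_apply, Matrix.vecMulVec_apply, Matrix.one_apply, mul_comm, eq_comm]

lemma gram_posDef (v : Fin n → Vec d) {c : ℝ} (hc : 0 < c) : (gram v c).PosDef := by
  refine Matrix.PosDef.of_dotProduct_mulVec_pos (gram_isHermitian v c) fun {x} hx => ?_
  have h := dotProduct_gram_mulVec v c (WithLp.toLp 2 x) (WithLp.toLp 2 x)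
  simp only [star_trivial]
  simp only at h
  rw [h]
  have hx' : (WithLp.toLp 2 x : Vec d) ≠ 0 := by
    intro h0; apply hx; simpa using h0
  have : 0 < inner ℝ (WithLp.toLp 2 x : Vec d) (WithLp.toLp 2 x) := real_inner_self_pos.2 hx'
  have h2 : 0 ≤ ∑ τ, inner ℝ (v τ) (WithLp.toLp 2 x) * inner ℝ (v τ) (WithLp.toLp 2 x) :=
    Finset.sum_nonneg fun τ _ => mul_self_nonneg _
  positivity

lemma gram_det_ne_zero (v : Fin n → Vec d) {c : ℝ} (hc : 0 < c) : IsUnit (gram v c).det :=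
  (gram_posDef v hc).det_pos.ne'.isUnit

/-- The solution `G⁻¹ x` of the normal equations, as a Euclidean vector. -/
noncomputable def gramSolve (v : Fin n → Vec d) (c : ℝ) (x : Vec d) : Vec d :=
  WithLp.toLp 2 ((gram v c)⁻¹.mulVec x.ofLp)

lemma gram_mulVec_gramSolve (v : Fin n → Vec d) {c : ℝ} (hc : 0 < c) (x : Vec d) :
    (gram v c).mulVec (gramSolve v c x).ofLp = x.ofLp := by
  simp [gramSolve, Matrix.mulVec_mulVec, Matrix.mul_nonsing_inv _ (gram_det_ne_zero v hc)]

/-- The normal equations in weak form. Testing against the solution itself expresses the squared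
inverse norm as a squared Gram norm. -/
lemma inner_gramSolve (v : Fin n → Vec d) {c : ℝ} (hc : 0 < c) (x y : Vec d) :
    c * inner ℝ y (gramSolve v c x) + ∑ τ, inner ℝ (v τ) y * inner ℝ (v τ) (gramSolve v c x)
      = inner ℝ y x := by
  rw [← dotProduct_gram_mulVec, gram_mulVec_gramSolve v hc]
  simp [EuclideanSpace.inner_eq_star_dotProduct, dotProduct_comm]

lemma matNorm_sq (v : Fin n → Vec d) {c : ℝ} (hc : 0 < c) (x : Vec d) :
    matNorm (gram v c)⁻¹ x ^ 2 = inner ℝ x (gramSolve v c x) := by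
  have h : x.ofLp ⬝ᵥ (gram v c)⁻¹.mulVec x.ofLp = inner ℝ x (gramSolve v c x) := by
    simp [EuclideanSpace.inner_eq_star_dotProduct, dotProduct_comm, gramSolve]
  rw [matNorm, Real.sq_sqrt, h]
  have := (gram_posDef v hc).inv.posSemidef.dotProduct_mulVec_nonneg x.ofLp
  simpa using this

lemma matNorm_nonneg (B : Matrix (Fin d) (Fin d) ℝ) (x : Vec d) : 0 ≤ matNorm B x :=
  Real.sqrt_nonneg _

/-- The Cauchy–Schwarz inequality for the norms of the Gram matrix and of its inverse. -/
lemma inner_sq_le_matNorm_sq_mul (v : Fin n → Vec d) {c : ℝ} (hc : 0 < c) (x y : Vec d) :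
    inner ℝ x y ^ 2 ≤
      matNorm (gram v c)⁻¹ x ^ 2 * (c * ‖y‖ ^ 2 + ∑ τ, inner ℝ (v τ) y ^ 2) := by
  set u := gramSolve v c x
  have hx : matNorm (gram v c)⁻¹ x ^ 2 = c * ‖u‖ ^ 2 + ∑ τ, inner ℝ (v τ) u ^ 2 := by
    rw [matNorm_sq v hc, real_inner_comm, ← inner_gramSolve v hc x u]
    simp [u, sq]
  have hxy : inner ℝ x y = c * inner ℝ y u + ∑ τ, inner ℝ (v τ) y * inner ℝ (v τ) u := by
    rw [real_inner_comm, ← inner_gramSolve v hc x y]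
  -- The quadratic in `t` is the squared Gram norm of `u - t y`, where `u` solves the normal
  -- equations for `x`; its discriminant gives the inequality.
  have key : ∀ t : ℝ, 0 ≤ (c * ‖y‖ ^ 2 + ∑ τ, inner ℝ (v τ) y ^ 2) * (t * t) +
      (-2 * inner ℝ x y) * t + matNorm (gram v c)⁻¹ x ^ 2 := by
    intro t
    have e : (c * ‖y‖ ^ 2 + ∑ τ, inner ℝ (v τ) y ^ 2) * (t * t) +
      (-2 * inner ℝ x y) * t + matNorm (gram v c)⁻¹ x ^ 2 =
        c * ‖u - t • y‖ ^ 2 + ∑ τ, (inner ℝ (v τ) u - t * inner ℝ (v τ) y) ^ 2 := by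
      rw [hx, hxy, norm_sub_sq_real, norm_smul, real_inner_smul_right, real_inner_comm y u,
        mul_pow, Real.norm_eq_abs, sq_abs]
      simp only [sub_sq, Finset.sum_add_distrib, Finset.sum_sub_distrib, add_mul, mul_add,
        Finset.mul_sum, Finset.sum_mul]
      have h1 : ∑ τ, 2 * inner ℝ (v τ) u * (t * inner ℝ (v τ) y)
          = 2 * t * ∑ τ, inner ℝ (v τ) y * inner ℝ (v τ) u := by
        rw [Finset.mul_sum]; exact Finset.sum_congr rfl fun _ _ => by ring
      have h2 : ∑ τ, -2 * (inner ℝ (v τ) y * inner ℝ (v τ) u) * t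
          = - (2 * t * ∑ τ, inner ℝ (v τ) y * inner ℝ (v τ) u) := by
        rw [Finset.mul_sum, ← Finset.sum_neg_distrib]
        exact Finset.sum_congr rfl fun _ _ => by ring
      have h3 : ∑ τ, (t * inner ℝ (v τ) y) ^ 2 = ∑ τ, inner ℝ (v τ) y ^ 2 * (t * t) :=
        Finset.sum_congr rfl fun _ _ => by ring
      rw [h1, h2, h3]
      ring
    rw [e]
    exact add_nonneg (by positivity) (Finset.sum_nonneg fun _ _ => sq_nonneg _)
  have := discrim_le_zero key
  rw [discrim] at this
  nlinarith

lemma abs_inner_le_matNorm_mul (v : Fin n → Vec d) {c : ℝ} (hc : 0 < c) (x y : Vec d) {R : ℝ}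
    (hR : c * ‖y‖ ^ 2 + ∑ τ, inner ℝ (v τ) y ^ 2 ≤ R ^ 2) (hR0 : 0 ≤ R) :
    |inner ℝ x y| ≤ R * matNorm (gram v c)⁻¹ x := by
  refine abs_le_of_sq_le_sq ?_ (mul_nonneg hR0 (matNorm_nonneg _ _))
  refine (inner_sq_le_matNorm_sq_mul v hc x y).trans ?_
  rw [mul_pow, mul_comm]
  gcongr

lemma matNorm_sq_eq_gram (v : Fin n → Vec d) {c : ℝ} (hc : 0 < c) (x : Vec d) :
    matNorm (gram v c)⁻¹ x ^ 2 =
      c * ‖gramSolve v c x‖ ^ 2 + ∑ τ, inner ℝ (v τ) (gramSolve v c x) ^ 2 := by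
  rw [matNorm_sq v hc, real_inner_comm, ← inner_gramSolve v hc x]
  simp [sq]

/-- Cauchy–Schwarz at level `c`, applied to `x` and the solution at level `c'`, gives `a² ≤ b a` for
the squared norms `a` at `c'` and `b` at `c`. No operator monotonicity of the inverse is needed. -/
lemma matNorm_gram_inv_antitone (v : Fin n → Vec d) {c c' : ℝ} (hc : 0 < c) (h : c ≤ c')
    (x : Vec d) : matNorm (gram v c')⁻¹ x ≤ matNorm (gram v c)⁻¹ x := by
  have hc' := hc.trans_le h
  have h1 := inner_sq_le_matNorm_sq_mul v hc x (gramSolve v c' x)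
  rw [← matNorm_sq v hc'] at h1
  have h2 : c * ‖gramSolve v c' x‖ ^ 2 + ∑ τ, inner ℝ (v τ) (gramSolve v c' x) ^ 2
      ≤ matNorm (gram v c')⁻¹ x ^ 2 := by
    rw [matNorm_sq_eq_gram v hc']; gcongr
  have h3 : (matNorm (gram v c')⁻¹ x ^ 2) ^ 2 ≤
      matNorm (gram v c)⁻¹ x ^ 2 * matNorm (gram v c')⁻¹ x ^ 2 :=
    h1.trans (by gcongr)
  refine le_of_not_gt fun hlt => ?_
  have h0 := matNorm_nonneg (gram v c)⁻¹ x
  have h4 : matNorm (gram v c)⁻¹ x ^ 2 < matNorm (gram v c')⁻¹ x ^ 2 := by gcongr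
  nlinarith [sq_nonneg (matNorm (gram v c)⁻¹ x)]

/-- The solution `u` satisfies `c ‖u‖² ≤ ⟨x, u⟩ ≤ ‖x‖ ‖u‖`, hence `c ‖u‖ ≤ ‖x‖`. -/
lemma matNorm_gram_inv_sq_le (v : Fin n → Vec d) {c : ℝ} (hc : 0 < c) (x : Vec d) :
    matNorm (gram v c)⁻¹ x ^ 2 ≤ ‖x‖ ^ 2 / c := by
  set u := gramSolve v c x with hu
  have h1 : matNorm (gram v c)⁻¹ x ^ 2 ≤ ‖x‖ * ‖u‖ := by
    rw [matNorm_sq v hc]; exact real_inner_le_norm _ _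
  have h2 : c * ‖u‖ ^ 2 ≤ matNorm (gram v c)⁻¹ x ^ 2 := by
    rw [matNorm_sq_eq_gram v hc]
    exact le_add_of_nonneg_right (Finset.sum_nonneg fun _ _ => sq_nonneg _)
  rw [le_div_iff₀ hc]
  have h3 : c * ‖u‖ ≤ ‖x‖ := by
    by_contra hcon
    push Not at hcon
    have : 0 < ‖u‖ := by
      by_contra h0
      have : ‖u‖ = 0 := le_antisymm (not_lt.1 h0) (norm_nonneg _)
      rw [this] at hcon; simp at hcon; linarith [norm_nonneg x]
    nlinarith
  nlinarith [norm_nonneg x, norm_nonneg u]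

/-- The error of ridge regression on noiseless data. -/
lemma abs_inner_ridge_sub_le (v : Fin n → Vec d) {c : ℝ} (hc : 0 < c) (η x : Vec d)
    (hη : ‖η‖ ≤ √(d : ℝ)) :
    |inner ℝ (WithLp.toLp 2 ((gram v c)⁻¹.mulVec
        (∑ τ, inner ℝ (v τ) η • (v τ).ofLp)) : Vec d) x - inner ℝ x η|
      ≤ √(d * c) * matNorm (gram v c)⁻¹ x := by
  -- Noiseless observations sum to `(G - c I) η`, so the estimate is `η - c G⁻¹ η` and only this
  -- bias remains.
  have e0 : ∑ τ, inner ℝ (v τ) η • (v τ).ofLp = (gram v c).mulVec η.ofLp - c • η.ofLp := by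
    simp only [gram, Matrix.add_mulVec, Matrix.sum_mulVec, Matrix.smul_mulVec, Matrix.one_mulVec,
      add_sub_cancel_right, Matrix.vecMulVec_mulVec]
    refine Finset.sum_congr rfl fun τ _ => ?_
    simp [EuclideanSpace.inner_eq_star_dotProduct, dotProduct_comm]
  have e1 : (WithLp.toLp 2 ((gram v c)⁻¹.mulVec (∑ τ, inner ℝ (v τ) η • (v τ).ofLp)) : Vec d)
      = η - c • gramSolve v c η := by
    rw [e0, Matrix.mulVec_sub, Matrix.mulVec_mulVec,
      Matrix.nonsing_inv_mul _ (gram_det_ne_zero v hc), Matrix.one_mulVec, Matrix.mulVec_smul]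
    rfl
  rw [e1, inner_sub_left, real_inner_comm x η, sub_sub_cancel_left, abs_neg,
    ← real_inner_comm]
  refine abs_inner_le_matNorm_mul v hc x _ ?_ (Real.sqrt_nonneg _)
  have h1 := matNorm_sq_eq_gram v hc η
  have h2 := matNorm_gram_inv_sq_le v hc η
  have h3 : ‖η‖ ^ 2 ≤ d := by
    calc ‖η‖ ^ 2 ≤ √(d : ℝ) ^ 2 := by gcongr
      _ = (d : ℝ) := Real.sq_sqrt (by positivity)
  rw [Real.sq_sqrt (by positivity)]
  -- The squared Gram norm of the bias is `c² ‖η‖²` in the inverse norm, hence at most `c ‖η‖² ≤ d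
  -- c`.
  have e2 : c * ‖c • gramSolve v c η‖ ^ 2 + ∑ τ, inner ℝ (v τ) (c • gramSolve v c η) ^ 2
      = c ^ 2 * matNorm (gram v c)⁻¹ η ^ 2 := by
    rw [h1, norm_smul, mul_add, Finset.mul_sum, mul_pow, Real.norm_eq_abs, sq_abs]
    simp only [real_inner_smul_right, mul_pow]
    ring
  rw [e2]
  calc c ^ 2 * matNorm (gram v c)⁻¹ η ^ 2 ≤ c ^ 2 * (‖η‖ ^ 2 / c) := by gcongr
    _ = c * ‖η‖ ^ 2 := by field_simp
    _ ≤ d * c := by nlinarith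

/-- A new observation is a rank-one update, so the matrix determinant lemma applies. -/
lemma gram_snoc_det (v : Fin n → Vec d) {c : ℝ} (hc : 0 < c) (x : Vec d) :
    (gram (Fin.snoc v x : Fin (n + 1) → Vec d) c).det =
      (gram v c).det * (1 + matNorm (gram v c)⁻¹ x ^ 2) := by
  have e : gram (Fin.snoc v x : Fin (n + 1) → Vec d) c =
      gram v c + Matrix.replicateCol Unit x.ofLp * Matrix.replicateRow Unit x.ofLp := by
    simp only [gram, Fin.sum_univ_castSucc, Fin.snoc_castSucc, Fin.snoc_last]
    rw [← Matrix.vecMulVec_eq]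
    abel
  rw [e, Matrix.det_add_replicateCol_mul_replicateRow (gram_det_ne_zero v hc),
    matNorm, Real.sq_sqrt]
  · congr 2
    rw [Matrix.det_unique]
    simp [Matrix.add_apply, Matrix.mul_apply, dotProduct, Matrix.mulVec, Finset.mul_sum,
      Finset.sum_mul]
    rw [Finset.sum_comm]
    exact Finset.sum_congr rfl fun _ _ => Finset.sum_congr rfl fun _ _ => by ring
  · simpa using (gram_posDef v hc).inv.posSemidef.dotProduct_mulVec_nonneg x.ofLp

lemma gram_trace (v : Fin n → Vec d) (c : ℝ) :
    (gram v c).trace = ∑ τ, ‖v τ‖ ^ 2 + d * c := by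
  simp only [EuclideanSpace.real_norm_sq_eq]
  simp [gram, Matrix.trace_add, Matrix.trace_sum, Matrix.trace_vecMulVec, dotProduct, sq,
    mul_comm]

/-- Jensen's inequality for `log` on the eigenvalues bounds the log-determinant by the trace, which
is at most `n + d c` for vectors in the unit ball. -/
lemma log_det_gram_le (v : Fin n → Vec d) {c : ℝ} (hc : 0 < c) (hd : 0 < d)
    (hv : ∀ τ, ‖v τ‖ ≤ 1) :
    Real.log (gram v c).det ≤ d * Real.log (c * (1 + n / (d * c))) := by
  have hd' : (0 : ℝ) < d := by exact_mod_cast hd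
  have hH := gram_isHermitian v c
  have hpos := hH.posDef_iff_eigenvalues_pos.1 (gram_posDef v hc)
  have hdet : (gram v c).det = ∏ i, hH.eigenvalues i := by
    simpa using hH.det_eq_prod_eigenvalues
  have htr : (gram v c).trace = ∑ i, hH.eigenvalues i := by
    simpa using hH.trace_eq_sum_eigenvalues
  rw [hdet, Real.log_prod (fun i _ => (hpos i).ne')]
  have hconc := strictConcaveOn_log_Ioi.concaveOn.le_map_sum (t := Finset.univ)
    (w := fun _ : Fin d => (1 / d : ℝ)) (p := hH.eigenvalues) (fun _ _ => by positivity)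
    (by simp [hd'.ne']) (fun i _ => hpos i)
  simp only [smul_eq_mul, ← Finset.mul_sum, ← htr] at hconc
  have h1 : 0 < (1 / d : ℝ) * (gram v c).trace := by
    rw [gram_trace]
    have : 0 ≤ ∑ τ, ‖v τ‖ ^ 2 := Finset.sum_nonneg fun _ _ => sq_nonneg _
    positivity
  have h2 : (1 / d : ℝ) * (gram v c).trace ≤ c * (1 + n / (d * c)) := by
    rw [gram_trace]
    have : ∑ τ, ‖v τ‖ ^ 2 ≤ n := by
      calc ∑ τ, ‖v τ‖ ^ 2 ≤ ∑ _τ : Fin n, (1 : ℝ) :=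
            Finset.sum_le_sum fun τ _ => by
              have := hv τ; have := norm_nonneg (v τ); nlinarith
        _ = n := by simp
    have e : c * (1 + n / (d * c)) = (1 / d : ℝ) * (n + d * c) := by field_simp; ring
    rw [e]; gcongr
  have h3 := Real.log_le_log h1 h2
  have h4 : (1 / d : ℝ) * ∑ i, Real.log (hH.eigenvalues i) ≤
    Real.log (c * (1 + n / (d * c))) := hconc.trans h3
  rw [one_div, inv_mul_le_iff₀ hd'] at h4
  exact h4

lemma le_two_mul_log_one_add {x : ℝ} (h0 : 0 ≤ x) (h1 : x ≤ 1) : x ≤ 2 * Real.log (1 + x) := by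
  have h := Real.one_sub_inv_le_log_of_pos (show 0 < 1 + x by linarith)
  have : x / 2 ≤ 1 - (1 + x)⁻¹ := by
    rw [← sub_nonneg]
    have e : 1 - (1 + x)⁻¹ - x / 2 = x * (1 - x) / (2 * (1 + x)) := by field_simp; ring
    rw [e]
    have : 0 ≤ 1 - x := by linarith
    positivity
  linarith

lemma gram_zero_det {c : ℝ} (v : Fin 0 → Vec d) : (gram v c).det = c ^ d := by
  simp [gram]

/-- The elliptic potential lemma, in telescoped form. -/
lemma sum_matNorm_sq_le_log_det {c : ℝ} (hc : 1 ≤ c) : ∀ (N : ℕ) (v : Fin N → Vec d),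
    (∀ τ, ‖v τ‖ ≤ 1) →
    ∑ i : Fin N, matNorm (gram (fun j : Fin i => v (j.castLE i.isLt.le)) c)⁻¹ (v i) ^ 2
      ≤ 2 * (Real.log (gram v c).det - d * Real.log c)
  | 0, v, _ => by simp [gram_zero_det]
  | N + 1, v, hv => by
    have hc0 : 0 < c := by linarith
    have ih := sum_matNorm_sq_le_log_det hc N (fun j => v j.castSucc) (fun τ => hv _)
    rw [Fin.sum_univ_castSucc]
    have e1 : (gram v c).det = (gram (fun j : Fin N => v j.castSucc) c).det *
        (1 + matNorm (gram (fun j : Fin N => v j.castSucc) c)⁻¹ (v (Fin.last N)) ^ 2) := by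
      rw [← gram_snoc_det _ hc0]
      congr 2
      exact (Fin.snoc_init_self v).symm
    set z := matNorm (gram (fun j : Fin N => v j.castSucc) c)⁻¹ (v (Fin.last N)) ^ 2 with hz
    have hz0 : 0 ≤ z := sq_nonneg _
    -- The assumption `c ≥ 1` enters here: only increments up to 1 satisfy `z ≤ 2 log (1 + z)`.
    have hz1 : z ≤ 1 := by
      refine (matNorm_gram_inv_sq_le _ hc0 _).trans ?_
      rw [div_le_one hc0]
      have := hv (Fin.last N); have := norm_nonneg (v (Fin.last N)); nlinarith
    rw [e1, Real.log_mul (gram_posDef _ hc0).det_pos.ne' (by positivity)]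
    have h2 := le_two_mul_log_one_add hz0 hz1
    have h3 : matNorm (gram (fun j : Fin (Fin.last N : Fin (N + 1)) =>
        v (j.castLE (Fin.last N).isLt.le)) c)⁻¹ (v (Fin.last N)) ^ 2 = z := rfl
    rw [h3]
    have h4 : ∑ i : Fin N, matNorm (gram (fun j : Fin (i.castSucc : Fin (N + 1)) =>
          v (j.castLE i.castSucc.isLt.le)) c)⁻¹ (v i.castSucc) ^ 2
        = ∑ i : Fin N, matNorm (gram (fun j : Fin i =>
          v (j.castLE i.isLt.le).castSucc) c)⁻¹ (v i.castSucc) ^ 2 := rfl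
    rw [h4]
    linarith

lemma elliptic_potential {c : ℝ} (hc : 1 ≤ c) (hd : 0 < d) {N : ℕ} (v : Fin N → Vec d)
    (hv : ∀ τ, ‖v τ‖ ≤ 1) :
    ∑ i : Fin N, matNorm (gram (fun j : Fin i => v (j.castLE i.isLt.le)) c)⁻¹ (v i) ^ 2
      ≤ 2 * d * Real.log (1 + N / (d * c)) := by
  have hc0 : 0 < c := by linarith
  have h1 := sum_matNorm_sq_le_log_det hc N v hv
  have h2 := log_det_gram_le v hc0 hd hv
  rw [Real.log_mul hc0.ne' (by positivity)] at h2
  linarith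

lemma continuous_gram (c : ℝ) : Continuous fun v : Fin n → Vec d => gram v c := by
  unfold gram
  refine Continuous.add (continuous_finsetSum _ fun τ _ => ?_) continuous_const
  refine continuous_matrix fun i j => ?_
  simp only [Matrix.vecMulVec_apply]
  fun_prop

/-- With the inverse written as adjugate over determinant, the norm is built from continuous
functions and one scalar inversion. -/
lemma measurable_matNorm_gram (c : ℝ) :
    Measurable fun p : (Fin n → Vec d) × Vec d => matNorm (gram p.1 c)⁻¹ p.2 := by
  have e : (fun p : (Fin n → Vec d) × Vec d => matNorm (gram p.1 c)⁻¹ p.2) =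
      fun p => √((gram p.1 c).det⁻¹ *
        (p.2.ofLp ⬝ᵥ (gram p.1 c).adjugate.mulVec p.2.ofLp)) := by
    ext p
    rw [matNorm, Matrix.inv_def, Matrix.smul_mulVec, dotProduct_smul, smul_eq_mul,
      Ring.inverse_eq_inv']
  rw [e]
  have h1 : Continuous fun p : (Fin n → Vec d) × Vec d => (gram p.1 c).det :=
    ((continuous_gram c).comp continuous_fst).matrix_det
  have h2 : Continuous fun p : (Fin n → Vec d) × Vec d =>
      p.2.ofLp ⬝ᵥ (gram p.1 c).adjugate.mulVec p.2.ofLp := by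
    refine Continuous.dotProduct (by fun_prop) (Continuous.matrix_mulVec ?_ (by fun_prop))
    exact ((continuous_gram c).comp continuous_fst).matrix_adjugate
  exact (h1.measurable.inv.mul h2.measurable).sqrt

end LinearAlgebra

/-! ### Measurability and integration for composed laws -/

section GiryMonad

variable {X Y Z : Type*} [MeasurableSpace X] [MeasurableSpace Y] [MeasurableSpace Z]

/-- Laws of trajectories and runs are iterated `bind`s of plain functions, and `bind` along a
non-measurable function collapses to the zero measure. Measurability in the parameters must
therefore be carried through every layer. -/
lemma measurable_bind_prod {κ : X → Measure Y} (hκ : Measurable κ)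
    (hp : ∀ x, IsProbabilityMeasure (κ x)) {f : X × Y → Measure Z} (hf : Measurable f) :
    Measurable fun x => (κ x).bind fun y => f (x, y) := by
  refine Measure.measurable_of_measurable_coe _ fun s hs => ?_
  let k : Kernel X Y := ⟨κ, hκ⟩
  have : IsMarkovKernel k := ⟨hp⟩
  have e : ∀ x, (κ x).bind (fun y => f (x, y)) s = ∫⁻ y, f (x, y) s ∂(k x) := fun x =>
    Measure.bind_apply hs (hf.comp (by fun_prop)).aemeasurable
  simp_rw [e]
  exact Measurable.lintegral_kernel_prod_right' (f := fun p : X × Y => f p s)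
    ((Measure.measurable_coe hs).comp hf)

lemma measurable_map_prod {κ : X → Measure Y} (hκ : Measurable κ)
    (hp : ∀ x, IsProbabilityMeasure (κ x)) {F : X × Y → Z} (hF : Measurable F) :
    Measurable fun x => (κ x).map fun y => F (x, y) := by
  have e : ∀ x, (κ x).map (fun y => F (x, y)) = (κ x).bind fun y => Measure.dirac (F (x, y)) :=
    fun x => (Measure.bind_dirac_eq_map _ (hF.comp (by fun_prop))).symm
  simp_rw [e]
  exact measurable_bind_prod hκ hp (f := fun p => Measure.dirac (F p))
    (Measure.measurable_dirac.comp hF)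

lemma isProbabilityMeasure_bind_of_measurable {μ : Measure X} [IsProbabilityMeasure μ]
    {f : X → Measure Y} (hf : Measurable f) (hp : ∀ x, IsProbabilityMeasure (f x)) :
    IsProbabilityMeasure (μ.bind f) := by
  constructor
  rw [Measure.bind_apply MeasurableSet.univ hf.aemeasurable]
  simp

/-- The three layers are those of one step of an episode: action, next state, remaining trajectory.
-/
lemma bind_bind_measurable_and_prob {V : Type*} [MeasurableSpace V] {κ₁ : X → Measure Y}
    (h₁ : Measurable κ₁) (p₁ : ∀ x, IsProbabilityMeasure (κ₁ x)) {κ₂ : X × Y → Measure Z}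
    (h₂ : Measurable κ₂) (p₂ : ∀ x, IsProbabilityMeasure (κ₂ x)) {κ₃ : (X × Y) × Z → Measure V}
    (h₃ : Measurable κ₃) (p₃ : ∀ x, IsProbabilityMeasure (κ₃ x)) :
    (Measurable fun x => (κ₁ x).bind fun y => (κ₂ (x, y)).bind fun z => κ₃ ((x, y), z)) ∧
    ∀ x, IsProbabilityMeasure
      ((κ₁ x).bind fun y => (κ₂ (x, y)).bind fun z => κ₃ ((x, y), z)) := by
  have m : Measurable fun q : X × Y => (κ₂ q).bind fun z => κ₃ (q, z) :=
    measurable_bind_prod h₂ p₂ h₃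
  refine ⟨measurable_bind_prod h₁ p₁ (f := fun q : X × Y => (κ₂ q).bind fun z => κ₃ (q, z)) m,
    fun x => ?_⟩
  have p : ∀ y, IsProbabilityMeasure ((κ₂ (x, y)).bind fun z => κ₃ ((x, y), z)) := fun y => by
    have := p₂ (x, y)
    exact isProbabilityMeasure_bind_of_measurable (f := fun z => κ₃ ((x, y), z))
      (h₃.comp measurable_prodMk_left) fun z => p₃ ((x, y), z)
  have hx := p₁ x
  have m' : Measurable fun y => (κ₂ (x, y)).bind fun z => κ₃ ((x, y), z) :=
    m.comp (f := fun y => (x, y)) measurable_prodMk_left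
  exact isProbabilityMeasure_bind_of_measurable m' p

lemma integral_bind_of_measurable {μ : Measure X} [IsProbabilityMeasure μ]
    {f : X → Measure Y} (hf : Measurable f) (hp : ∀ x, IsProbabilityMeasure (f x))
    {F : Y → ℝ} (hF : Measurable F) {C : ℝ} (hC : ∀ y, |F y| ≤ C) :
    ∫ y, F y ∂(μ.bind f) = ∫ x, ∫ y, F y ∂(f x) ∂μ := by
  let k : Kernel X Y := ⟨f, hf⟩
  have : IsMarkovKernel k := ⟨hp⟩
  have hb := isProbabilityMeasure_bind_of_measurable (μ := μ) hf hp
  have e : (k ∘ₖ Kernel.const Unit μ) () = μ.bind f := by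
    rw [Kernel.comp_apply]; rfl
  have hint : Integrable F ((k ∘ₖ Kernel.const Unit μ) ()) := by
    rw [e]
    exact Integrable.of_bound hF.aestronglyMeasurable C (ae_of_all _ hC)
  have := Kernel.integral_comp hint
  rw [e] at this
  exact this

end GiryMonad

/-! ### Trajectory laws and expected sums along them -/

section

variable {S A : Type*} {H : ℕ}

lemma abs_sum_traj_le {f : Fin H → S → A → ℝ} {C : ℝ} (hC : ∀ h s a, |f h s a| ≤ C)
    (τ : Traj H S A) : |∑ h, f h (τ h).1 (τ h).2.1| ≤ H * C := by
  refine (Finset.abs_sum_le_sum_abs _ _).trans ?_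
  refine (Finset.sum_le_sum fun h _ => hC h _ _).trans ?_
  simp

end

section Trajectories

variable {X W S A : Type*} [MeasurableSpace X] [MeasurableSpace W] [MeasurableSpace S]
  [MeasurableSpace A]

lemma measurable_fin_cons {H : ℕ} {f : X → S × A × S} {g : X → Traj H S A} (hf : Measurable f)
    (hg : Measurable g) :
    Measurable fun x => (Fin.cons (f x) (g x) : Fin (H + 1) → S × A × S) := by
  refine measurable_pi_iff.2 fun i => ?_
  refine Fin.cases ?_ (fun j => ?_) i
  · simpa using hf
  · simpa using measurable_pi_iff.1 hg j

lemma measurable_fin_snoc {E : Type*} [MeasurableSpace E] {n : ℕ} {f : X → Fin n → E} {g : X → E}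
    (hf : Measurable f) (hg : Measurable g) :
    Measurable fun x => (Fin.snoc (f x) (g x) : Fin (n + 1) → E) := by
  refine measurable_pi_iff.2 fun i => ?_
  refine Fin.lastCases ?_ (fun j => ?_) i
  · simpa using hg
  · simpa using measurable_pi_iff.1 hf j

/-- The parameter `X` will hold data and context, on which the policy of an episode depends.
Measurability and total mass one are proved together because each induction step uses both. -/
lemma trajLaw_measurable_and_prob (H : ℕ) : ∀ (P : Fin H → X → Kernel (S × A) S)
    (π : Fin H → X → Kernel S A),
    (∀ h, Measurable fun p : X × S × A => P h p.1 p.2) →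
    (∀ h, Measurable fun p : X × S => π h p.1 p.2) →
    (∀ h x, IsMarkovKernel (P h x)) → (∀ h x, IsMarkovKernel (π h x)) →
    (Measurable fun p : X × S => trajLaw H (fun h => P h p.1) (fun h => π h p.1) p.2) ∧
    ∀ x s, IsProbabilityMeasure (trajLaw H (fun h => P h x) (fun h => π h x) s) := by
  induction H with
  | zero =>
    intro P π _ _ _ _
    refine ⟨?_, fun x s => ?_⟩
    · simp only [trajLaw]; exact measurable_const
    · simp only [trajLaw]; infer_instance
  | succ H ih =>
    intro P π hP hπ hPm hπm
    obtain ⟨ih1, ih2⟩ := ih (fun h => P h.succ) (fun h => π h.succ)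
      (fun h => hP _) (fun h => hπ _) (fun h => hPm _) (fun h => hπm _)
    have m1 : Measurable fun q : (((X × S) × A) × S) =>
        (trajLaw H (fun h => P h.succ q.1.1.1) (fun h => π h.succ q.1.1.1) q.2).map fun τ =>
          (Fin.cons (q.1.1.2, q.1.2, q.2) τ : Fin (H + 1) → S × A × S) := by
      refine measurable_map_prod (X := ((X × S) × A) × S)
        (κ := fun q => trajLaw H (fun h => P h.succ q.1.1.1) (fun h => π h.succ q.1.1.1) q.2)
        (F := fun p : (((X × S) × A) × S) × Traj H S A =>
          (Fin.cons (p.1.1.1.2, p.1.1.2, p.1.2) p.2 : Fin (H + 1) → S × A × S))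
        (ih1.comp (g := fun p : X × S => _)
          (f := fun q : (((X × S) × A) × S) => (q.1.1.1, q.2)) (by fun_prop))
        (fun q => ih2 _ _) ?_
      exact measurable_fin_cons (by fun_prop) (by fun_prop)
    have p1 : ∀ q : (((X × S) × A) × S), IsProbabilityMeasure
        ((trajLaw H (fun h => P h.succ q.1.1.1) (fun h => π h.succ q.1.1.1) q.2).map fun τ =>
          (Fin.cons (q.1.1.2, q.1.2, q.2) τ : Fin (H + 1) → S × A × S)) := fun q => by
      have := ih2 q.1.1.1 q.2
      exact Measure.isProbabilityMeasure_map
        (measurable_fin_cons (by fun_prop) (by fun_prop)).aemeasurable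
    have key := bind_bind_measurable_and_prob (hπ 0) (fun q => (hπm 0 _).isProbabilityMeasure _)
      (κ₂ := fun q : (X × S) × A => P 0 q.1.1 (q.1.2, q.2))
      ((hP 0).comp (g := fun p : X × S × A => _)
          (f := fun q : (X × S) × A => (q.1.1, q.1.2, q.2)) (by fun_prop))
      (fun q => (hPm 0 _).isProbabilityMeasure _) m1 p1
    exact ⟨key.1, fun x s => key.2 (x, s)⟩

variable {H : ℕ}

lemma measurable_trajLaw (P : Fin H → Kernel (S × A) S) (π : Fin H → Kernel S A)
    [∀ h, IsMarkovKernel (P h)] [∀ h, IsMarkovKernel (π h)] : Measurable (trajLaw H P π) := by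
  have := (trajLaw_measurable_and_prob (X := Unit) H (fun h _ => P h) (fun h _ => π h)
    (fun h => (P h).measurable.comp measurable_snd) (fun h => (π h).measurable.comp measurable_snd)
    (fun _ _ => inferInstance) (fun _ _ => inferInstance)).1
  exact this.comp (f := fun s => ((), s)) (by fun_prop)

instance isProbabilityMeasure_trajLaw (P : Fin H → Kernel (S × A) S) (π : Fin H → Kernel S A)
    [∀ h, IsMarkovKernel (P h)] [∀ h, IsMarkovKernel (π h)] (s : S) :
    IsProbabilityMeasure (trajLaw H P π s) :=
  (trajLaw_measurable_and_prob (X := Unit) H (fun h _ => P h) (fun h _ => π h)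
    (fun h => (P h).measurable.comp measurable_snd) (fun h => (π h).measurable.comp measurable_snd)
    (fun _ _ => inferInstance) (fun _ _ => inferInstance)).2 () s

/-- Expected sum of `f h (s_h, a_h)` along a trajectory. -/
noncomputable def expSum (P : Fin H → Kernel (S × A) S) (π : Fin H → Kernel S A)
    (f : Fin H → S → A → ℝ) (s : S) : ℝ :=
  ∫ τ, ∑ h, f h (τ h).1 (τ h).2.1 ∂(trajLaw H P π s)

lemma measurable_sum_traj {f : Fin H → S → A → ℝ}
    (hf : ∀ h, Measurable (Function.uncurry (f h))) :
    Measurable fun τ : Traj H S A => ∑ h, f h (τ h).1 (τ h).2.1 :=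
  Finset.measurable_sum _ fun h _ => (hf h).comp (f := fun τ : Traj H S A => ((τ h).1, (τ h).2.1))
    (by fun_prop)

lemma integrable_sum_traj (P : Fin H → Kernel (S × A) S) (π : Fin H → Kernel S A)
    [∀ h, IsMarkovKernel (P h)] [∀ h, IsMarkovKernel (π h)] {f : Fin H → S → A → ℝ}
    (hf : ∀ h, Measurable (Function.uncurry (f h))) {C : ℝ} (hC : ∀ h s a, |f h s a| ≤ C) (s : S) :
    Integrable (fun τ : Traj H S A => ∑ h, f h (τ h).1 (τ h).2.1) (trajLaw H P π s) :=
  Integrable.of_bound (measurable_sum_traj hf).aestronglyMeasurable (H * C)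
    (ae_of_all _ (abs_sum_traj_le hC))

lemma measurable_expSum (P : Fin H → Kernel (S × A) S) (π : Fin H → Kernel S A)
    [∀ h, IsMarkovKernel (P h)] [∀ h, IsMarkovKernel (π h)] {f : Fin H → S → A → ℝ}
    (hf : ∀ h, Measurable (Function.uncurry (f h))) : Measurable (expSum P π f) := by
  let k : Kernel S (Traj H S A) := ⟨trajLaw H P π, measurable_trajLaw P π⟩
  have : IsMarkovKernel k := ⟨fun s => isProbabilityMeasure_trajLaw P π s⟩
  have := StronglyMeasurable.integral_kernel_prod_right' (κ := k)
    (f := fun p : S × Traj H S A => ∑ h, f h (p.2 h).1 (p.2 h).2.1)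
    ((measurable_sum_traj hf).comp measurable_snd).stronglyMeasurable
  exact this.measurable

lemma measurable_trajLaw_map_cons (P : Fin H → Kernel (S × A) S) (π : Fin H → Kernel S A)
    [∀ h, IsMarkovKernel (P h)] [∀ h, IsMarkovKernel (π h)] (s : S) (a : A) :
    Measurable fun s' => (trajLaw H P π s').map fun τ =>
      (Fin.cons (s, a, s') τ : Fin (H + 1) → S × A × S) :=
  measurable_map_prod (measurable_trajLaw P π) (fun _ => inferInstance)
    (F := fun p : S × Traj H S A => (Fin.cons (s, a, p.1) p.2 : Fin (H + 1) → S × A × S))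
    (measurable_fin_cons (by fun_prop) (by fun_prop))

lemma isProbabilityMeasure_trajLaw_map_cons (P : Fin H → Kernel (S × A) S)
    (π : Fin H → Kernel S A) [∀ h, IsMarkovKernel (P h)] [∀ h, IsMarkovKernel (π h)] (s : S)
    (a : A) (s' : S) : IsProbabilityMeasure ((trajLaw H P π s').map fun τ =>
      (Fin.cons (s, a, s') τ : Fin (H + 1) → S × A × S)) :=
  Measure.isProbabilityMeasure_map (measurable_fin_cons (by fun_prop) (by fun_prop)).aemeasurable

variable [Finite A] [MeasurableSingletonClass A]

lemma lintegral_trajLaw_succ (P : Fin (H + 1) → Kernel (S × A) S)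
    (π : Fin (H + 1) → Kernel S A) [∀ h, IsMarkovKernel (P h)] [∀ h, IsMarkovKernel (π h)] (s : S)
    {F : Traj (H + 1) S A → ℝ≥0∞} (hF : Measurable F) :
    ∫⁻ τ, F τ ∂(trajLaw (H + 1) P π s) = ∫⁻ a, ∫⁻ s', ∫⁻ τ, F (Fin.cons (s, a, s') τ)
      ∂(trajLaw H (fun h => P h.succ) (fun h => π h.succ) s') ∂(P 0 (s, a)) ∂(π 0 s) := by
  rw [trajLaw, Measure.lintegral_bind (measurable_of_countable _).aemeasurable hF.aemeasurable]
  refine lintegral_congr fun a => ?_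
  rw [Measure.lintegral_bind (measurable_trajLaw_map_cons _ _ s a).aemeasurable hF.aemeasurable]
  refine lintegral_congr fun s' => ?_
  exact lintegral_map hF (measurable_fin_cons (by fun_prop) (by fun_prop))

lemma integral_trajLaw_succ (P : Fin (H + 1) → Kernel (S × A) S)
    (π : Fin (H + 1) → Kernel S A) [∀ h, IsMarkovKernel (P h)] [∀ h, IsMarkovKernel (π h)] (s : S)
    {F : Traj (H + 1) S A → ℝ} (hF : Measurable F) {C : ℝ} (hC : ∀ τ, |F τ| ≤ C) :
    ∫ τ, F τ ∂(trajLaw (H + 1) P π s) = ∫ a, ∫ s', ∫ τ, F (Fin.cons (s, a, s') τ)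
      ∂(trajLaw H (fun h => P h.succ) (fun h => π h.succ) s') ∂(P 0 (s, a)) ∂(π 0 s) := by
  have hp := isProbabilityMeasure_trajLaw_map_cons (fun h => P h.succ) (fun h => π h.succ) s
  have hm := measurable_trajLaw_map_cons (fun h => P h.succ) (fun h => π h.succ) s
  rw [trajLaw, integral_bind_of_measurable (measurable_of_countable _)
    (fun a => isProbabilityMeasure_bind_of_measurable (hm a) (hp a)) hF hC]
  refine integral_congr_ae (ae_of_all _ fun a => ?_)
  simp only
  rw [integral_bind_of_measurable (hm a) (hp a) hF hC]
  refine integral_congr_ae (ae_of_all _ fun s' => ?_)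
  exact integral_map (measurable_fin_cons (by fun_prop) (by fun_prop)).aemeasurable
    hF.aestronglyMeasurable

/-- Whatever policy leads to step `h`, the weight has mean at most 1 given the state and action
reached there. -/
lemma lintegral_trajLaw_step_le_one : ∀ {H : ℕ} (P : Fin H → Kernel (S × A) S)
    (π : Fin H → Kernel S A) [∀ h, IsMarkovKernel (P h)] [∀ h, IsMarkovKernel (π h)] (s : S)
    (h : Fin H) {f : S × A × S → ℝ≥0∞} (_ : Measurable f)
    (_ : ∀ s a, ∫⁻ s', f (s, a, s') ∂(P h (s, a)) ≤ 1),
    ∫⁻ τ, f (τ h) ∂(trajLaw H P π s) ≤ 1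
  | 0, _, _, _, _, _, h, _, _, _ => h.elim0
  | H + 1, P, π, _, _, s, h, f, hf, hle => by
    rw [lintegral_trajLaw_succ P π s (F := fun τ => f (τ h)) (hf.comp (measurable_pi_apply h))]
    refine (lintegral_mono fun a => (?_ : _ ≤ (1 : ℝ≥0∞))).trans (by simp)
    revert hle
    refine Fin.cases (fun hle => ?_) (fun j hle => ?_) h
    · simpa using hle s a
    · refine (lintegral_mono fun s' => (?_ : _ ≤ (1 : ℝ≥0∞))).trans (by simp)
      simpa using lintegral_trajLaw_step_le_one (fun h => P h.succ) (fun h => π h.succ) s' j hf hle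

/-- The Bellman equation of policy evaluation, which puts the true value in the recursive form of
`truncValue`. -/
lemma expSum_succ (P : Fin (H + 1) → Kernel (S × A) S) (π : Fin (H + 1) → Kernel S A)
    [∀ h, IsMarkovKernel (P h)] [∀ h, IsMarkovKernel (π h)] {f : Fin (H + 1) → S → A → ℝ}
    (hf : ∀ h, Measurable (Function.uncurry (f h))) {C : ℝ} (hC : ∀ h s a, |f h s a| ≤ C) (s : S) :
    expSum P π f s = ∫ a, (f 0 s a + ∫ s', expSum (fun h => P h.succ) (fun h => π h.succ)
      (fun h => f h.succ) s' ∂(P 0 (s, a))) ∂(π 0 s) := by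
  rw [expSum, integral_trajLaw_succ P π s (measurable_sum_traj hf) (abs_sum_traj_le hC)]
  refine integral_congr_ae (ae_of_all _ fun a => ?_)
  simp only [Fin.sum_univ_succ, Fin.cons_zero, Fin.cons_succ]
  have hC' : ∀ (h : Fin H) s a, |f h.succ s a| ≤ C := fun h => hC _
  have hint := fun s' => integrable_sum_traj (fun h => P h.succ) (fun h => π h.succ)
    (fun h => hf h.succ) hC' s'
  have e : ∀ s', ∫ τ, (f 0 s a + ∑ h : Fin H, f h.succ (τ h).1 (τ h).2.1)
      ∂(trajLaw H (fun h => P h.succ) (fun h => π h.succ) s') =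
      f 0 s a + expSum (fun h => P h.succ) (fun h => π h.succ) (fun h => f h.succ) s' := by
    intro s'
    rw [integral_add (integrable_const _) (hint s')]
    simp [expSum]
  simp_rw [e]
  rw [integral_add (integrable_const _)]
  · simp
  · refine Integrable.of_bound
      (measurable_expSum _ _ (fun h => hf h.succ)).aestronglyMeasurable (H * C)
      (ae_of_all _ fun s' => ?_)
    refine (norm_integral_le_of_norm_le_const (ae_of_all _ (abs_sum_traj_le hC'))).trans ?_
    simp

end Trajectories

/-! ### The law of the run and its supermartingales -/

section Run

variable {H d : ℕ} {W S A : Type*} [MeasurableSpace W] [MeasurableSpace S] [MeasurableSpace A]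

instance (M : CMDP H W S A) : IsProbabilityMeasure M.q := M.q_prob

instance (M : CMDP H W S A) (h : Fin H) : IsMarkovKernel (M.P h) := M.P_markov h

instance (M : CMDP H W S A) (w : W) (h : Fin H) : IsMarkovKernel (M.transAt w h) := by
  unfold CMDP.transAt; infer_instance

instance (π : Policy H S A) (h : Fin H) : IsMarkovKernel (π.kernel h) := π.markov h

instance (M : CMDP H W S A) (w : W) (π : Policy H S A) :
    IsProbabilityMeasure (M.episodeLaw w π) := by
  unfold CMDP.episodeLaw; infer_instance

lemma measurable_episodeLaw (M : CMDP H W S A) (L : Learner H d W S A) (n : ℕ) :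
    Measurable fun p : (Fin n → Episode H W S A) × W =>
      M.episodeLaw p.2 (L.policy n p.1 p.2) := by
  have := (trajLaw_measurable_and_prob (X := (Fin n → Episode H W S A) × W) H
    (fun h x => M.transAt x.2 h) (fun h x => (L.policy n x.1 x.2).kernel h)
    (fun h => (M.P h).measurable.comp
      (f := fun p : ((Fin n → Episode H W S A) × W) × S × A => (p.2.1, p.2.2, p.1.2))
      (by fun_prop))
    (fun h => (L.kernel n h).measurable.comp
      (f := fun p : ((Fin n → Episode H W S A) × W) × S => p) (by fun_prop))
    (fun _ _ => inferInstance) (fun _ _ => inferInstance)).1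
  exact this.comp (f := fun p : (Fin n → Episode H W S A) × W => (p, M.s₁)) (by fun_prop)

/-- The law of episode `n + 1` given the data of the first `n` episodes. -/
noncomputable def Learner.stepLaw (L : Learner H d W S A) (M : CMDP H W S A) (n : ℕ) :
    Kernel (Fin n → Episode H W S A) (Episode H W S A) where
  toFun D := M.q.bind fun w => (M.episodeLaw w (L.policy n D w)).map fun τ => (w, τ)
  measurable' := by
    refine measurable_bind_prod (X := Fin n → Episode H W S A) (κ := fun _ => M.q)
      (f := fun p => (M.episodeLaw p.2 (L.policy n p.1 p.2)).map fun τ => (p.2, τ))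
      measurable_const (fun _ => inferInstance) ?_
    exact measurable_map_prod (κ := fun p : (Fin n → Episode H W S A) × W =>
      M.episodeLaw p.2 (L.policy n p.1 p.2)) (F := fun p => (p.1.2, p.2))
      (measurable_episodeLaw M L n) (fun _ => inferInstance) (by fun_prop)

lemma Learner.stepLaw_apply (L : Learner H d W S A) (M : CMDP H W S A) (n : ℕ)
    (D : Fin n → Episode H W S A) :
    L.stepLaw M n D = M.q.bind fun w => (M.episodeLaw w (L.policy n D w)).map fun τ => (w, τ) :=
  rfl

lemma Learner.measurable_stepLaw_aux (L : Learner H d W S A) (M : CMDP H W S A) (n : ℕ)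
    (D : Fin n → Episode H W S A) :
    Measurable fun w => (M.episodeLaw w (L.policy n D w)).map fun τ => (w, τ) :=
  measurable_map_prod (κ := fun w => M.episodeLaw w (L.policy n D w)) (F := fun p => p)
      ((measurable_episodeLaw M L n).comp (f := fun w => (D, w)) (by fun_prop))
      (fun _ => inferInstance) measurable_id

lemma isProbabilityMeasure_map_context (M : CMDP H W S A) (w : W) (π : Policy H S A) :
    IsProbabilityMeasure ((M.episodeLaw w π).map fun τ => (w, τ)) :=
  Measure.isProbabilityMeasure_map (by fun_prop)

instance (L : Learner H d W S A) (M : CMDP H W S A) (n : ℕ) : IsMarkovKernel (L.stepLaw M n) :=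
  ⟨fun D => isProbabilityMeasure_bind_of_measurable (L.measurable_stepLaw_aux M n D)
    fun w => isProbabilityMeasure_map_context M w _⟩

lemma Learner.lintegral_stepLaw (L : Learner H d W S A) (M : CMDP H W S A) (n : ℕ)
    (D : Fin n → Episode H W S A) {F : Episode H W S A → ℝ≥0∞} (hF : Measurable F) :
    ∫⁻ e, F e ∂(L.stepLaw M n D) =
      ∫⁻ w, ∫⁻ τ, F (w, τ) ∂(M.episodeLaw w (L.policy n D w)) ∂M.q := by
  rw [L.stepLaw_apply, Measure.lintegral_bind (L.measurable_stepLaw_aux M n D).aemeasurable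
    hF.aemeasurable]
  exact lintegral_congr fun w => lintegral_map hF (by fun_prop)

lemma Learner.integral_stepLaw (L : Learner H d W S A) (M : CMDP H W S A) (n : ℕ)
    (D : Fin n → Episode H W S A) {F : Episode H W S A → ℝ} (hF : Measurable F) {C : ℝ}
    (hC : ∀ e, |F e| ≤ C) :
    ∫ e, F e ∂(L.stepLaw M n D) =
      ∫ w, ∫ τ, F (w, τ) ∂(M.episodeLaw w (L.policy n D w)) ∂M.q := by
  rw [L.stepLaw_apply, integral_bind_of_measurable (L.measurable_stepLaw_aux M n D)
    (fun w => isProbabilityMeasure_map_context M w _) hF hC]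
  refine integral_congr_ae (ae_of_all _ fun w => ?_)
  exact integral_map (by fun_prop) hF.aestronglyMeasurable

lemma Learner.measurable_integral_episodeLaw (L : Learner H d W S A) (M : CMDP H W S A) (n : ℕ)
    (D : Fin n → Episode H W S A) {F : Episode H W S A → ℝ} (hF : Measurable F) :
    Measurable fun w => ∫ τ, F (w, τ) ∂(M.episodeLaw w (L.policy n D w)) := by
  let k : Kernel W (Traj H S A) := ⟨fun w => M.episodeLaw w (L.policy n D w),
    (measurable_episodeLaw M L n).comp (f := fun w => (D, w)) (by fun_prop)⟩
  have : IsMarkovKernel k :=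
    ⟨fun w => inferInstanceAs (IsProbabilityMeasure (M.episodeLaw w (L.policy n D w)))⟩
  exact (StronglyMeasurable.integral_kernel_prod_right' (κ := k)
    hF.stronglyMeasurable).measurable

/-- Grouping context and trajectory into one kernel step makes the run an adaptive process, to which
supermartingale arguments apply episode by episode. -/
lemma Learner.runLaw_succ (L : Learner H d W S A) (M : CMDP H W S A) (n : ℕ) :
    L.runLaw M (n + 1) = (L.runLaw M n).bind fun D => (L.stepLaw M n D).map fun e =>
      (Fin.snoc D e : Fin (n + 1) → Episode H W S A) := by
  rw [runLaw]
  congr 1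
  funext D
  ext s hs
  have hsn : Measurable fun e : Episode H W S A =>
      (Fin.snoc D e : Fin (n + 1) → Episode H W S A) :=
    measurable_fin_snoc measurable_const measurable_id
  rw [Measure.map_apply hsn hs, L.stepLaw_apply,
    Measure.bind_apply (hsn hs) (L.measurable_stepLaw_aux M n D).aemeasurable,
    Measure.bind_apply hs]
  · refine lintegral_congr fun w => ?_
    have hw : Measurable fun τ : Traj H S A =>
        (Fin.snoc D (w, τ) : Fin (n + 1) → Episode H W S A) :=
      hsn.comp (f := fun τ : Traj H S A => (w, τ)) (by fun_prop)
    rw [Measure.map_apply hw hs, Measure.map_apply (by fun_prop) (hsn hs)]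
    rfl
  · exact (measurable_map_prod (κ := fun w => M.episodeLaw w (L.policy n D w))
      (F := fun p => (Fin.snoc D p : Fin (n + 1) → Episode H W S A))
      ((measurable_episodeLaw M L n).comp (f := fun w => (D, w)) (by fun_prop))
      (fun _ => inferInstance) hsn).aemeasurable

lemma Learner.measurable_map_snoc (L : Learner H d W S A) (M : CMDP H W S A) (n : ℕ) :
    Measurable fun D => (L.stepLaw M n D).map fun e =>
      (Fin.snoc D e : Fin (n + 1) → Episode H W S A) :=
  measurable_map_prod (L.stepLaw M n).measurable (fun _ => inferInstance)
    (F := fun p => (Fin.snoc p.1 p.2 : Fin (n + 1) → Episode H W S A))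
    (measurable_fin_snoc measurable_fst measurable_snd)

instance (L : Learner H d W S A) (M : CMDP H W S A) (n : ℕ) :
    IsProbabilityMeasure (L.runLaw M n) := by
  induction n with
  | zero => rw [Learner.runLaw]; infer_instance
  | succ n ih =>
    rw [L.runLaw_succ]
    exact isProbabilityMeasure_bind_of_measurable (L.measurable_map_snoc M n) fun D =>
      Measure.isProbabilityMeasure_map
        (measurable_fin_snoc measurable_const measurable_id).aemeasurable

lemma Learner.lintegral_runLaw_succ (L : Learner H d W S A) (M : CMDP H W S A) (n : ℕ)
    {F : (Fin (n + 1) → Episode H W S A) → ℝ≥0∞} (hF : Measurable F) :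
    ∫⁻ x, F x ∂(L.runLaw M (n + 1)) =
      ∫⁻ D, ∫⁻ e, F (Fin.snoc D e) ∂(L.stepLaw M n D) ∂(L.runLaw M n) := by
  rw [L.runLaw_succ, Measure.lintegral_bind (L.measurable_map_snoc M n).aemeasurable
    hF.aemeasurable]
  exact lintegral_congr fun D => lintegral_map hF
    (measurable_fin_snoc measurable_const measurable_id)

/-- The first `i` entries of `x`. -/
def pre {E : Type*} {N : ℕ} (x : Fin N → E) (i : Fin N) : Fin i → E :=
  fun j => x (j.castLE i.isLt.le)

lemma measurable_pre {E : Type*} [MeasurableSpace E] {N : ℕ} (i : Fin N) :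
    Measurable fun x : Fin N → E => pre x i :=
  measurable_pi_iff.2 fun _ => measurable_pi_apply _

lemma pre_snoc_castSucc {E : Type*} {n : ℕ} (D : Fin n → E) (e : E) (i : Fin n) :
    pre (Fin.snoc D e : Fin (n + 1) → E) i.castSucc = pre D i := by
  funext j
  exact Fin.snoc_castSucc (α := fun _ => E) e D (j.castLE i.isLt.le)

lemma pre_snoc_last {E : Type*} {n : ℕ} (D : Fin n → E) (e : E) :
    pre (Fin.snoc D e : Fin (n + 1) → E) (Fin.last n) = D := by
  funext j
  exact Fin.snoc_castSucc (α := fun _ => E) e D j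

/-- The product of conditional weights of mean at most one has mean at most one. -/
lemma Learner.lintegral_prod_le_one (L : Learner H d W S A) (M : CMDP H W S A)
    {g : (i : ℕ) → (Fin i → Episode H W S A) → Episode H W S A → ℝ≥0∞}
    (hg : ∀ i, Measurable (Function.uncurry (g i)))
    (hle : ∀ i D, ∫⁻ e, g i D e ∂(L.stepLaw M i D) ≤ 1) (N : ℕ) :
    ∫⁻ x, ∏ i : Fin N, g i (pre x i) (x i) ∂(L.runLaw M N) ≤ 1 := by
  have hmeas : ∀ N : ℕ, Measurable fun x : Fin N → Episode H W S A =>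
      ∏ i : Fin N, g i (pre x i) (x i) := fun N =>
    Finset.measurable_prod _ fun i _ => (hg i).comp
      (f := fun x : Fin N → Episode H W S A => (pre x i, x i))
      ((measurable_pre i).prodMk (measurable_pi_apply i))
  induction N with
  | zero => simp
  | succ N ih =>
    rw [L.lintegral_runLaw_succ M N (hmeas _)]
    refine le_trans (lintegral_mono fun D => ?_) ih
    have e : ∀ e, ∏ i : Fin (N + 1), g i (pre (Fin.snoc D e : Fin (N + 1) → _) i)
        ((Fin.snoc D e : Fin (N + 1) → Episode H W S A) i) =
        (∏ i : Fin N, g i (pre D i) (D i)) * g N D e := by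
      intro e
      rw [Fin.prod_univ_castSucc]
      congr 1
      · refine Finset.prod_congr rfl fun i _ => ?_
        rw [pre_snoc_castSucc, Fin.snoc_castSucc]; rfl
      · rw [pre_snoc_last, Fin.snoc_last]; rfl
    simp_rw [e]
    have hgD : Measurable (g N D) := (hg N).comp (f := fun e => (D, e)) measurable_prodMk_left
    rw [lintegral_const_mul _ hgD]
    exact (mul_le_mul_right (hle N D) _).trans (by simp)

/-- Markov's inequality for products of conditional weights. -/
lemma Learner.measure_prod_ge_le (L : Learner H d W S A) (M : CMDP H W S A)
    {g : (i : ℕ) → (Fin i → Episode H W S A) → Episode H W S A → ℝ≥0∞}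
    (hg : ∀ i, Measurable (Function.uncurry (g i)))
    (hle : ∀ i D, ∫⁻ e, g i D e ∂(L.stepLaw M i D) ≤ 1) (N : ℕ) (t : ℝ) :
    L.runLaw M N {x | ENNReal.ofReal (Real.exp t) ≤ ∏ i : Fin N, g i (pre x i) (x i)} ≤
      ENNReal.ofReal (Real.exp (-t)) := by
  have hmeas : Measurable fun x : Fin N → Episode H W S A =>
      ∏ i : Fin N, g i (pre x i) (x i) :=
    Finset.measurable_prod _ fun i _ => (hg i).comp
      (f := fun x : Fin N → Episode H W S A => (pre x i, x i))
      ((measurable_pre i).prodMk (measurable_pi_apply i))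
  have h := mul_meas_ge_le_lintegral (μ := L.runLaw M N) hmeas (ENNReal.ofReal (Real.exp t))
  have h2 := h.trans (L.lintegral_prod_le_one M hg hle N)
  rw [Real.exp_neg, ENNReal.ofReal_inv_of_pos (Real.exp_pos t)]
  rw [ENNReal.le_inv_iff_mul_le, mul_comm]
  exact h2

/-- A lower-tail Bernstein bound: with high probability the sum of the conditional means of
`[0, 1]`-valued observations is at most twice the sum of the observations, up to a constant. -/
lemma Learner.measure_sum_integral_gt_le (L : Learner H d W S A) (M : CMDP H W S A)
    {z : (i : ℕ) → (Fin i → Episode H W S A) → Episode H W S A → ℝ}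
    (hz : ∀ i, Measurable (Function.uncurry (z i))) (hz01 : ∀ i D e, z i D e ∈ Set.Icc (0 : ℝ) 1)
    (N : ℕ) (t : ℝ) :
    L.runLaw M N {x | 2 * (∑ i : Fin N, z i (pre x i) (x i) + t) <
        ∑ i : Fin N, ∫ e, z i (pre x i) e ∂(L.stepLaw M i (pre x i))} ≤
      ENNReal.ofReal (Real.exp (-t)) := by
  let m : (i : ℕ) → (Fin i → Episode H W S A) → ℝ := fun i D => ∫ e, z i D e ∂(L.stepLaw M i D)
  have hm : ∀ i, Measurable (m i) := fun i =>
    (StronglyMeasurable.integral_kernel_prod_right' (κ := L.stepLaw M i)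
      (hz i).stronglyMeasurable).measurable
  -- With `m` the conditional mean of `z`, the exponents `m / 2 - z` sum to more than `t` on the
  -- event in question, so it suffices that each weight has conditional mean at most 1.
  let g : (i : ℕ) → (Fin i → Episode H W S A) → Episode H W S A → ℝ≥0∞ := fun i D e =>
    ENNReal.ofReal (Real.exp (m i D / 2 - z i D e))
  have hg : ∀ i, Measurable (Function.uncurry (g i)) := fun i => by
    have h1 : Measurable fun p : (Fin i → Episode H W S A) × Episode H W S A => m i p.1 :=
      (hm i).comp measurable_fst
    exact ((h1.div_const 2).sub (hz i)).exp.ennreal_ofReal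
  have hle : ∀ i D, ∫⁻ e, g i D e ∂(L.stepLaw M i D) ≤ 1 := by
    intro i D
    have hzD : Measurable (z i D) := (hz i).comp (f := fun e => (D, e)) measurable_prodMk_left
    have hint : Integrable (z i D) (L.stepLaw M i D) :=
      Integrable.of_bound hzD.aestronglyMeasurable 1 (ae_of_all _ fun e => by
        rw [Real.norm_eq_abs, abs_le]; constructor <;> linarith [(hz01 i D e).1, (hz01 i D e).2])
    -- On `[0, 1]` one has `exp (-z) ≤ 1 - z / 2`. Taking means leaves `1 - m / 2 ≤ exp (-m / 2)`.
    have hpt : ∀ e, Real.exp (m i D / 2 - z i D e) ≤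
        Real.exp (m i D / 2) * (1 - z i D e / 2) := by
      intro e
      rw [sub_eq_add_neg, Real.exp_add]
      gcongr
      have h0 := (hz01 i D e).1
      have h1 := (hz01 i D e).2
      have h2 := Real.quadratic_le_exp_of_nonneg h0
      rw [Real.exp_neg, inv_le_iff_one_le_mul₀ (Real.exp_pos _)]
      have h3 : 0 ≤ 1 - z i D e / 2 := by linarith
      nlinarith [mul_le_mul_of_nonneg_left h2 h3, mul_nonneg h0 (sub_nonneg.2 h1),
        mul_nonneg (mul_nonneg h0 h0) (sub_nonneg.2 h1)]
    have hle2 : ∫⁻ e, g i D e ∂(L.stepLaw M i D) ≤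
        ∫⁻ e, ENNReal.ofReal (Real.exp (m i D / 2) * (1 - z i D e / 2)) ∂(L.stepLaw M i D) :=
      lintegral_mono fun e => ENNReal.ofReal_le_ofReal (hpt e)
    refine hle2.trans ?_
    have hint2 : Integrable (fun e => Real.exp (m i D / 2) * (1 - z i D e / 2))
        (L.stepLaw M i D) := ((integrable_const _).sub (hint.div_const 2)).const_mul _
    rw [← ofReal_integral_eq_lintegral_ofReal hint2
      (ae_of_all _ fun e => mul_nonneg (Real.exp_pos _).le
        (by linarith [(hz01 i D e).2])), integral_const_mul,
      integral_sub (integrable_const _) (hint.div_const 2), integral_div]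
    rw [← ENNReal.ofReal_one]
    refine ENNReal.ofReal_le_ofReal ?_
    simp only [integral_const, probReal_univ, smul_eq_mul, mul_one]
    have h1 : 1 - m i D / 2 ≤ Real.exp (-(m i D / 2)) := by
      have := Real.add_one_le_exp (-(m i D / 2)); linarith
    calc Real.exp (m i D / 2) * (1 - m i D / 2)
        ≤ Real.exp (m i D / 2) * Real.exp (-(m i D / 2)) := by gcongr
      _ = 1 := by rw [← Real.exp_add]; simp
  refine le_trans (measure_mono fun x hx => ?_) (L.measure_prod_ge_le M hg hle N t)
  simp only [Set.mem_ofPred_eq] at hx ⊢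
  rw [← ENNReal.ofReal_prod_of_nonneg (fun _ _ => (Real.exp_pos _).le), ← Real.exp_sum]
  refine ENNReal.ofReal_le_ofReal (Real.exp_le_exp.2 ?_)
  rw [Finset.sum_sub_distrib, ← Finset.sum_div]
  have : ∑ i : Fin N, ∫ e, z i (pre x i) e ∂(L.stepLaw M i (pre x i)) =
    ∑ i : Fin N, m i (pre x i) := rfl
  linarith

end Run

/-! ### Hellinger distance and likelihood ratios -/

section Densities

variable {S : Type*} [MeasurableSpace S] {ν : Measure S}

/-- A probability density with respect to `ν`. -/
structure IsDensity (ν : Measure S) (p : S → ℝ) : Prop where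
  measurable : Measurable p
  nonneg : ∀ s, 0 ≤ p s
  integrable : Integrable p ν
  integral_eq_one : ∫ s, p s ∂ν = 1

/-- The squared Hellinger distance `1 - ∫ √(p q)` of two densities. -/
noncomputable def hellingerSq (ν : Measure S) (p q : S → ℝ) : ℝ :=
  1 - ∫ s, √(p s * q s) ∂ν

variable {p q : S → ℝ}

lemma sqrt_mul_le_half_add {a b : ℝ} (ha : 0 ≤ a) (hb : 0 ≤ b) : √(a * b) ≤ (a + b) / 2 := by
  rw [Real.sqrt_mul ha]
  nlinarith [sq_nonneg (√a - √b), Real.sq_sqrt ha, Real.sq_sqrt hb]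

lemma IsDensity.integrable_sqrt_mul (hp : IsDensity ν p) (hq : IsDensity ν q) :
    Integrable (fun s => √(p s * q s)) ν := by
  refine Integrable.mono' ((hp.integrable.add hq.integrable).div_const 2)
    (hp.measurable.mul hq.measurable).sqrt.aestronglyMeasurable (ae_of_all _ fun s => ?_)
  rw [Real.norm_eq_abs, abs_of_nonneg (Real.sqrt_nonneg _)]
  exact sqrt_mul_le_half_add (hp.nonneg s) (hq.nonneg s)

/-- Factor `|p - q| = |√p - √q| (√p + √q)` and apply Cauchy–Schwarz in discriminant form: `∫ (√p -
√q)²` is twice the Hellinger quantity, and `(√p + √q)² ≤ 2 (p + q)` has integral at most 4. -/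
lemma IsDensity.integral_abs_sub_sq_le (hp : IsDensity ν p) (hq : IsDensity ν q) :
    (∫ s, |p s - q s| ∂ν) ^ 2 ≤ 8 * hellingerSq ν p q := by
  have hI := hp.integrable_sqrt_mul hq
  have key : ∀ t : ℝ, 0 ≤ 4 * (t * t) +
      (-2 * ∫ s, |p s - q s| ∂ν) * t + 2 * hellingerSq ν p q := by
    intro t
    have hpt : ∀ s, 0 ≤ (2 * (p s + q s)) * (t * t) + (-2 * |p s - q s|) * t +
        (p s + q s - 2 * √(p s * q s)) := by
      intro s
      have ha := hp.nonneg s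
      have hb := hq.nonneg s
      rw [Real.sqrt_mul ha]
      have e1 := Real.sq_sqrt ha
      have e2 := Real.sq_sqrt hb
      set a := √(p s)
      set b := √(q s)
      have ha' : 0 ≤ a := Real.sqrt_nonneg _
      have hb' : 0 ≤ b := Real.sqrt_nonneg _
      rw [← e1, ← e2]
      have e3 : |a ^ 2 - b ^ 2| = |a - b| * (a + b) := by
        rw [sq_sub_sq, abs_mul, abs_of_nonneg (add_nonneg ha' hb'), mul_comm]
      rw [e3]
      have e4 : a ^ 2 + b ^ 2 - 2 * (a * b) = |a - b| ^ 2 := by rw [sq_abs]; ring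
      rw [e4]
      nlinarith [sq_nonneg (|a - b| - (a + b) * t), sq_nonneg ((a - b) * t)]
    have h0 : 0 ≤ ∫ s, ((2 * (p s + q s)) * (t * t) + (-2 * |p s - q s|) * t +
        (p s + q s - 2 * √(p s * q s))) ∂ν := integral_nonneg hpt
    have i1 : Integrable (fun s => (2 * (p s + q s)) * (t * t)) ν :=
      ((hp.integrable.add hq.integrable).const_mul 2).mul_const _
    have i2 : Integrable (fun s => (-2 * |p s - q s|) * t) ν :=
      ((hp.integrable.sub hq.integrable).abs.const_mul (-2)).mul_const t
    have i3 : Integrable (fun s => p s + q s - 2 * √(p s * q s)) ν :=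
      (hp.integrable.add hq.integrable).sub (hI.const_mul 2)
    have i12 : Integrable (fun s => (2 * (p s + q s)) * (t * t) + (-2 * |p s - q s|) * t) ν :=
      i1.add i2
    have i4 : Integrable (fun s => p s + q s) ν := hp.integrable.add hq.integrable
    rw [integral_add i12 i3, integral_add i1 i2, integral_mul_const, integral_mul_const,
      integral_const_mul, integral_const_mul, integral_sub i4 (hI.const_mul 2), integral_add hp.integrable hq.integrable, integral_const_mul,
      hp.integral_eq_one, hq.integral_eq_one] at h0
    unfold hellingerSq
    linarith
  have := discrim_le_zero key
  rw [discrim] at this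
  nlinarith

lemma IsDensity.integral_sub_mul_sq_le (hp : IsDensity ν p) (hq : IsDensity ν q) {V : S → ℝ}
    {B : ℝ} (hV : ∀ s, V s ∈ Set.Icc 0 B) :
    (∫ s, (p s - q s) * V s ∂ν) ^ 2 ≤ B ^ 2 * (8 * hellingerSq ν p q) := by
  have h1 : |∫ s, (p s - q s) * V s ∂ν| ≤ B * ∫ s, |p s - q s| ∂ν := by
    rw [← Real.norm_eq_abs, ← integral_const_mul]
    refine norm_integral_le_of_norm_le ((hp.integrable.sub hq.integrable).abs.const_mul B)
      (ae_of_all _ fun s => ?_)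
    rw [norm_mul, Real.norm_eq_abs, Real.norm_eq_abs, abs_of_nonneg (hV s).1, mul_comm]
    exact mul_le_mul_of_nonneg_right (hV s).2 (abs_nonneg _)
  calc (∫ s, (p s - q s) * V s ∂ν) ^ 2 = |∫ s, (p s - q s) * V s ∂ν| ^ 2 := (sq_abs _).symm
    _ ≤ (B * ∫ s, |p s - q s| ∂ν) ^ 2 := by gcongr
    _ = B ^ 2 * (∫ s, |p s - q s| ∂ν) ^ 2 := mul_pow _ _ _
    _ ≤ _ := by gcongr; exact hp.integral_abs_sub_sq_le hq

/-- Under the true density `p`, the mean of `√(q / p)` is `∫ √(p q)`, which equals one minus the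
Hellinger quantity. Points with `p = 0` contribute nothing on either side. -/
lemma IsDensity.lintegral_likelihood_ratio_le_one (hp : IsDensity ν p) (hq : IsDensity ν q) :
    ∫⁻ s, ENNReal.ofReal (√(q s / p s) * Real.exp (hellingerSq ν p q))
      ∂(ν.withDensity fun s => ENNReal.ofReal (p s)) ≤ 1 := by
  have hm : Measurable fun s => ENNReal.ofReal (√(q s / p s) * Real.exp (hellingerSq ν p q)) :=
    ((hq.measurable.div hp.measurable).sqrt.mul_const _).ennreal_ofReal
  rw [lintegral_withDensity_eq_lintegral_mul _ hp.measurable.ennreal_ofReal hm]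
  have e : ∀ s, ((fun s => ENNReal.ofReal (p s)) *
      fun s => ENNReal.ofReal (√(q s / p s) * Real.exp (hellingerSq ν p q))) s =
      ENNReal.ofReal (√(p s * q s) * Real.exp (hellingerSq ν p q)) := by
    intro s
    simp only [Pi.mul_apply]
    rw [← ENNReal.ofReal_mul (hp.nonneg s), ← mul_assoc]
    congr 2
    rcases (hp.nonneg s).eq_or_lt with h | h
    · simp [← h]
    · rw [Real.sqrt_div (hq.nonneg s), Real.sqrt_mul h.le]
      have : √(p s) ≠ 0 := (Real.sqrt_pos.2 h).ne'
      field_simp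
      rw [Real.sq_sqrt h.le, mul_comm]
  rw [lintegral_congr e, ← ofReal_integral_eq_lintegral_ofReal
    ((hp.integrable_sqrt_mul hq).mul_const _)
    (ae_of_all _ fun s => mul_nonneg (Real.sqrt_nonneg _) (Real.exp_pos _).le), integral_mul_const,
    ← ENNReal.ofReal_one]
  refine ENNReal.ofReal_le_ofReal ?_
  have h1 : ∫ s, √(p s * q s) ∂ν = 1 - hellingerSq ν p q := by rw [hellingerSq]; ring
  rw [h1]
  have h2 : 1 - hellingerSq ν p q ≤ Real.exp (-hellingerSq ν p q) := by
    have := Real.add_one_le_exp (-hellingerSq ν p q); linarith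
  calc (1 - hellingerSq ν p q) * Real.exp (hellingerSq ν p q)
      ≤ Real.exp (-hellingerSq ν p q) * Real.exp (hellingerSq ν p q) := by gcongr
    _ = 1 := by rw [← Real.exp_add]; simp

/-- Even an infinite weight on the zeros of `p` keeps the mean at most 1; Markov's inequality will
then show that these zeros are almost surely never observed. -/
lemma IsDensity.lintegral_zero_weight_le_one (hp : IsDensity ν p) :
    ∫⁻ s, (if p s = 0 then ⊤ else 1) ∂(ν.withDensity fun s => ENNReal.ofReal (p s)) ≤ 1 := by
  have hm : Measurable fun s => (if p s = 0 then ⊤ else 1 : ℝ≥0∞) :=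
    Measurable.ite (measurableSet_eq_fun hp.measurable measurable_const) measurable_const
      measurable_const
  rw [lintegral_withDensity_eq_lintegral_mul _ hp.measurable.ennreal_ofReal hm]
  have e : ∀ s, ((fun s => ENNReal.ofReal (p s)) * fun s => (if p s = 0 then ⊤ else 1 : ℝ≥0∞)) s
      = ENNReal.ofReal (p s) := by
    intro s
    simp only [Pi.mul_apply]
    split_ifs with h
    · simp [h]
    · simp
  rw [lintegral_congr e, ← ofReal_integral_eq_lintegral_ofReal hp.integrable
    (ae_of_all _ hp.nonneg), hp.integral_eq_one, ENNReal.ofReal_one]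

end Densities

/-! ### Prediction error of an estimated weight function -/

section Weights

variable {d : ℕ} {W S A : Type*} [MeasurableSpace S] {ν : Measure S} {φ : S × A × W → Vec d} {m m' : S → Vec d}

lemma IsWeight.isDensity (hm : IsWeight ν φ m) (x : S × A × W) :
    IsDensity ν fun s' => inner ℝ (φ x) (m s') where
  measurable := measurable_const.inner hm.measurable
  nonneg := hm.nonneg x
  integrable := hm.integrable.const_inner _
  integral_eq_one := hm.integral_eq_one x

lemma IsWeight.integrable_smul (hm : IsWeight ν φ m) {V : S → ℝ} (hV : Measurable V) {B : ℝ}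
    (hB : ∀ s, V s ∈ Set.Icc 0 B) : Integrable (fun s => V s • m s) ν :=
  hm.integrable.bdd_smul B hV.aestronglyMeasurable (ae_of_all _ fun s => by
    rw [Real.norm_eq_abs, abs_of_nonneg (hB s).1]; exact (hB s).2)

lemma IsWeight.norm_integral_smul_le (hm : IsWeight ν φ m) {V : S → ℝ} (hV : Measurable V)
    {B : ℝ} (hB0 : 0 < B) (hB : ∀ s, V s ∈ Set.Icc 0 B) :
    ‖∫ s, V s • m s ∂ν‖ ≤ B * √(d : ℝ) := by
  have h := hm.norm_integral_le (fun s => V s / B) (hV.div_const B) fun s =>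
    ⟨div_nonneg (hB s).1 hB0.le, (div_le_one hB0).2 (hB s).2⟩
  have e : ∫ s, V s • m s ∂ν = B • ∫ s, (V s / B) • m s ∂ν := by
    rw [← integral_smul]
    refine integral_congr_ae (ae_of_all _ fun s => ?_)
    simp only [smul_smul]
    congr 1
    field_simp
  rw [e, norm_smul, Real.norm_eq_abs, abs_of_pos hB0]
  gcongr

/-- The prediction error of an estimated weight function, in terms of its Hellinger error on the
data. -/
lemma IsWeight.abs_integral_sub_le (hm : IsWeight ν φ m) (hm' : IsWeight ν φ m')
    {n : ℕ} (y : Fin n → S × A × W) {c T : ℝ} (hc : 0 < c) (hT : 0 ≤ T)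
    (hy : ∑ τ, hellingerSq ν (fun s => inner ℝ (φ (y τ)) (m s))
      (fun s => inner ℝ (φ (y τ)) (m' s)) ≤ T)
    {V : S → ℝ} (hV : Measurable V) {B : ℝ} (hB0 : 0 < B) (hB : ∀ s, V s ∈ Set.Icc 0 B)
    (x : S × A × W) :
    |∫ s, inner ℝ (φ x) (m s) * V s ∂ν - ∫ s, inner ℝ (φ x) (m' s) * V s ∂ν| ≤
      B * √(4 * d * c + 8 * T) * matNorm (gram (fun τ => φ (y τ)) c)⁻¹ (φ x) := by
  have i1 := hm.integrable_smul hV hB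
  have i2 := hm'.integrable_smul hV hB
  -- The error at every point is `⟨φ x, θ⟩` for this one vector, so smallness on the data transfers
  -- to a new point by Cauchy–Schwarz. The regularizer costs `c ‖θ‖² ≤ 4 B² d c`, the data cost `8
  -- B² T`.
  set θ : Vec d := ∫ s, V s • m s ∂ν - ∫ s, V s • m' s ∂ν with hθ
  have e1 : ∀ x, inner ℝ (φ x) θ =
      ∫ s, inner ℝ (φ x) (m s) * V s ∂ν - ∫ s, inner ℝ (φ x) (m' s) * V s ∂ν := by
    intro x
    rw [hθ, inner_sub_right, ← integral_inner i1, ← integral_inner i2]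
    simp only [real_inner_smul_right, mul_comm]
  have j : ∀ x, Integrable (fun s => inner ℝ (φ x) (m s) * V s) ν := fun x => by
    refine (i1.const_inner (φ x)).congr (ae_of_all _ fun s => ?_)
    simp only [real_inner_smul_right, mul_comm]
  have j' : ∀ x, Integrable (fun s => inner ℝ (φ x) (m' s) * V s) ν := fun x => by
    refine (i2.const_inner (φ x)).congr (ae_of_all _ fun s => ?_)
    simp only [real_inner_smul_right, mul_comm]
  rw [← e1]
  refine abs_inner_le_matNorm_mul _ hc _ _ ?_ (by positivity)
  have h1 : ‖θ‖ ≤ 2 * B * √(d : ℝ) := by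
    have := norm_sub_le (∫ s, V s • m s ∂ν) (∫ s, V s • m' s ∂ν)
    have := hm.norm_integral_smul_le hV hB0 hB
    have := hm'.norm_integral_smul_le hV hB0 hB
    rw [hθ]; linarith
  have h2 : ‖θ‖ ^ 2 ≤ 4 * B ^ 2 * d := by
    calc ‖θ‖ ^ 2 ≤ (2 * B * √(d : ℝ)) ^ 2 := by gcongr
      _ = 4 * B ^ 2 * d := by rw [mul_pow, Real.sq_sqrt (by positivity)]; ring
  have h3 : ∑ τ, inner ℝ (φ (y τ)) θ ^ 2 ≤ B ^ 2 * (8 * T) := by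
    calc ∑ τ, inner ℝ (φ (y τ)) θ ^ 2 ≤ ∑ τ, B ^ 2 * (8 * hellingerSq ν
          (fun s => inner ℝ (φ (y τ)) (m s)) (fun s => inner ℝ (φ (y τ)) (m' s))) := by
          refine Finset.sum_le_sum fun τ _ => ?_
          refine le_trans (le_of_eq ?_)
            ((hm.isDensity (y τ)).integral_sub_mul_sq_le (hm'.isDensity (y τ)) hB)
          rw [e1, ← integral_sub (j _) (j' _)]
          simp only [sub_mul]
      _ ≤ B ^ 2 * (8 * T) := by
          rw [← Finset.mul_sum, ← Finset.mul_sum]; gcongr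
  rw [mul_pow, Real.sq_sqrt (by positivity)]
  nlinarith

lemma measurable_hellingerSq [MeasurableSpace W] [MeasurableSpace A] [SFinite ν] (hφ : Measurable φ) (hm : IsWeight ν φ m)
    (hm' : IsWeight ν φ m') : Measurable fun x => hellingerSq ν
      (fun s => inner ℝ (φ x) (m s)) (fun s => inner ℝ (φ x) (m' s)) := by
  have h1 : Measurable fun p : (S × A × W) × S => inner ℝ (φ p.1) (m p.2) :=
    (hφ.comp measurable_fst).inner (hm.measurable.comp measurable_snd)
  have h2 : Measurable fun p : (S × A × W) × S => inner ℝ (φ p.1) (m' p.2) :=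
    (hφ.comp measurable_fst).inner (hm'.measurable.comp measurable_snd)
  exact ((h1.mul h2).sqrt.stronglyMeasurable.integral_prod_right').measurable.const_sub 1

end Weights

/-! ### Comparison of likelihoods -/

section LogLikelihood

variable {H d : ℕ} {W S A : Type*}

/-- Since `ENNReal.log` is strictly monotone, with `log 0 = ⊥`, comparing log-likelihoods becomes
comparing products in `ℝ≥0∞`. -/
lemma logLik_eq (φ : Fin H → S × A × W → Vec d) {i : ℕ} (D : Fin i → Episode H W S A) (h : Fin H)
    (m : S → Vec d) : logLik φ D h m =
      ENNReal.log (∏ τ, ENNReal.ofReal (inner ℝ (φ h (visit (D τ) h)) (m ((D τ).2 h).2.2))) := by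
  have key : ∀ (s : Finset (Fin i)) (f : Fin i → ℝ≥0∞),
      ∑ τ ∈ s, ENNReal.log (f τ) = ENNReal.log (∏ τ ∈ s, f τ) := by
    intro s f
    induction s using Finset.cons_induction with
    | empty => simp
    | cons a s ha ih => rw [Finset.sum_cons, Finset.prod_cons, ENNReal.log_mul_add, ih]
  exact key _ _

/-- Weights switched to 1 from episode `i` on let a product over the full run of length `N` describe
its prefix. -/
lemma prod_ite_lt_eq {β E : Type*} [CommMonoid β] {N : ℕ} (i : Fin N) (x : Fin N → E) (f : E → β) :
    ∏ k : Fin N, (if (k : ℕ) < i then f (x k) else 1) = ∏ τ : Fin i, f (pre x i τ) := by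
  rw [← Finset.prod_filter]
  symm
  refine Finset.prod_bij (fun τ _ => τ.castLE i.isLt.le) (fun τ _ => by
      rw [Finset.mem_filter]; exact ⟨Finset.mem_univ _, τ.isLt⟩)
    (fun a _ b _ hab => by simpa using hab) (fun k hk => ?_) (fun τ _ => rfl)
  simp only [Finset.mem_filter, Finset.mem_univ, true_and] at hk
  exact ⟨⟨k, hk⟩, Finset.mem_univ _, rfl⟩

/-- The likelihood ratio controls the Hellinger error wherever the true density is positive. -/
lemma exp_sum_le_prod {n : ℕ} {p q z : Fin n → ℝ} (hp : ∀ i, 0 < p i) (hq : ∀ i, 0 ≤ q i)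
    (hpq : ∏ i, ENNReal.ofReal (p i) ≤ ∏ i, ENNReal.ofReal (q i)) :
    ENNReal.ofReal (Real.exp (∑ i, z i)) ≤
      ∏ i, ENNReal.ofReal (√(q i / p i) * Real.exp (z i)) := by
  rw [← ENNReal.ofReal_prod_of_nonneg (fun i _ => by positivity), Finset.prod_mul_distrib,
    ← Real.exp_sum]
  refine ENNReal.ofReal_le_ofReal ?_
  rw [← ENNReal.ofReal_prod_of_nonneg (fun i _ => (hp i).le),
    ← ENNReal.ofReal_prod_of_nonneg (fun i _ => hq i),
    ENNReal.ofReal_le_ofReal_iff (Finset.prod_nonneg fun i _ => hq i)] at hpq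
  -- The product of the ratios `q / p` is at least 1, hence so is its square root.
  have h1 : (1 : ℝ) ≤ ∏ i, √(q i / p i) := by
    refine one_le_sq_iff₀ (Finset.prod_nonneg fun i _ => Real.sqrt_nonneg _) |>.1 ?_
    rw [← Finset.prod_pow]
    have : ∀ i, √(q i / p i) ^ 2 = q i / p i := fun i =>
      Real.sq_sqrt (div_nonneg (hq i) (hp i).le)
    simp_rw [this]
    rw [Finset.prod_div_distrib, one_le_div (Finset.prod_pos fun i _ => hp i)]
    exact hpq
  exact le_mul_of_one_le_left (Real.exp_pos _).le h1

end LogLikelihood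

lemma sum_range_inv_sq_le_two (n : ℕ) : ∑ i ∈ Finset.range n, 1 / ((i : ℝ) + 1) ^ 2 ≤ 2 := by
  have h : ∀ n : ℕ, ∑ i ∈ Finset.range (n + 1), 1 / ((i : ℝ) + 1) ^ 2 ≤ 2 - 1 / ((n : ℝ) + 1) := by
    intro n
    induction n with
    | zero => norm_num
    | succ n ih =>
      rw [Finset.sum_range_succ]
      have h1 : 1 / (((n + 1 : ℕ) : ℝ) + 1) ^ 2 ≤
          1 / ((n : ℝ) + 1) - 1 / (((n + 1 : ℕ) : ℝ) + 1) := by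
        push_cast
        rw [div_sub_div _ _ (by positivity) (by positivity),
          div_le_div_iff₀ (by positivity) (by positivity)]
        have : (0 : ℝ) ≤ n := by positivity
        nlinarith
      linarith
  cases n with
  | zero => simp
  | succ n =>
    have := h n
    have : 0 ≤ 1 / ((n : ℝ) + 1) := by positivity
    linarith

/-! ### The maximum likelihood guarantee -/

section MaximumLikelihood

variable {H d : ℕ} {W S A : Type*} [MeasurableSpace W] [MeasurableSpace S] [MeasurableSpace A]

lemma measurable_visit (h : Fin H) : Measurable fun e : Episode H W S A => visit e h := by
  unfold visit; fun_prop

variable [Finite A] [MeasurableSingletonClass A]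

lemma Learner.lintegral_stepLaw_transition_le_one (L : Learner H d W S A) (M : CMDP H W S A)
    (n : ℕ) (D : Fin n → Episode H W S A) (h : Fin H) {f : (S × A × W) × S → ℝ≥0∞}
    (hf : Measurable f) (hle : ∀ x, ∫⁻ s', f (x, s') ∂(M.P h x) ≤ 1) :
    ∫⁻ e, f (visit e h, (e.2 h).2.2) ∂(L.stepLaw M n D) ≤ 1 := by
  rw [L.lintegral_stepLaw M n D (F := fun e => f (visit e h, (e.2 h).2.2))
    (hf.comp ((measurable_visit h).prodMk (by fun_prop)))]
  refine (lintegral_mono fun w => (?_ : _ ≤ (1 : ℝ≥0∞))).trans (by simp)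
  exact lintegral_trajLaw_step_le_one (M.transAt w) (L.policy n D w).kernel M.s₁ h
    (f := fun y => f ((y.1, y.2.1, w), y.2.2)) (hf.comp (by fun_prop)) (fun s a => hle (s, a, w))

variable {M : CMDP H W S A} {ν : Measure S} {φ ψ : Fin H → S × A × W → Vec d}
  {μ : Fin H → S → Vec d} {η : Fin H → Vec d} {Ψ : Finset (S → Vec d)}

/-- The Hellinger error of `m` at step `h` on the data `D`. -/
noncomputable def dataError (ν : Measure S) (φ : Fin H → S × A × W → Vec d)
    (μ : Fin H → S → Vec d) {i : ℕ} (D : Fin i → Episode H W S A) (h : Fin H) (m : S → Vec d) : ℝ :=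
  ∑ τ, hellingerSq ν (fun s => inner ℝ (φ h (visit (D τ) h)) (μ h s))
      (fun s => inner ℝ (φ h (visit (D τ) h)) (m s))

/-- Where the true density vanishes, the real quotient `q / p` takes the junk value 0 and the
likelihood comparison says nothing, so these points have to be excluded almost surely. -/
lemma Learner.measure_density_eq_zero (L : Learner H d W S A) (hM : IsModelI M ν φ ψ μ η) (N : ℕ)
    (k : Fin N) (h : Fin H) :
    L.runLaw M N {x | inner ℝ (φ h (visit (x k) h)) (μ h ((x k).2 h).2.2) = 0} = 0 := by
  let f : (S × A × W) × S → ℝ≥0∞ := fun y => if inner ℝ (φ h y.1) (μ h y.2) = 0 then ⊤ else 1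
  have hin : Measurable fun y : (S × A × W) × S => inner ℝ (φ h y.1) (μ h y.2) :=
    ((hM.φ_measurable h).comp measurable_fst).inner
      ((hM.weight h).measurable.comp measurable_snd)
  have hf : Measurable f := Measurable.ite (measurableSet_eq_fun hin measurable_const)
      measurable_const measurable_const
  have hf1 : ∀ y, 1 ≤ f y := fun y => by simp only [f]; split_ifs <;> simp
  have hle : ∀ x, ∫⁻ s', f (x, s') ∂(M.P h x) ≤ 1 := fun x => by
    rw [hM.trans_eq]
    exact ((hM.weight h).isDensity x).lintegral_zero_weight_le_one
  have hmeas : Measurable fun e : Episode H W S A => f (visit e h, (e.2 h).2.2) :=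
    hf.comp ((measurable_visit h).prodMk (by fun_prop))
  have hb : ∀ t : ℝ, L.runLaw M N
      {x | inner ℝ (φ h (visit (x k) h)) (μ h ((x k).2 h).2.2) = 0} ≤
        ENNReal.ofReal (Real.exp (-t)) := by
    intro t
    refine le_trans (measure_mono fun x hx => ?_)
      (L.measure_prod_ge_le M (g := fun _ _ e => f (visit e h, (e.2 h).2.2))
      (fun i => hmeas.comp measurable_snd)
      (fun i D => L.lintegral_stepLaw_transition_le_one M i D h hf hle) N t)
    simp only [Set.mem_ofPred_eq] at hx ⊢
    -- All factors are at least 1 and this one is infinite, so the product exceeds every threshold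
    -- `exp t`.
    have h1 : f (visit (x k) h, ((x k).2 h).2.2) = ⊤ := by simp only [f, hx, if_true]
    have h2 := Finset.single_le_prod' (f := fun k => f (visit (x k) h, ((x k).2 h).2.2))
      (s := Finset.univ) (fun i _ => hf1 _) (Finset.mem_univ k)
    simp only [h1, top_le_iff] at h2
    rw [h2]; exact le_top
  refine le_antisymm (le_of_tendsto_of_tendsto' tendsto_const_nhds (b := Filter.atTop) ?_ hb)
    (zero_le)
  have := ENNReal.tendsto_ofReal (Real.tendsto_exp_neg_atTop_nhds_zero)
  simpa using this

variable [SFinite ν]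

/-- The maximum likelihood guarantee for one model, one step and one episode. -/
lemma Learner.measure_dataError_gt_le (L : Learner H d W S A) (hM : IsModelI M ν φ ψ μ η)
    {N : ℕ} (i : Fin N) (h : Fin H) {m : S → Vec d} (hm : IsWeight ν (φ h) m) (t : ℝ) :
    L.runLaw M N {x | logLik φ (pre x i) h (μ h) ≤ logLik φ (pre x i) h m ∧
        t < dataError ν φ μ (pre x i) h m} ≤ ENNReal.ofReal (Real.exp (-t)) := by
  let f : (S × A × W) × S → ℝ≥0∞ := fun y => ENNReal.ofReal
    (√(inner ℝ (φ h y.1) (m y.2) / inner ℝ (φ h y.1) (μ h y.2)) *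
      Real.exp (hellingerSq ν (fun s => inner ℝ (φ h y.1) (μ h s))
        (fun s => inner ℝ (φ h y.1) (m s))))
  have hin : Measurable fun y : (S × A × W) × S => inner ℝ (φ h y.1) (μ h y.2) :=
    ((hM.φ_measurable h).comp measurable_fst).inner
      ((hM.weight h).measurable.comp measurable_snd)
  have hin' : Measurable fun y : (S × A × W) × S => inner ℝ (φ h y.1) (m y.2) :=
    ((hM.φ_measurable h).comp measurable_fst).inner (hm.measurable.comp measurable_snd)
  have hf : Measurable f := ((hin'.div hin).sqrt.mul
    ((measurable_hellingerSq (hM.φ_measurable h) (hM.weight h) hm).comp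
      measurable_fst).exp).ennreal_ofReal
  have hle : ∀ x, ∫⁻ s', f (x, s') ∂(M.P h x) ≤ 1 := fun x => by
    rw [hM.trans_eq]
    exact ((hM.weight h).isDensity x).lintegral_likelihood_ratio_le_one (hm.isDensity x)
  have hmeas : Measurable fun e : Episode H W S A => f (visit e h, (e.2 h).2.2) :=
    hf.comp ((measurable_visit h).prodMk (by fun_prop))
  let g : (k : ℕ) → (Fin k → Episode H W S A) → Episode H W S A → ℝ≥0∞ := fun k _ e =>
    if k < i then f (visit e h, (e.2 h).2.2) else 1
  have hg : ∀ k, Measurable (Function.uncurry (g k)) := fun k => by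
    by_cases hk : k < i
    · simp only [g, hk, if_true]; exact hmeas.comp measurable_snd
    · simp only [g, hk, if_false]; exact measurable_const
  have hgle : ∀ k D, ∫⁻ e, g k D e ∂(L.stepLaw M k D) ≤ 1 := fun k D => by
    by_cases hk : k < i
    · simp only [g, hk, if_true]
      exact L.lintegral_stepLaw_transition_le_one M k D h hf hle
    · simp [g, hk]
  have h0 : L.runLaw M N (⋃ k : Fin N,
      {x | inner ℝ (φ h (visit (x k) h)) (μ h ((x k).2 h).2.2) = 0}) = 0 :=
    measure_iUnion_null fun k => L.measure_density_eq_zero hM N k h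
  refine (measure_mono (fun x hx => ?_)).trans ((measure_union_le _ _).trans
    ((add_le_add h0.le (L.measure_prod_ge_le M hg hgle N t)).trans (by simp)))
  by_cases hx0 : x ∈ ⋃ k : Fin N,
      {x | inner ℝ (φ h (visit (x k) h)) (μ h ((x k).2 h).2.2) = 0}
  · exact Or.inl hx0
  refine Or.inr ?_
  simp only [Set.mem_iUnion, Set.mem_ofPred_eq, not_exists] at hx0
  obtain ⟨hx1, hx2⟩ := hx
  simp only [Set.mem_ofPred_eq, g]
  rw [prod_ite_lt_eq i x (fun e => f (visit e h, (e.2 h).2.2))]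
  rw [logLik_eq, logLik_eq, ENNReal.log_le_log_iff] at hx1
  refine (ENNReal.ofReal_le_ofReal (Real.exp_le_exp.2 hx2.le)).trans ?_
  refine exp_sum_le_prod (p := fun τ => inner ℝ (φ h (visit (pre x i τ) h))
    (μ h ((pre x i τ).2 h).2.2)) (q := fun τ => inner ℝ (φ h (visit (pre x i τ) h))
    (m ((pre x i τ).2 h).2.2)) (fun τ => ?_) (fun τ => hm.nonneg _ _) hx1
  exact lt_of_le_of_ne ((hM.weight h).nonneg _ _) (Ne.symm (hx0 _))

/-- The maximum likelihood guarantee, for all steps and episodes. -/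
lemma Learner.measure_mle_bad_le (L : Learner H d W S A) (hM : IsModelI M ν φ ψ μ η)
    (hΨ : IsModelClass ν φ μ Ψ) (hH : 1 ≤ H) {δ : ℝ} (hδ : 0 < δ) (hδ1 : δ < 1) (N : ℕ) :
    L.runLaw M N {x | ∃ i : Fin N, ∃ h, ∃ m ∈ Ψ,
      logLik φ (pre x i) h (μ h) ≤ logLik φ (pre x i) h m ∧
      2 * Real.log (2 * ((i + 1 : ℕ) : ℝ) * H * Ψ.card / δ) < dataError ν φ μ (pre x i) h m} ≤
    ENNReal.ofReal (δ / 2) := by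
  have hK : 1 ≤ Ψ.card := Finset.card_pos.2 ⟨_, hΨ.realizable ⟨0, hH⟩⟩
  have hH' : (1 : ℝ) ≤ H := by exact_mod_cast hH
  have hK' : (1 : ℝ) ≤ Ψ.card := by exact_mod_cast hK
  set t : ℕ → ℝ := fun i => 2 * Real.log (2 * ((i + 1 : ℕ) : ℝ) * H * Ψ.card / δ) with ht
  have hsub : {x : Fin N → Episode H W S A | ∃ i : Fin N, ∃ h, ∃ m ∈ Ψ,
      logLik φ (pre x i) h (μ h) ≤ logLik φ (pre x i) h m ∧
      t i < dataError ν φ μ (pre x i) h m} ⊆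
      ⋃ i ∈ (Finset.univ : Finset (Fin N)), ⋃ h ∈ (Finset.univ : Finset (Fin H)), ⋃ m ∈ Ψ,
        {x | logLik φ (pre x i) h (μ h) ≤ logLik φ (pre x i) h m ∧
          t i < dataError ν φ μ (pre x i) h m} := by
    rintro x ⟨i, h, m, hm, hx⟩
    simp only [Set.mem_iUnion]
    exact ⟨i, Finset.mem_univ _, h, Finset.mem_univ _, m, hm, hx⟩
  refine (measure_mono hsub).trans ?_
  -- With `n = i + 1` the tail is `(δ / (2 n H K))²`. The union over `H K` pairs leaves at most `δ /
  -- (4 n²)`, and the sum over `n` is at most `δ / 2`.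
  have hexp : ∀ i : ℕ, Real.exp (-t i) ≤ δ / (4 * H * Ψ.card) * (1 / (i + 1 : ℝ) ^ 2) := by
    intro i
    have hpos : 0 < 2 * ((i + 1 : ℕ) : ℝ) * H * Ψ.card / δ := by positivity
    have e : Real.exp (-t i) = (2 * ((i + 1 : ℕ) : ℝ) * H * Ψ.card / δ)⁻¹ ^ 2 := by
      have e1 : -t i = -Real.log (2 * ((i + 1 : ℕ) : ℝ) * H * Ψ.card / δ) +
          -Real.log (2 * ((i + 1 : ℕ) : ℝ) * H * Ψ.card / δ) := by simp only [ht]; ring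
      rw [e1, Real.exp_add, Real.exp_neg, Real.exp_log hpos, sq]
    rw [e]
    have e2 : (2 * ((i + 1 : ℕ) : ℝ) * H * Ψ.card / δ)⁻¹ ^ 2 =
        δ / (4 * H * Ψ.card) * (1 / (i + 1 : ℝ) ^ 2) * (δ / (H * Ψ.card)) := by
      push_cast; field_simp; ring
    rw [e2]
    refine mul_le_of_le_one_right (by positivity) ?_
    rw [div_le_one (by positivity)]
    nlinarith
  calc L.runLaw M N (⋃ i ∈ (Finset.univ : Finset (Fin N)),
        ⋃ h ∈ (Finset.univ : Finset (Fin H)), ⋃ m ∈ Ψ,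
        {x | logLik φ (pre x i) h (μ h) ≤ logLik φ (pre x i) h m ∧
          t i < dataError ν φ μ (pre x i) h m})
      ≤ ∑ i : Fin N, ∑ h : Fin H, ∑ m ∈ Ψ, ENNReal.ofReal (Real.exp (-t i)) := by
        refine (measure_biUnion_finset_le _ _).trans (Finset.sum_le_sum fun i _ => ?_)
        refine (measure_biUnion_finset_le _ _).trans (Finset.sum_le_sum fun h _ => ?_)
        refine (measure_biUnion_finset_le _ _).trans (Finset.sum_le_sum fun m hm => ?_)
        exact L.measure_dataError_gt_le hM i h (hΨ.admissible m hm h) _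
    _ = ENNReal.ofReal (∑ i : Fin N, H * Ψ.card * Real.exp (-t i)) := by
        rw [ENNReal.ofReal_sum_of_nonneg (fun i _ => by positivity)]
        refine Finset.sum_congr rfl fun i _ => ?_
        rw [ENNReal.ofReal_mul (by positivity), ENNReal.ofReal_mul (by positivity)]
        simp [mul_assoc]
    _ ≤ ENNReal.ofReal (δ / 2) := by
        refine ENNReal.ofReal_le_ofReal ?_
        calc ∑ i : Fin N, H * Ψ.card * Real.exp (-t i)
            ≤ ∑ i : Fin N, δ / 4 * (1 / ((i : ℕ) + 1 : ℝ) ^ 2) := by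
              refine Finset.sum_le_sum fun i _ => ?_
              calc H * Ψ.card * Real.exp (-t i) ≤ H * Ψ.card *
                    (δ / (4 * H * Ψ.card) * (1 / ((i : ℕ) + 1 : ℝ) ^ 2)) := by
                    gcongr; exact hexp i
                _ = _ := by field_simp
          _ = δ / 4 * ∑ i ∈ Finset.range N, 1 / ((i : ℝ) + 1) ^ 2 := by
              rw [← Finset.mul_sum, Fin.sum_univ_eq_sum_range
                (fun i : ℕ => 1 / ((i : ℝ) + 1) ^ 2)]
          _ ≤ δ / 4 * 2 := by
              gcongr
              exact sum_range_inv_sq_le_two N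
          _ = δ / 2 := by ring

end MaximumLikelihood

/-! ### Optimism and simulation for truncated values -/

section Planning

variable {S A : Type*} [MeasurableSpace S] [MeasurableSpace A] {ν : Measure S}

lemma integral_mem_Icc {Y : Type*} [MeasurableSpace Y] {μ : Measure Y} [IsProbabilityMeasure μ]
    {f : Y → ℝ} (hf : Measurable f) {B : ℝ} (h : ∀ y, f y ∈ Set.Icc 0 B) :
    ∫ y, f y ∂μ ∈ Set.Icc 0 B := by
  have hint : Integrable f μ := Integrable.of_bound hf.aestronglyMeasurable B
    (ae_of_all _ fun y => by rw [Real.norm_eq_abs, abs_of_nonneg (h y).1]; exact (h y).2)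
  refine ⟨integral_nonneg fun y => (h y).1, ?_⟩
  calc ∫ y, f y ∂μ ≤ ∫ _, B ∂μ := integral_mono hint (integrable_const _) fun y => (h y).2
    _ = B := by simp

lemma integrable_of_mem_Icc {Y : Type*} [MeasurableSpace Y] {μ : Measure Y} [IsFiniteMeasure μ]
    {f : Y → ℝ} (hf : Measurable f) {B : ℝ} (h : ∀ y, f y ∈ Set.Icc 0 B) : Integrable f μ :=
  Integrable.of_bound hf.aestronglyMeasurable B
    (ae_of_all _ fun y => by rw [Real.norm_eq_abs, abs_of_nonneg (h y).1]; exact (h y).2)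

lemma IsDensity.integrable_mul {p : S → ℝ} (hp : IsDensity ν p) {V : S → ℝ} (hV : Measurable V)
    {B : ℝ} (hB : ∀ s, V s ∈ Set.Icc 0 B) : Integrable (fun s => p s * V s) ν :=
  hp.integrable.mul_bdd hV.aestronglyMeasurable (c := B) (ae_of_all _ fun s => by
    rw [Real.norm_eq_abs, abs_of_nonneg (hB s).1]; exact (hB s).2)

lemma IsDensity.integral_mul_nonneg {p : S → ℝ} (hp : IsDensity ν p) {V : S → ℝ}
    (hV : ∀ s, 0 ≤ V s) : 0 ≤ ∫ s, p s * V s ∂ν :=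
  integral_nonneg fun s => mul_nonneg (hp.nonneg s) (hV s)

lemma expSum_mem_Icc {H : ℕ} (P : Fin H → Kernel (S × A) S) (π : Fin H → Kernel S A)
    [∀ h, IsMarkovKernel (P h)] [∀ h, IsMarkovKernel (π h)] {f : Fin H → S → A → ℝ}
    (hf : ∀ h, Measurable (Function.uncurry (f h))) {C : ℝ}
    (hC : ∀ h s a, f h s a ∈ Set.Icc 0 C) (s : S) : expSum P π f s ∈ Set.Icc 0 (H * C) := by
  refine integral_mem_Icc (measurable_sum_traj hf) fun τ =>
    ⟨Finset.sum_nonneg fun h _ => (hC h _ _).1, ?_⟩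
  refine (Finset.sum_le_sum fun h _ => (hC h _ _).2).trans ?_
  simp

lemma expSum_add {H : ℕ} (P : Fin H → Kernel (S × A) S) (π : Fin H → Kernel S A)
    [∀ h, IsMarkovKernel (P h)] [∀ h, IsMarkovKernel (π h)] {f g : Fin H → S → A → ℝ}
    (hf : ∀ h, Measurable (Function.uncurry (f h))) (hg : ∀ h, Measurable (Function.uncurry (g h)))
    {C C' : ℝ} (hC : ∀ h s a, |f h s a| ≤ C) (hC' : ∀ h s a, |g h s a| ≤ C') (s : S) :
    expSum P π (fun h s a => f h s a + g h s a) s = expSum P π f s + expSum P π g s := by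
  unfold expSum
  rw [← integral_add (integrable_sum_traj P π hf hC s) (integrable_sum_traj P π hg hC' s)]
  simp only [Finset.sum_add_distrib]

variable [Finite A] [MeasurableSingletonClass A]

lemma truncValue_measurable_and_mem [SFinite ν] {B : ℝ} (hB : 0 ≤ B) (H : ℕ) :
    ∀ (r : Fin H → S → A → ℝ) (p : Fin H → S → A → S → ℝ) (π : Fin H → Kernel S A),
    (∀ h, IsMarkovKernel (π h)) → (∀ h, Measurable (Function.uncurry (r h))) →
    (∀ h s a, 0 ≤ r h s a) → (∀ h, Measurable fun y : (S × A) × S => p h y.1.1 y.1.2 y.2) →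
    (∀ h s a, IsDensity ν (p h s a)) →
    Measurable (truncValue ν B H r p π) ∧ ∀ s, truncValue ν B H r p π s ∈ Set.Icc 0 B := by
  induction H with
  | zero =>
    intro r p π _ _ _ _ _
    exact ⟨measurable_const, fun s => ⟨le_rfl, hB⟩⟩
  | succ H ih =>
    intro r p π hπ hr hr0 hp hd
    obtain ⟨ih1, ih2⟩ := ih (fun h => r h.succ) (fun h => p h.succ) (fun h => π h.succ)
      (fun h => hπ _) (fun h => hr _) (fun h => hr0 _) (fun h => hp _) (fun h => hd _)
    have hm : Measurable fun y : S × A => min B (r 0 y.1 y.2 + ∫ s', p 0 y.1 y.2 s' *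
        truncValue ν B H (fun h => r h.succ) (fun h => p h.succ) (fun h => π h.succ) s' ∂ν) := by
      have : Measurable fun y : S × A => ∫ s', p 0 y.1 y.2 s' *
        truncValue ν B H (fun h => r h.succ) (fun h => p h.succ) (fun h => π h.succ) s' ∂ν :=
        (((hp 0).mul (ih1.comp measurable_snd)).stronglyMeasurable.integral_prod_right').measurable
      exact measurable_const.min ((hr 0).add this)
    refine ⟨(StronglyMeasurable.integral_kernel_prod_right' (κ := π 0)
      hm.stronglyMeasurable).measurable, fun s => ?_⟩
    refine integral_mem_Icc (measurable_of_countable _) fun a => ⟨le_min hB ?_, min_le_left _ _⟩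
    exact add_nonneg (hr0 0 s a) ((hd 0 s a).integral_mul_nonneg fun s' => (ih2 s').1)

/-- Optimism: the truncated value in an optimistic model dominates the true value. -/
lemma expSum_le_truncValue [SFinite ν] {B Hm : ℝ} (hB : Hm ≤ B) (H : ℕ) :
    ∀ (P : Fin H → Kernel (S × A) S) (π : Fin H → Kernel S A)
    (r r' : Fin H → S → A → ℝ) (p : Fin H → S → A → S → ℝ),
    (H : ℝ) ≤ Hm →
    (∀ h, IsMarkovKernel (P h)) → (∀ h, IsMarkovKernel (π h)) →
    (∀ h, Measurable (Function.uncurry (r h))) → (∀ h s a, r h s a ∈ Set.Icc (0 : ℝ) 1) →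
    (∀ h, Measurable (Function.uncurry (r' h))) → (∀ h s a, 0 ≤ r' h s a) →
    (∀ h, Measurable fun y : (S × A) × S => p h y.1.1 y.1.2 y.2) →
    (∀ h s a, IsDensity ν (p h s a)) →
    (∀ h s a (V : S → ℝ), Measurable V → (∀ s, V s ∈ Set.Icc 0 Hm) →
      r h s a + ∫ s', V s' ∂(P h (s, a)) ≤ r' h s a + ∫ s', p h s a s' * V s' ∂ν) →
    ∀ s, expSum P π r s ≤ truncValue ν B H r' p π s := by
  induction H with
  | zero => intro P π r r' p _ _ _ _ _ _ _ _ _ _ s; simp [expSum, truncValue]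
  | succ H ih =>
    intro P π r r' p hHm hP hπ hr hr01 hr' hr'0 hp hd hle s
    have hHm' : (H : ℝ) ≤ Hm := by push_cast at hHm; linarith
    have hHm0 : 0 ≤ Hm := le_trans (by positivity) hHm'
    have ih' := ih (fun h => P h.succ) (fun h => π h.succ) (fun h => r h.succ)
      (fun h => r' h.succ) (fun h => p h.succ) hHm' (fun h => hP _) (fun h => hπ _)
      (fun h => hr _) (fun h => hr01 _) (fun h => hr' _) (fun h => hr'0 _) (fun h => hp _)
      (fun h => hd _) (fun h => hle _)
    obtain ⟨t1, t2⟩ := truncValue_measurable_and_mem (ν := ν) (hHm0.trans hB) H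
      (fun h => r' h.succ) (fun h => p h.succ) (fun h => π h.succ) (fun h => hπ _)
      (fun h => hr' _) (fun h => hr'0 _) (fun h => hp _) (fun h => hd _)
    have m1 : Measurable (expSum (fun h => P h.succ) (fun h => π h.succ) (fun h => r h.succ)) :=
      measurable_expSum _ _ (fun h => hr h.succ)
    have m2 : ∀ s, expSum (fun h => P h.succ) (fun h => π h.succ) (fun h => r h.succ) s ∈
        Set.Icc (0 : ℝ) H := fun s => by
      have := expSum_mem_Icc (fun h => P h.succ) (fun h => π h.succ) (fun h => hr h.succ)
        (fun h => hr01 h.succ) s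
      rwa [mul_one] at this
    have m3 : ∀ s, expSum (fun h => P h.succ) (fun h => π h.succ) (fun h => r h.succ) s ∈
        Set.Icc (0 : ℝ) Hm := fun s => ⟨(m2 s).1, (m2 s).2.trans hHm'⟩
    rw [expSum_succ P π hr (C := 1) (fun h s a => by
      rw [abs_of_nonneg (hr01 h s a).1]; exact (hr01 h s a).2), truncValue]
    refine integral_mono (Integrable.of_finite) (Integrable.of_finite) fun a => ?_
    refine le_min ?_ ?_
    -- Truncation does no harm to optimism: the true value from here on is at most the number of
    -- remaining steps, which is below `B`.
    · have h1 := (integral_mem_Icc (μ := P 0 (s, a)) m1 m2).2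
      have h2 := (hr01 0 s a).2
      push_cast at hHm
      linarith
    -- The comparison hypothesis is used for the true continuation value; the planned one replaces
    -- it afterwards, by monotonicity under the estimated density.
    · refine (hle 0 s a _ m1 m3).trans ?_
      refine add_le_add le_rfl ?_
      refine integral_mono ((hd 0 s a).integrable_mul m1 m3) ((hd 0 s a).integrable_mul t1 t2)
        fun s' => mul_le_mul_of_nonneg_left (ih' s') ((hd 0 s a).nonneg s')

/-- The simulation inequality: the truncated value in the estimated model is at most the true
expected sum of rewards that absorb the estimation errors. -/
lemma truncValue_le_expSum [SFinite ν] {B : ℝ} (hB : 0 ≤ B) (H : ℕ) :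
    ∀ (P : Fin H → Kernel (S × A) S) (π : Fin H → Kernel S A)
    (r' g : Fin H → S → A → ℝ) (p : Fin H → S → A → S → ℝ) (C : ℝ),
    (∀ h, IsMarkovKernel (P h)) → (∀ h, IsMarkovKernel (π h)) →
    (∀ h, Measurable (Function.uncurry (r' h))) → (∀ h s a, 0 ≤ r' h s a) →
    (∀ h, Measurable (Function.uncurry (g h))) → (∀ h s a, g h s a ∈ Set.Icc 0 C) →
    (∀ h, Measurable fun y : (S × A) × S => p h y.1.1 y.1.2 y.2) →
    (∀ h s a, IsDensity ν (p h s a)) →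
    (∀ h s a (V : S → ℝ), Measurable V → (∀ s, V s ∈ Set.Icc 0 B) →
      r' h s a + ∫ s', p h s a s' * V s' ∂ν ≤ g h s a + ∫ s', V s' ∂(P h (s, a))) →
    ∀ s, truncValue ν B H r' p π s ≤ expSum P π g s := by
  induction H with
  | zero => intro P π r' g p C _ _ _ _ _ _ _ _ _ s; simp [expSum, truncValue]
  | succ H ih =>
    intro P π r' g p C hP hπ hr' hr'0 hg hg0 hp hd hle s
    have ih' := ih (fun h => P h.succ) (fun h => π h.succ) (fun h => r' h.succ)
      (fun h => g h.succ) (fun h => p h.succ) C (fun h => hP _) (fun h => hπ _)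
      (fun h => hr' _) (fun h => hr'0 _) (fun h => hg _) (fun h => hg0 _) (fun h => hp _)
      (fun h => hd _) (fun h => hle _)
    obtain ⟨t1, t2⟩ := truncValue_measurable_and_mem (ν := ν) hB H
      (fun h => r' h.succ) (fun h => p h.succ) (fun h => π h.succ) (fun h => hπ _)
      (fun h => hr' _) (fun h => hr'0 _) (fun h => hp _) (fun h => hd _)
    have m1 : Measurable (expSum (fun h => P h.succ) (fun h => π h.succ) (fun h => g h.succ)) :=
      measurable_expSum _ _ (fun h => hg h.succ)
    have m2 := expSum_mem_Icc (fun h => P h.succ) (fun h => π h.succ) (fun h => hg h.succ)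
        (fun h => hg0 h.succ)
    rw [expSum_succ P π hg (C := C) (fun h s a => by
      rw [abs_of_nonneg (hg0 h s a).1]; exact (hg0 h s a).2), truncValue]
    refine integral_mono (Integrable.of_finite) (Integrable.of_finite) fun a => ?_
    -- Here the hypothesis is used for the planned continuation value, admissible because truncation
    -- confines it to `[0, B]`. The induction hypothesis is then integrated against the true kernel.
    refine (min_le_right _ _).trans ((hle 0 s a _ t1 t2).trans ?_)
    refine add_le_add le_rfl ?_
    exact integral_mono (integrable_of_mem_Icc t1 t2) (integrable_of_mem_Icc m1 m2) ih'

end Planning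

/-! ### Monotonicity and size of the parameters -/

section Parameters

variable {γ γ₁ γ₂ δ : ℝ} {d H K n : ℕ}

lemma log_arg_ge_two (hH : 1 ≤ H) (hδ : 0 < δ) (hδ1 : δ < 1) (hn : 1 ≤ n) :
    (2 : ℝ) ≤ 2 * n * H / δ := by
  have h1 : (1 : ℝ) ≤ H := by exact_mod_cast hH
  have h2 : (1 : ℝ) ≤ n := by exact_mod_cast hn
  rw [le_div_iff₀ hδ]
  nlinarith [mul_le_mul h2 h1 (by norm_num) (by linarith)]

lemma half_le_log (hH : 1 ≤ H) (hδ : 0 < δ) (hδ1 : δ < 1) (hn : 1 ≤ n) :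
    1 / 2 ≤ Real.log (2 * n * H / δ) := by
  have h := Real.log_le_log (by norm_num) (log_arg_ge_two hH hδ hδ1 hn)
  have := Real.log_two_gt_d9
  linarith

lemma reg_mono (hγ : 0 ≤ γ) (hH : 1 ≤ H) (hδ : 0 < δ) (hδ1 : δ < 1) {n n' : ℕ} (hn : 1 ≤ n)
    (hnn : n ≤ n') : reg γ d H δ n ≤ reg γ d H δ n' := by
  have h0 := log_arg_ge_two hH hδ hδ1 hn
  unfold reg
  have : (n : ℝ) ≤ n' := by exact_mod_cast hnn
  gcongr

/-- The logarithm is at least `log 2 > 1/2`, so `γ ≥ 2` suffices; this determines the value of `γ₀`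
in the theorem. -/
lemma one_le_reg (hγ : 2 ≤ γ) (hd : 1 ≤ d) (hH : 1 ≤ H) (hδ : 0 < δ) (hδ1 : δ < 1) (hn : 1 ≤ n) :
    1 ≤ reg γ d H δ n := by
  have h1 := half_le_log hH hδ hδ1 hn
  have h2 : (1 : ℝ) ≤ d := by exact_mod_cast hd
  unfold reg
  nlinarith [mul_le_mul hγ h2 (by norm_num) (by linarith)]

/-- The confidence radius `√(2 λ_n d + 4 log(2 n H K / δ))`. -/
noncomputable def radius (γ₁ : ℝ) (d H K : ℕ) (δ : ℝ) (n : ℕ) : ℝ :=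
  √(2 * reg γ₁ d H δ n * d + 4 * Real.log (2 * n * H * K / δ))

lemma radius_nonneg : 0 ≤ radius γ₁ d H K δ n := Real.sqrt_nonneg _

lemma log_mul_card_nonneg (hK : 1 ≤ K) (hH : 1 ≤ H) (hδ : 0 < δ) (hδ1 : δ < 1) (hn : 1 ≤ n) :
    0 ≤ Real.log (2 * n * H * K / δ) := by
  have h0 := log_arg_ge_two hH hδ hδ1 hn
  have h1 : (1 : ℝ) ≤ K := by exact_mod_cast hK
  refine Real.log_nonneg ?_
  rw [mul_div_right_comm]
  nlinarith

lemma radius_mono (hγ : 0 ≤ γ₁) (hK : 1 ≤ K) (hH : 1 ≤ H) (hδ : 0 < δ) (hδ1 : δ < 1) {n n' : ℕ}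
    (hn : 1 ≤ n) (hnn : n ≤ n') : radius γ₁ d H K δ n ≤ radius γ₁ d H K δ n' := by
  have h1 := reg_mono (d := d) hγ hH hδ hδ1 hn hnn
  have : (n : ℝ) ≤ n' := by exact_mod_cast hnn
  have hn0 : (0 : ℝ) < n := by exact_mod_cast hn
  have hH0 : (0 : ℝ) < H := by exact_mod_cast hH
  have hK0 : (0 : ℝ) < K := by exact_mod_cast hK
  unfold radius
  gcongr

end Parameters

/-! ### Feature norms and the analysis bonus -/

section FeatureNorms

variable {H d : ℕ} {W S A : Type*}

lemma featNorm_nonneg (v : Fin H → S × A × W → Vec d) (c : ℝ) {i : ℕ}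
    (D : Fin i → Episode H W S A) (h : Fin H) (x : S × A × W) : 0 ≤ featNorm v c D h x :=
  matNorm_nonneg _ _

lemma featNorm_sq_le {v : Fin H → S × A × W → Vec d} (hv : ∀ h x, ‖v h x‖ ≤ 1) {c : ℝ}
    (hc : 0 < c) {i : ℕ} (D : Fin i → Episode H W S A) (h : Fin H) (x : S × A × W) :
    featNorm v c D h x ^ 2 ≤ 1 / c := by
  refine (matNorm_gram_inv_sq_le _ hc _).trans ?_
  gcongr
  have := hv h x
  nlinarith [norm_nonneg (v h x)]

lemma featNorm_le_one {v : Fin H → S × A × W → Vec d} (hv : ∀ h x, ‖v h x‖ ≤ 1) {c : ℝ}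
    (hc : 1 ≤ c) {i : ℕ} (D : Fin i → Episode H W S A) (h : Fin H) (x : S × A × W) :
    featNorm v c D h x ≤ 1 := by
  have h1 := featNorm_sq_le hv (by linarith) D h x
  have h2 : 1 / c ≤ 1 := by rw [div_le_one (by linarith)]; exact hc
  exact (sq_le_one_iff₀ (featNorm_nonneg _ _ _ _ _)).1 (h1.trans h2)

/-- The exploration bonus that dominates the per-step gap between the optimistic model and the
true one. -/
noncomputable def bonus (φ ψ : Fin H → S × A × W → Vec d) (K : ℕ) (γ₁ γ₂ δ : ℝ)
    {i : ℕ} (D : Fin i → Episode H W S A) (h : Fin H) (x : S × A × W) : ℝ :=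
  -- The factor 11 is 5 from `alpha` plus 6 from the model error on values up to `3H`. The factor 2
  -- is the ridge error plus the reward bonus.
  11 * H * radius γ₁ d H K δ (i + 1) * featNorm φ (reg γ₁ d H δ (i + 1)) D h x +
    2 * beta γ₂ d H δ (i + 1) * featNorm ψ (reg γ₂ d H δ (i + 1)) D h x

lemma bonus_nonneg {φ ψ : Fin H → S × A × W → Vec d} {γ₁ γ₂ δ : ℝ} {K i : ℕ}
    (D : Fin i → Episode H W S A) (h : Fin H) (x : S × A × W) :
    0 ≤ bonus φ ψ K γ₁ γ₂ δ D h x := by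
  unfold bonus
  have := featNorm_nonneg φ (reg γ₁ d H δ (i + 1)) D h x
  have := featNorm_nonneg ψ (reg γ₂ d H δ (i + 1)) D h x
  have := radius_nonneg (γ₁ := γ₁) (d := d) (H := H) (K := K) (δ := δ) (n := i + 1)
  have : 0 ≤ beta γ₂ d H δ (i + 1) := Real.sqrt_nonneg _
  positivity

end FeatureNorms

/-! ### From the sub-optimality gap to expected bonuses -/

section Gap

variable {H d : ℕ} {W S A : Type*} [MeasurableSpace W] [MeasurableSpace S] [MeasurableSpace A]

lemma measurable_featNorm {v : Fin H → S × A × W → Vec d} (hv : ∀ h, Measurable (v h)) (c : ℝ)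
    (i : ℕ) (h : Fin H) : Measurable fun p : (Fin i → Episode H W S A) × (S × A × W) =>
      featNorm v c p.1 h p.2 := by
  refine (measurable_matNorm_gram c).comp
    (f := fun p : (Fin i → Episode H W S A) × (S × A × W) =>
      ((fun τ => v h (visit (p.1 τ) h)), v h p.2)) (Measurable.prodMk ?_ ?_)
  · refine measurable_pi_iff.2 fun τ => (hv h).comp ((measurable_visit h).comp ?_)
    exact (measurable_pi_apply τ).comp measurable_fst
  · exact (hv h).comp measurable_snd

variable {M : CMDP H W S A} {ν : Measure S} {φ ψ : Fin H → S × A × W → Vec d}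
  {μ : Fin H → S → Vec d} {η : Fin H → Vec d} {Ψ : Finset (S → Vec d)} {γ₁ γ₂ δ : ℝ}

lemma CMDP.value_eq_expSum (M : CMDP H W S A) (w : W) (π : Policy H S A) :
    M.value w π = expSum (M.transAt w) π.kernel (fun h s a => M.r h (s, a, w)) M.s₁ := rfl

lemma CMDP.measurable_reward (M : CMDP H W S A) (w : W) (h : Fin H) :
    Measurable (Function.uncurry fun (s : S) (a : A) => M.r h (s, a, w)) :=
  (M.r_measurable h).comp (f := fun p : S × A => (p.1, p.2, w)) (by fun_prop)

lemma CMDP.value_mem_Icc (M : CMDP H W S A) (w : W) (π : Policy H S A) :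
    M.value w π ∈ Set.Icc (0 : ℝ) H := by
  have := expSum_mem_Icc (M.transAt w) π.kernel (M.measurable_reward w)
    (fun h s a => M.r_mem h (s, a, w)) M.s₁
  rwa [mul_one] at this

lemma CMDP.value_le_optValue (M : CMDP H W S A) (w : W) (π : Policy H S A) :
    M.value w π ≤ M.optValue w :=
  le_ciSup (f := fun π => M.value w π) ⟨H, by rintro _ ⟨π, rfl⟩; exact (M.value_mem_Icc w π).2⟩ π

lemma Learner.integral_gap_le_horizon (L : Learner H d W S A) (M : CMDP H W S A) (i : ℕ)
    (D : Fin i → Episode H W S A) :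
    ∫ w, (M.optValue w - M.value w (L.policy i D w)) ∂M.q ≤ H := by
  have h : ∫ w, (M.optValue w - M.value w (L.policy i D w)) ∂M.q ≤ ∫ _, (H : ℝ) ∂M.q := by
    -- `optValue` is a supremum over all policies and is not known to be measurable in the context;
    -- this form of monotonicity asks for integrability of the majorant only.
    refine integral_mono_of_nonneg (ae_of_all _ fun w => sub_nonneg.2 (M.value_le_optValue w _))
      (integrable_const _) (ae_of_all _ fun w => ?_)
    have : Nonempty (Policy H S A) := ⟨L.policy i D w⟩
    have h1 : M.optValue w ≤ H := ciSup_le fun π => (M.value_mem_Icc w π).2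
    have h2 := (M.value_mem_Icc w (L.policy i D w)).1
    simp only
    linarith
  simpa using h

lemma IsModelI.integral_trans (hM : IsModelI M ν φ ψ μ η) (w : W) (h : Fin H) (s : S) (a : A)
    (V : S → ℝ) : ∫ s', V s' ∂(M.transAt w h (s, a)) =
      ∫ s', inner ℝ (φ h (s, a, w)) (μ h s') * V s' ∂ν := by
  have e : M.transAt w h (s, a) = M.P h (s, a, w) := rfl
  rw [e, hM.trans_eq, integral_withDensity_eq_integral_toReal_smul
    ((hM.weight h).isDensity (s, a, w)).measurable.ennreal_ofReal (ae_of_all _ fun _ => by simp)]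
  refine integral_congr_ae (ae_of_all _ fun s' => ?_)
  simp only [smul_eq_mul]
  rw [ENNReal.toReal_ofReal ((hM.weight h).nonneg _ _)]

lemma IsModelI.abs_ridge_sub_le (hM : IsModelI M ν φ ψ μ η) {c : ℝ} (hc : 0 < c) {i : ℕ}
    (D : Fin i → Episode H W S A) (h : Fin H) (x : S × A × W) :
    |inner ℝ (ridge M ψ c D h) (ψ h x) - M.r h x| ≤ √(d * c) * featNorm ψ c D h x := by
  have := abs_inner_ridge_sub_le (fun τ => ψ h (visit (D τ) h)) hc (η h) (ψ h x) (hM.η_norm_le h)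
  simp only [← hM.reward_eq] at this
  exact this

lemma abs_clip_sub_le {y r : ℝ} (hr : r ∈ Set.Icc (0 : ℝ) 1) :
    |max 0 (min 1 y) - r| ≤ |y - r| := by
  have e : r = max 0 (min 1 r) := by rw [min_eq_right hr.2, max_eq_right hr.1]
  conv_lhs => rw [e]
  rw [max_comm 0, max_comm 0]
  exact (abs_max_sub_max_le_abs _ _ _).trans (by
    simpa [abs_sub_comm] using abs_min_sub_min_le_max 1 y 1 r)

/-- The model error of `m` is small on the data `D`. -/
def IsAccurate (ν : Measure S) (φ : Fin H → S × A × W → Vec d) (μ : Fin H → S → Vec d) (K : ℕ)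
    (δ : ℝ) {i : ℕ} (D : Fin i → Episode H W S A) (m : Fin H → S → Vec d) : Prop :=
  ∀ h, dataError ν φ μ D h (m h) ≤ 2 * Real.log (2 * ((i + 1 : ℕ) : ℝ) * H * K / δ)

/-- With `T = 2 log (2 n H K / δ)` and `c = λ_n`, the root `√(4 d c + 8 T)` is at most twice the
confidence radius. -/
lemma IsAccurate.abs_integral_sub_le (hM : IsModelI M ν φ ψ μ η) {K : ℕ} (hK : 1 ≤ K)
    (hH : 1 ≤ H) (hδ : 0 < δ) (hδ1 : δ < 1) {i : ℕ} (hc : 0 < reg γ₁ d H δ (i + 1))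
    {D : Fin i → Episode H W S A} {m : Fin H → S → Vec d} (hm : ∀ h, IsWeight ν (φ h) (m h))
    (hD : IsAccurate ν φ μ K δ D m) {V : S → ℝ} (hV : Measurable V) {B : ℝ} (hB0 : 0 < B)
    (hB : ∀ s, V s ∈ Set.Icc 0 B) (h : Fin H) (x : S × A × W) :
    |∫ s, inner ℝ (φ h x) (μ h s) * V s ∂ν - ∫ s, inner ℝ (φ h x) (m h s) * V s ∂ν| ≤
      2 * B * radius γ₁ d H K δ (i + 1) * featNorm φ (reg γ₁ d H δ (i + 1)) D h x := by
  have hlog := log_mul_card_nonneg (n := i + 1) hK hH hδ hδ1 (by omega)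
  refine ((hM.weight h).abs_integral_sub_le (hm h) (fun τ => visit (D τ) h) hc
    (by positivity) (hD h) hV hB0 hB x).trans ?_
  refine mul_le_mul_of_nonneg_right ?_ (matNorm_nonneg _ _)
  rw [mul_comm 2 B, mul_assoc B 2]
  refine mul_le_mul_of_nonneg_left ?_ hB0.le
  have e : (2 : ℝ) = √4 := by rw [show (4 : ℝ) = 2 ^ 2 by norm_num]; simp
  rw [radius]
  conv_rhs => rw [e]
  rw [← Real.sqrt_mul (by norm_num)]
  refine Real.sqrt_le_sqrt ?_
  have : 0 ≤ d * reg γ₁ d H δ (i + 1) := by positivity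
  nlinarith

lemma bonus_le (hM : IsModelI M ν φ ψ μ η) {K i : ℕ} (h1 : 1 ≤ reg γ₁ d H δ (i + 1))
    (h2 : 1 ≤ reg γ₂ d H δ (i + 1)) (D : Fin i → Episode H W S A) (h : Fin H) (x : S × A × W) :
    bonus φ ψ K γ₁ γ₂ δ D h x ≤
      11 * H * radius γ₁ d H K δ (i + 1) + 2 * beta γ₂ d H δ (i + 1) := by
  unfold bonus
  have := featNorm_le_one hM.φ_norm_le h1 D h x
  have := featNorm_le_one hM.ψ_norm_le h2 D h x
  have := radius_nonneg (γ₁ := γ₁) (d := d) (H := H) (K := K) (δ := δ) (n := i + 1)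
  have : 0 ≤ beta γ₂ d H δ (i + 1) := Real.sqrt_nonneg _
  exact add_le_add (mul_le_of_le_one_right (by positivity) (by assumption))
    (mul_le_of_le_one_right (by positivity) (by assumption))

lemma measurable_bonus (hM : IsModelI M ν φ ψ μ η) (K i : ℕ) (h : Fin H) :
    Measurable fun p : (Fin i → Episode H W S A) × (S × A × W) =>
      bonus φ ψ K γ₁ γ₂ δ p.1 h p.2 :=
  ((measurable_featNorm hM.φ_measurable _ i h).const_mul _).add
    ((measurable_featNorm hM.ψ_measurable _ i h).const_mul _)

lemma optReward_nonneg {K i : ℕ} (hc : 0 ≤ alpha γ₁ d H K δ (i + 1))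
    (D : Fin i → Episode H W S A) (h : Fin H) (x : S × A × W) :
    0 ≤ optReward M φ ψ K γ₁ γ₂ δ D h x := by
  unfold optReward
  have : 0 ≤ beta γ₂ d H δ (i + 1) := Real.sqrt_nonneg _
  refine add_nonneg (add_nonneg (le_max_left _ _) (le_min ?_ (by positivity)))
    (le_min ?_ (by norm_num))
  · exact mul_nonneg hc (featNorm_nonneg _ _ _ _ _)
  · exact mul_nonneg this (featNorm_nonneg _ _ _ _ _)

lemma measurable_optReward (hM : IsModelI M ν φ ψ μ η) {K i : ℕ}
    (D : Fin i → Episode H W S A) (h : Fin H) :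
    Measurable fun x => optReward M φ ψ K γ₁ γ₂ δ D h x := by
  have m1 : Measurable fun x => featNorm φ (reg γ₁ d H δ (i + 1)) D h x :=
    (measurable_featNorm hM.φ_measurable _ i h).comp (f := fun x => (D, x)) (by fun_prop)
  have m2 : Measurable fun x => featNorm ψ (reg γ₂ d H δ (i + 1)) D h x :=
    (measurable_featNorm hM.ψ_measurable _ i h).comp (f := fun x => (D, x)) (by fun_prop)
  have m3 : Measurable fun x => (inner ℝ (ridge M ψ (reg γ₂ d H δ (i + 1)) D h) (ψ h x) : ℝ) :=
    measurable_const.inner (hM.ψ_measurable h)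
  exact ((measurable_const.max (measurable_const.min m3)).add
    ((m1.const_mul _).min measurable_const)).add ((m2.const_mul _).min measurable_const)

variable [Finite A] [MeasurableSingletonClass A] [SFinite ν]

/-- The sub-optimality gap in one context is at most the expected sum of bonuses. -/
lemma Learner.gap_le_expSum_bonus (L : Learner H d W S A) (hM : IsModelI M ν φ ψ μ η)
    (hΨ : IsModelClass ν φ μ Ψ) (hL : L.RunsUCB M ν φ ψ Ψ γ₁ γ₂ δ) (hH : 1 ≤ H) (hδ : 0 < δ)
    (hδ1 : δ < 1) {i : ℕ} (hi : 1 ≤ i) (h1 : 1 ≤ reg γ₁ d H δ (i + 1))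
    (h2 : 1 ≤ reg γ₂ d H δ (i + 1)) {D : Fin i → Episode H W S A}
    (hD : IsAccurate ν φ μ Ψ.card δ D (L.muHat i D)) (w : W) :
    M.optValue w - M.value w (L.policy i D w) ≤
      expSum (M.transAt w) (L.policy i D w).kernel
        (fun h s a => bonus φ ψ Ψ.card γ₁ γ₂ δ D h (s, a, w)) M.s₁ := by
  have hK : 1 ≤ Ψ.card := Finset.card_pos.2 ⟨_, hΨ.realizable ⟨0, hH⟩⟩
  have hH0 : (0 : ℝ) < H := by exact_mod_cast hH
  set Y := radius γ₁ d H Ψ.card δ (i + 1) with hY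
  have hY0 : 0 ≤ Y := radius_nonneg
  have hα : alpha γ₁ d H Ψ.card δ (i + 1) = 5 * H * Y := rfl
  have hβ0 : 0 ≤ beta γ₂ d H δ (i + 1) := Real.sqrt_nonneg _
  set m := L.muHat i D with hm
  have hmw : ∀ h, IsWeight ν (φ h) (m h) := fun h => hΨ.admissible _ (hL.mle_mem i hi D h) h
  have hφw : ∀ h, Measurable fun y : S × A => φ h (y.1, y.2, w) := fun h =>
    (hM.φ_measurable h).comp (f := fun y : S × A => (y.1, y.2, w)) (by fun_prop)
  have hpm : ∀ h, Measurable fun y : (S × A) × S =>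
      (inner ℝ (φ h (y.1.1, y.1.2, w)) (m h y.2) : ℝ) := fun h =>
    ((hφw h).comp measurable_fst).inner ((hmw h).measurable.comp measurable_snd)
  have hpd : ∀ h s a, IsDensity ν fun s' => (inner ℝ (φ h (s, a, w)) (m h s') : ℝ) :=
    fun h s a => (hmw h).isDensity (s, a, w)
  have hrm : ∀ h, Measurable (Function.uncurry fun (s : S) (a : A) =>
      optReward M φ ψ Ψ.card γ₁ γ₂ δ D h (s, a, w)) := fun h =>
    (measurable_optReward hM D h).comp (f := fun y : S × A => (y.1, y.2, w)) (by fun_prop)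
  have hr0 : ∀ h s a, 0 ≤ optReward M φ ψ Ψ.card γ₁ γ₂ δ D h (s, a, w) := fun h s a =>
    optReward_nonneg (by rw [hα]; positivity) D h _
  have herr := fun {V : S → ℝ} (hV : Measurable V) {B : ℝ} (hB0 : 0 < B)
    (hB : ∀ s, V s ∈ Set.Icc 0 B) => hD.abs_integral_sub_le hM hK hH hδ hδ1
      (by linarith : 0 < reg γ₁ d H δ (i + 1)) hmw hV hB0 hB
  have hclip : ∀ h x, |max 0 (min 1 (inner ℝ (ridge M ψ (reg γ₂ d H δ (i + 1)) D h) (ψ h x)))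
      - M.r h x| ≤ beta γ₂ d H δ (i + 1) * featNorm ψ (reg γ₂ d H δ (i + 1)) D h x := fun h x =>
    (abs_clip_sub_le (M.r_mem h x)).trans (hM.abs_ridge_sub_le (by linarith) D h x)
  have hclip1 : ∀ h x, max 0 (min 1 (inner ℝ (ridge M ψ (reg γ₂ d H δ (i + 1)) D h) (ψ h x)))
      ∈ Set.Icc (0 : ℝ) 1 := fun h x => ⟨le_max_left _ _, max_le zero_le_one (min_le_left _ _)⟩
  have hopt : ∀ π : Policy H S A, M.value w π ≤
      plannedValue M ν φ ψ Ψ.card γ₁ γ₂ δ D m w π := by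
    intro π
    rw [M.value_eq_expSum]
    refine expSum_le_truncValue (Hm := (H : ℝ)) (by linarith) H _ _ _ _ _ le_rfl
      inferInstance inferInstance (M.measurable_reward w)
      (fun h s a => M.r_mem h _) hrm hr0 hpm hpd ?_ _
    intro h s a V hV hVm
    rw [hM.integral_trans]
    have e1 := (abs_le.1 (herr hV hH0 hVm h (s, a, w))).2
    have e2 := abs_le.1 (hclip h (s, a, w))
    have e3 := (hM.weight h).isDensity (s, a, w)
    have e4 := (hpd h s a).integral_mul_nonneg fun s' => (hVm s').1
    have e5 : ∫ s', inner ℝ (φ h (s, a, w)) (μ h s') * V s' ∂ν ≤ H := by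
      calc ∫ s', inner ℝ (φ h (s, a, w)) (μ h s') * V s' ∂ν
          ≤ ∫ s', inner ℝ (φ h (s, a, w)) (μ h s') * H ∂ν :=
            integral_mono (e3.integrable_mul hV hVm) (e3.integrable.mul_const _) fun s' =>
              mul_le_mul_of_nonneg_left (hVm s').2 (e3.nonneg s')
        _ = H := by rw [integral_mul_const, e3.integral_eq_one, one_mul]
    have e6 : M.r h (s, a, w) ≤ max 0 (min 1 (inner ℝ (ridge M ψ (reg γ₂ d H δ (i + 1)) D h)
        (ψ h (s, a, w)))) + min (beta γ₂ d H δ (i + 1) *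
          featNorm ψ (reg γ₂ d H δ (i + 1)) D h (s, a, w)) 1 := by
      rw [← sub_le_iff_le_add']
      -- Capping the bonus at 1 preserves optimism, as the reward is at most 1 and the clipped
      -- estimate nonnegative. The cap `H` below works likewise, for expectations of values up to
      -- `H`.
      refine le_min (by linarith [e2.1]) ?_
      linarith [(M.r_mem h (s, a, w)).2, (hclip1 h (s, a, w)).1]
    have e7 : ∫ s', inner ℝ (φ h (s, a, w)) (μ h s') * V s' ∂ν ≤
        ∫ s', inner ℝ (φ h (s, a, w)) (m h s') * V s' ∂ν +
        min (alpha γ₁ d H Ψ.card δ (i + 1) *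
          featNorm φ (reg γ₁ d H δ (i + 1)) D h (s, a, w)) H := by
      rw [← sub_le_iff_le_add']
      refine le_min ?_ (by linarith)
      -- On values up to `H` the model error has the factor `2H`, which the `5H` in `alpha` covers.
      refine e1.trans ?_
      rw [hα]
      refine mul_le_mul_of_nonneg_right ?_ (featNorm_nonneg _ _ _ _ _)
      nlinarith [mul_nonneg hH0.le hY0]
    unfold optReward
    linarith
  have hsim : plannedValue M ν φ ψ Ψ.card γ₁ γ₂ δ D m w (L.policy i D w) ≤
      expSum (M.transAt w) (L.policy i D w).kernel (fun h s a => M.r h (s, a, w) +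
        bonus φ ψ Ψ.card γ₁ γ₂ δ D h (s, a, w)) M.s₁ := by
    refine truncValue_le_expSum (by positivity) H _ _ _ _ _
      (1 + (11 * H * Y + 2 * beta γ₂ d H δ (i + 1))) inferInstance inferInstance hrm hr0 ?_ ?_
      hpm hpd ?_ _
    · intro h
      exact (M.measurable_reward w h).add ((measurable_bonus hM Ψ.card i h).comp
        (f := fun y : S × A => (D, (y.1, y.2, w))) (by fun_prop))
    · intro h s a
      have b1 := M.r_mem h (s, a, w)
      exact ⟨add_nonneg b1.1 (bonus_nonneg D h _), add_le_add b1.2 (bonus_le hM h1 h2 D h _)⟩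
    · intro h s a V hV hVm
      rw [hM.integral_trans]
      -- Planned values reach `3H`, which gives the model error the factor `6H`.
      have e1 := (abs_le.1 (herr hV (by positivity : (0 : ℝ) < 3 * H) hVm h (s, a, w))).1
      have e2 := abs_le.1 (hclip h (s, a, w))
      unfold optReward bonus
      have e3 := min_le_left (alpha γ₁ d H Ψ.card δ (i + 1) *
          featNorm φ (reg γ₁ d H δ (i + 1)) D h (s, a, w)) H
      have e4 := min_le_left (beta γ₂ d H δ (i + 1) *
          featNorm ψ (reg γ₂ d H δ (i + 1)) D h (s, a, w)) 1
      rw [hα] at e3 ⊢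
      rw [← hY] at e1 ⊢
      linarith [e2.2]
  have : Nonempty (Policy H S A) := ⟨L.policy i D w⟩
  have h3 : M.optValue w ≤ plannedValue M ν φ ψ Ψ.card γ₁ γ₂ δ D m w (L.policy i D w) :=
    ciSup_le fun π => (hopt π).trans (hL.planning i hi D w π)
  have h4 := h3.trans hsim
  rw [expSum_add (M.transAt w) (L.policy i D w).kernel (C := 1)
    (g := fun h s a => bonus φ ψ Ψ.card γ₁ γ₂ δ D h (s, a, w))
    (C' := 11 * H * Y + 2 * beta γ₂ d H δ (i + 1)) (M.measurable_reward w)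
    (fun h => (measurable_bonus hM Ψ.card i h).comp
        (f := fun y : S × A => (D, (y.1, y.2, w))) (by fun_prop))
    (fun h s a => by
      rw [abs_of_nonneg (M.r_mem h _).1]; exact (M.r_mem h _).2)
    (fun h s a => by
      rw [abs_of_nonneg (bonus_nonneg D h _)]; exact bonus_le hM h1 h2 D h _),
    ← M.value_eq_expSum] at h4
  linarith

/-- The expected sub-optimality gap is at most the expected sum of bonuses in the next episode. -/
lemma Learner.integral_gap_le (L : Learner H d W S A) (hM : IsModelI M ν φ ψ μ η)
    (hΨ : IsModelClass ν φ μ Ψ) (hL : L.RunsUCB M ν φ ψ Ψ γ₁ γ₂ δ) (hH : 1 ≤ H) (hδ : 0 < δ)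
    (hδ1 : δ < 1) {i : ℕ} (hi : 1 ≤ i) (h1 : 1 ≤ reg γ₁ d H δ (i + 1))
    (h2 : 1 ≤ reg γ₂ d H δ (i + 1)) {D : Fin i → Episode H W S A}
    (hD : IsAccurate ν φ μ Ψ.card δ D (L.muHat i D)) :
    ∫ w, (M.optValue w - M.value w (L.policy i D w)) ∂M.q ≤
      ∫ e, ∑ h, bonus φ ψ Ψ.card γ₁ γ₂ δ D h (visit e h) ∂(L.stepLaw M i D) := by
  set C := 11 * H * radius γ₁ d H Ψ.card δ (i + 1) + 2 * beta γ₂ d H δ (i + 1)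
  have hm : Measurable fun e : Episode H W S A =>
      ∑ h, bonus φ ψ Ψ.card γ₁ γ₂ δ D h (visit e h) :=
    Finset.measurable_sum _ fun h _ => (measurable_bonus hM Ψ.card i h).comp
      (f := fun e : Episode H W S A => (D, visit e h)) (measurable_const.prodMk (measurable_visit h))
  have hb : ∀ e : Episode H W S A,
      ∑ h, bonus φ ψ Ψ.card γ₁ γ₂ δ D h (visit e h) ∈ Set.Icc 0 (H * C) := fun e => by
    refine ⟨Finset.sum_nonneg fun h _ => bonus_nonneg D h _, ?_⟩
    refine (Finset.sum_le_sum fun h _ => bonus_le hM h1 h2 D h _).trans ?_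
    simp [C, mul_add]
  rw [L.integral_stepLaw M i D hm (C := H * C) fun e => by
    rw [abs_of_nonneg (hb e).1]; exact (hb e).2]
  -- As before, nothing is needed about measurability of the gap in the context.
  refine integral_mono_of_nonneg (ae_of_all _ fun w => sub_nonneg.2 (M.value_le_optValue w _)) ?_
    (ae_of_all _ fun w => L.gap_le_expSum_bonus hM hΨ hL hH hδ hδ1 hi h1 h2 hD w)
  exact integrable_of_mem_Icc (L.measurable_integral_episodeLaw M i D hm) fun w =>
    integral_mem_Icc (hm.comp (f := fun τ => (w, τ)) (by fun_prop)) fun τ => hb (w, τ)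

end Gap

/-! ### Concentration, potential and the regret bound -/

section Regret

variable {H d : ℕ} {W S A : Type*} [MeasurableSpace W] [MeasurableSpace S] [MeasurableSpace A]

lemma integral_le_sqrt_integral_sq {Y : Type*} [MeasurableSpace Y] {μ : Measure Y}
    [IsProbabilityMeasure μ] {f : Y → ℝ} (hf : Measurable f) (h : ∀ y, f y ∈ Set.Icc (0 : ℝ) 1) :
    ∫ y, f y ∂μ ≤ √(∫ y, f y ^ 2 ∂μ) := by
  have i1 : Integrable f μ := integrable_of_mem_Icc hf h
  have i2 : Integrable (fun y => f y ^ 2) μ := integrable_of_mem_Icc (hf.pow_const 2) (B := 1)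
    fun y => ⟨sq_nonneg _, pow_le_one₀ (h y).1 (h y).2⟩
  refine Real.le_sqrt_of_sq_le ?_
  set m := ∫ y, f y ∂μ with hm
  have h0 : 0 ≤ ∫ y, (f y - m) ^ 2 ∂μ := integral_nonneg fun y => sq_nonneg _
  have e : ∀ y, (f y - m) ^ 2 = f y ^ 2 - (2 * m * f y - m ^ 2) := fun y => by ring
  simp_rw [e] at h0
  have i3 : Integrable (fun y => 2 * m * f y - m ^ 2) μ :=
    (i1.const_mul _).sub (integrable_const _)
  rw [integral_sub i2 i3, integral_sub (i1.const_mul _) (integrable_const _),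
    integral_const_mul] at h0
  simp only [integral_const, probReal_univ, smul_eq_mul, one_mul, ← hm] at h0
  nlinarith

/-- The bad event that, at some step, the conditional means of the squared feature norms exceed
their empirical sum. -/
def concentrationBad (L : Learner H d W S A) (M : CMDP H W S A) (v : Fin H → S × A × W → Vec d)
    (c δ : ℝ) (N : ℕ) : Set (Fin N → Episode H W S A) :=
  {x | ∃ h, 2 * (∑ i : Fin N, c * featNorm v c (pre x i) h (visit (x i) h) ^ 2 +
      Real.log (2 * (1 : ℕ) * H / δ)) <
    ∑ i : Fin N, ∫ e, c * featNorm v c (pre x i) h (visit e h) ^ 2 ∂(L.stepLaw M i (pre x i))}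

lemma Learner.measure_concentrationBad_le (L : Learner H d W S A) (M : CMDP H W S A)
    {v : Fin H → S × A × W → Vec d} (hv : ∀ h, Measurable (v h)) (hv1 : ∀ h x, ‖v h x‖ ≤ 1)
    {c δ : ℝ} (hc : 0 < c) (hδ : 0 < δ) (hH : 1 ≤ H) (N : ℕ) :
    L.runLaw M N (concentrationBad L M v c δ N) ≤ ENNReal.ofReal (δ / 2) := by
  have hH0 : (0 : ℝ) < H := by exact_mod_cast hH
  have hsub : concentrationBad L M v c δ N ⊆ ⋃ h ∈ (Finset.univ : Finset (Fin H)),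
      {x | 2 * (∑ i : Fin N, c * featNorm v c (pre x i) h (visit (x i) h) ^ 2 +
        Real.log (2 * (1 : ℕ) * H / δ)) < ∑ i : Fin N, ∫ e,
          c * featNorm v c (pre x i) h (visit e h) ^ 2 ∂(L.stepLaw M i (pre x i))} := by
    rintro x ⟨h, hx⟩
    simp only [Set.mem_iUnion]
    exact ⟨h, Finset.mem_univ _, hx⟩
  refine (measure_mono hsub).trans ((measure_biUnion_finset_le _ _).trans ?_)
  have hh : ∀ h : Fin H, L.runLaw M N
      {x | 2 * (∑ i : Fin N, c * featNorm v c (pre x i) h (visit (x i) h) ^ 2 +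
        Real.log (2 * (1 : ℕ) * H / δ)) < ∑ i : Fin N, ∫ e,
          c * featNorm v c (pre x i) h (visit e h) ^ 2 ∂(L.stepLaw M i (pre x i))} ≤
      ENNReal.ofReal (δ / (2 * H)) := by
    intro h
    refine (L.measure_sum_integral_gt_le M
      (z := fun i D e => c * featNorm v c D h (visit e h) ^ 2) (fun i => ?_) (fun i D e => ?_) N
      (Real.log (2 * (1 : ℕ) * H / δ))).trans (le_of_eq ?_)
    · exact (((measurable_featNorm hv c i h).comp
        (f := fun p : (Fin i → Episode H W S A) × Episode H W S A => (p.1, visit p.2 h))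
        (measurable_fst.prodMk ((measurable_visit h).comp measurable_snd))).pow_const 2).const_mul c
    -- The factor `c` normalizes: squared feature norms are at most `1 / c`, so the observations lie
    -- in `[0, 1]`.
    · refine ⟨by positivity, ?_⟩
      have := featNorm_sq_le hv1 hc D h (visit e h)
      rwa [le_div_iff₀ hc, mul_comm] at this
    -- Each step fails with probability `δ / (2H)`, leaving `δ / 2` for the union over the horizon.
    · rw [Real.exp_neg, Real.exp_log (by positivity)]
      congr 1
      push_cast
      field_simp
  refine (Finset.sum_le_sum fun h _ => hh h).trans (le_of_eq ?_)
  rw [Finset.sum_const, Finset.card_univ, Fintype.card_fin, nsmul_eq_mul,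
    ← ENNReal.ofReal_natCast, ← ENNReal.ofReal_mul (by positivity)]
  congr 1
  field_simp

/-- Outside of the bad event the squared feature norms satisfy a potential bound in conditional
mean. -/
lemma Learner.sum_integral_featNorm_sq_le (L : Learner H d W S A) (M : CMDP H W S A)
    {v : Fin H → S × A × W → Vec d} (hv1 : ∀ h x, ‖v h x‖ ≤ 1) {c δ : ℝ} (hc : 1 ≤ c)
    (hd : 1 ≤ d) {N : ℕ} {x : Fin N → Episode H W S A} (hx : x ∉ concentrationBad L M v c δ N)
    (h : Fin H) :
    ∑ i : Fin N, ∫ e, featNorm v c (pre x i) h (visit e h) ^ 2 ∂(L.stepLaw M i (pre x i)) ≤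
      4 * d * Real.log (1 + N / (d * c)) + 2 * Real.log (2 * (1 : ℕ) * H / δ) / c := by
  have hc0 : 0 < c := by linarith
  simp only [concentrationBad, Set.mem_ofPred_eq, not_exists, not_lt] at hx
  have h1 := hx h
  simp only [integral_const_mul, ← Finset.mul_sum] at h1
  have h2 : ∑ i : Fin N, featNorm v c (pre x i) h (visit (x i) h) ^ 2 ≤
      2 * d * Real.log (1 + N / (d * c)) :=
    elliptic_potential hc (by omega) (fun τ => v h (visit (x τ) h)) (fun τ => hv1 _ _)
  rw [← le_div_iff₀' hc0] at h1
  refine h1.trans ?_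
  have e : 2 * (c * ∑ i : Fin N, featNorm v c (pre x i) h (visit (x i) h) ^ 2 +
      Real.log (2 * (1 : ℕ) * H / δ)) / c =
      2 * ∑ i : Fin N, featNorm v c (pre x i) h (visit (x i) h) ^ 2 +
        2 * Real.log (2 * (1 : ℕ) * H / δ) / c := by field_simp
  rw [e]
  linarith

lemma sum_sqrt_le_sqrt_card_mul {N : ℕ} {E : Fin N → ℝ} (hE : ∀ i, 0 ≤ E i) {T : ℝ}
    (hT : ∑ i, E i ≤ T) : ∑ i, √(E i) ≤ √(N * T) := by
  refine Real.le_sqrt_of_sq_le ?_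
  have h := sq_sum_le_card_mul_sum_sq (s := Finset.univ) (f := fun i => √(E i))
  simp only [Real.sq_sqrt (hE _), Finset.card_univ, Fintype.card_fin] at h
  exact h.trans (by gcongr)

variable {M : CMDP H W S A} {ν : Measure S} {φ ψ : Fin H → S × A × W → Vec d}
  {μ : Fin H → S → Vec d} {η : Fin H → Vec d} {Ψ : Finset (S → Vec d)} {γ₁ γ₂ δ : ℝ}

lemma measurable_featNorm_visit {v : Fin H → S × A × W → Vec d} (hv : ∀ h, Measurable (v h))
    (c : ℝ) {i : ℕ} (D : Fin i → Episode H W S A) (h : Fin H) :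
    Measurable fun e : Episode H W S A => featNorm v c D h (visit e h) :=
  (measurable_featNorm hv c i h).comp (f := fun e : Episode H W S A => (D, visit e h))
    (measurable_const.prodMk (measurable_visit h))

/-- The expected bonuses of episode `i + 1`, in terms of the mean squared feature norms for the
initial regularizers. -/
lemma Learner.integral_bonus_le (L : Learner H d W S A) (hM : IsModelI M ν φ ψ μ η) {K : ℕ}
    (hK : 1 ≤ K) (hH : 1 ≤ H) (hd : 1 ≤ d) (hδ : 0 < δ) (hδ1 : δ < 1) (hγ₁ : 2 ≤ γ₁)
    (hγ₂ : 2 ≤ γ₂) {i N : ℕ} (hi : i < N) (D : Fin i → Episode H W S A) :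
    ∫ e, ∑ h, bonus φ ψ K γ₁ γ₂ δ D h (visit e h) ∂(L.stepLaw M i D) ≤
      ∑ h, (11 * H * radius γ₁ d H K δ N * √(∫ e, featNorm φ (reg γ₁ d H δ 1) D h (visit e h) ^ 2
          ∂(L.stepLaw M i D)) +
        2 * beta γ₂ d H δ N * √(∫ e, featNorm ψ (reg γ₂ d H δ 1) D h (visit e h) ^ 2
          ∂(L.stepLaw M i D))) := by
  have c1 := one_le_reg hγ₁ hd hH hδ hδ1 (le_refl 1)
  have c2 := one_le_reg hγ₂ hd hH hδ hδ1 (le_refl 1)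
  have c1' := one_le_reg hγ₁ hd hH hδ hδ1 (n := i + 1) (by omega)
  have c2' := one_le_reg hγ₂ hd hH hδ hδ1 (n := i + 1) (by omega)
  have r1 := reg_mono (d := d) (by linarith : 0 ≤ γ₁) hH hδ hδ1 (le_refl 1)
    (show 1 ≤ i + 1 by omega)
  have r2 := reg_mono (d := d) (by linarith : 0 ≤ γ₂) hH hδ hδ1 (le_refl 1)
    (show 1 ≤ i + 1 by omega)
  have q1 := radius_mono (d := d) (by linarith : 0 ≤ γ₁) hK hH hδ hδ1
    (show 1 ≤ i + 1 by omega) (show i + 1 ≤ N by omega)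
  have q2 : beta γ₂ d H δ (i + 1) ≤ beta γ₂ d H δ N := by
    have := reg_mono (d := d) (by linarith : 0 ≤ γ₂) hH hδ hδ1
      (show 1 ≤ i + 1 by omega) (show i + 1 ≤ N by omega)
    unfold beta; gcongr
  have q0 := radius_nonneg (γ₁ := γ₁) (d := d) (H := H) (K := K) (δ := δ) (n := i + 1)
  have q0' : 0 ≤ beta γ₂ d H δ (i + 1) := Real.sqrt_nonneg _
  have m1 := fun h => measurable_featNorm_visit hM.φ_measurable (reg γ₁ d H δ 1) D h
  have m2 := fun h => measurable_featNorm_visit hM.ψ_measurable (reg γ₂ d H δ 1) D h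
  have b1 : ∀ (h : Fin H) (e : Episode H W S A),
      featNorm φ (reg γ₁ d H δ 1) D h (visit e h) ∈ Set.Icc (0 : ℝ) 1 := fun h e =>
    ⟨featNorm_nonneg _ _ _ _ _, featNorm_le_one hM.φ_norm_le c1 _ _ _⟩
  have b2 : ∀ (h : Fin H) (e : Episode H W S A),
      featNorm ψ (reg γ₂ d H δ 1) D h (visit e h) ∈ Set.Icc (0 : ℝ) 1 := fun h e =>
    ⟨featNorm_nonneg _ _ _ _ _, featNorm_le_one hM.ψ_norm_le c2 _ _ _⟩
  have i1 := fun h => integrable_of_mem_Icc (μ := L.stepLaw M i D) (m1 h) (b1 h)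
  have i2 := fun h => integrable_of_mem_Icc (μ := L.stepLaw M i D) (m2 h) (b2 h)
  have hmb : ∀ h, Measurable fun e : Episode H W S A =>
      bonus φ ψ K γ₁ γ₂ δ D h (visit e h) := fun h => (measurable_bonus hM K i h).comp
      (f := fun e : Episode H W S A => (D, visit e h)) (measurable_const.prodMk (measurable_visit h))
  have ib : ∀ h, Integrable (fun e : Episode H W S A =>
      bonus φ ψ K γ₁ γ₂ δ D h (visit e h)) (L.stepLaw M i D) := fun h =>
    integrable_of_mem_Icc (hmb h) fun e => ⟨bonus_nonneg D h _, bonus_le hM c1' c2' D h _⟩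
  rw [integral_finsetSum _ fun h _ => ib h]
  refine Finset.sum_le_sum fun h _ => ?_
  calc ∫ e, bonus φ ψ K γ₁ γ₂ δ D h (visit e h) ∂(L.stepLaw M i D)
      ≤ ∫ e, (11 * H * radius γ₁ d H K δ N * featNorm φ (reg γ₁ d H δ 1) D h (visit e h) +
          2 * beta γ₂ d H δ N * featNorm ψ (reg γ₂ d H δ 1) D h (visit e h)) ∂(L.stepLaw M i D) := by
        refine integral_mono (ib h) (((i1 h).const_mul _).add ((i2 h).const_mul _)) fun e => ?_
        -- Regularizers increase with the episode, so freezing them at their first value only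
        -- enlarges the norms; the potential lemma needs one fixed regularizer. Radius and `beta`
        -- are replaced by their final values.
        have f1 : featNorm φ (reg γ₁ d H δ (i + 1)) D h (visit e h) ≤
            featNorm φ (reg γ₁ d H δ 1) D h (visit e h) :=
          matNorm_gram_inv_antitone _ (by linarith) r1 _
        have f2 : featNorm ψ (reg γ₂ d H δ (i + 1)) D h (visit e h) ≤
            featNorm ψ (reg γ₂ d H δ 1) D h (visit e h) :=
          matNorm_gram_inv_antitone _ (by linarith) r2 _
        have f3 := featNorm_nonneg φ (reg γ₁ d H δ (i + 1)) D h (visit e h)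
        have f4 := featNorm_nonneg ψ (reg γ₂ d H δ (i + 1)) D h (visit e h)
        have q3 := q0.trans q1
        have q4 := q0'.trans q2
        simp only [bonus]
        exact add_le_add (mul_le_mul (by gcongr) f1 f3 (by positivity))
          (mul_le_mul (by gcongr) f2 f4 (by positivity))
    _ = 11 * H * radius γ₁ d H K δ N *
            ∫ e, featNorm φ (reg γ₁ d H δ 1) D h (visit e h) ∂(L.stepLaw M i D) +
          2 * beta γ₂ d H δ N *
            ∫ e, featNorm ψ (reg γ₂ d H δ 1) D h (visit e h) ∂(L.stepLaw M i D) := by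
        rw [integral_add ((i1 h).const_mul _) ((i2 h).const_mul _), integral_const_mul,
          integral_const_mul]
    _ ≤ _ := by
        have g1 := integral_le_sqrt_integral_sq (μ := L.stepLaw M i D) (m1 h) (b1 h)
        have g2 := integral_le_sqrt_integral_sq (μ := L.stepLaw M i D) (m2 h) (b2 h)
        have q3 := q0.trans q1
        have q4 := q0'.trans q2
        gcongr

/-- The right-hand side of the regret bound. -/
noncomputable def regretBound (γ₁ γ₂ δ : ℝ) (d H K N : ℕ) : ℝ :=
  (42 * H * √(2 * d * reg γ₁ d H δ N + 4 * Real.log (2 * H * N * K / δ))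
      + 6 * √(d * reg γ₂ d H δ N))
    * (H * √(2 * d / N))
    * √(Real.log (1 + N / (d * min (reg γ₁ d H δ 1) (reg γ₂ d H δ 1))))

lemma regretBound_eq (γ₁ γ₂ δ : ℝ) (d H K N : ℕ) : regretBound γ₁ γ₂ δ d H K N =
    (42 * H * radius γ₁ d H K δ N + 6 * beta γ₂ d H δ N) * (H * √(2 * d / N)) *
      √(Real.log (1 + N / (d * min (reg γ₁ d H δ 1) (reg γ₂ d H δ 1)))) := by
  unfold regretBound radius beta
  rw [show 2 * (d : ℝ) * reg γ₁ d H δ N = 2 * reg γ₁ d H δ N * d by ring,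
    show 2 * (H : ℝ) * N * K / δ = 2 * N * H * K / δ by ring]

lemma two_mul_reg_le_radius_sq {K N : ℕ} (hK : 1 ≤ K) (hH : 1 ≤ H) (hδ : 0 < δ)
    (hδ1 : δ < 1) (hN : 1 ≤ N) (hγ₁ : 0 ≤ γ₁) :
    2 * reg γ₁ d H δ N * d ≤ radius γ₁ d H K δ N ^ 2 := by
  have h0 := log_mul_card_nonneg hK hH hδ hδ1 hN
  have h1 : 0 ≤ reg γ₁ d H δ N := by
    have := half_le_log hH hδ hδ1 hN
    unfold reg; positivity
  rw [radius, Real.sq_sqrt (by positivity)]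
  linarith

/-- For few episodes the regret bound is trivial. -/
lemma horizon_le_regretBound {K N : ℕ} (hK : 1 ≤ K) (hH : 1 ≤ H) (hd : 1 ≤ d) (hδ : 0 < δ)
    (hδ1 : δ < 1) (hN : 1 ≤ N) (hγ₁ : 2 ≤ γ₁) (hγ₂ : 2 ≤ γ₂)
    (hlt : (N : ℝ) ≤ d * min (reg γ₁ d H δ 1) (reg γ₂ d H δ 1)) :
    (H : ℝ) ≤ regretBound γ₁ γ₂ δ d H K N := by
  set lam := min (reg γ₁ d H δ 1) (reg γ₂ d H δ 1) with hlam
  have c1 := one_le_reg hγ₁ hd hH hδ hδ1 (le_refl 1)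
  have c2 := one_le_reg hγ₂ hd hH hδ hδ1 (le_refl 1)
  have hl1 : 1 ≤ lam := le_min c1 c2
  have hlN : lam ≤ reg γ₁ d H δ N :=
    (min_le_left _ _).trans (reg_mono (by linarith) hH hδ hδ1 (le_refl 1) hN)
  have hN0 : (0 : ℝ) < N := by exact_mod_cast hN
  have hd1 : (1 : ℝ) ≤ d := by exact_mod_cast hd
  have hH1 : (1 : ℝ) ≤ H := by exact_mod_cast hH
  rw [regretBound_eq]
  set Y := radius γ₁ d H K δ N with hY
  have hY0 : 0 ≤ Y := radius_nonneg
  have hYsq := two_mul_reg_le_radius_sq (d := d) hK hH hδ hδ1 hN (by linarith : 0 ≤ γ₁)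
  rw [← hY] at hYsq
  have hu0 : 0 ≤ N / (d * lam) := by positivity
  have hlog := le_two_mul_log_one_add hu0 ((div_le_one (by positivity)).2 hlt)
  have hβ : 0 ≤ beta γ₂ d H δ N := Real.sqrt_nonneg _
  set Lg := Real.log (1 + N / (d * lam)) with hLg
  -- With `u = N / (d λ) ≤ 1`, use `Y² ≥ 2 λ d` and `log (1 + u) ≥ u / 2`; the squared product is
  -- then at least `2 d`.
  have key : 1 ≤ Y * √(2 * d / N) * √Lg := by
    refine (one_le_sq_iff₀ (by positivity)).1 ?_
    rw [mul_pow, mul_pow, Real.sq_sqrt (by positivity), Real.sq_sqrt (by linarith)]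
    calc (1 : ℝ) ≤ (2 * lam * d) * (2 * d / N) * (N / (d * lam) / 2) := by
          have : (2 * lam * d) * (2 * d / N) * (N / (d * lam) / 2) = 2 * d := by
            field_simp
          rw [this]; linarith
      _ ≤ Y ^ 2 * (2 * d / N) * Lg := by
          have : 2 * lam * d ≤ Y ^ 2 := le_trans (by gcongr) hYsq
          have h3 : N / (d * lam) / 2 ≤ Lg := by linarith
          gcongr
  calc (H : ℝ) ≤ 42 * H * H * 1 := by nlinarith
    _ ≤ 42 * H * H * (Y * √(2 * d / N) * √Lg) := by gcongr
    _ = (42 * H * Y) * (H * √(2 * d / N)) * √Lg := by ring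
    _ ≤ _ := by gcongr; linarith

lemma Learner.avgGap_eq (L : Learner H d W S A) (M : CMDP H W S A) {N : ℕ}
    (x : Fin N → Episode H W S A) : L.avgGap M x =
      (1 / N : ℝ) * ∑ i : Fin N, ∫ w, (M.optValue w - M.value w (L.policy i (pre x i) w)) ∂M.q :=
  rfl

lemma Learner.avgGap_le_horizon (L : Learner H d W S A) (M : CMDP H W S A) {N : ℕ} (hN : 1 ≤ N)
    (x : Fin N → Episode H W S A) : L.avgGap M x ≤ H := by
  have hN0 : (0 : ℝ) < N := by exact_mod_cast hN
  rw [L.avgGap_eq, one_div, inv_mul_le_iff₀ hN0]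
  refine (Finset.sum_le_sum fun (i : Fin N) _ => L.integral_gap_le_horizon M i (pre x i)).trans ?_
  simp

variable [Finite A] [MeasurableSingletonClass A] [SFinite ν]

/-- The regret bound holds on every run outside of the bad events. -/
lemma Learner.avgGap_le_regretBound (L : Learner H d W S A) (hM : IsModelI M ν φ ψ μ η)
    (hΨ : IsModelClass ν φ μ Ψ) (hL : L.RunsUCB M ν φ ψ Ψ γ₁ γ₂ δ) (hH : 1 ≤ H) (hd : 1 ≤ d)
    (hδ : 0 < δ) (hδ1 : δ < 1) (hγ₁ : 2 ≤ γ₁) (hγ₂ : 2 ≤ γ₂) {N : ℕ} (hN : 1 ≤ N)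
    {x : Fin N → Episode H W S A}
    (hx : ∀ i : Fin N, 1 ≤ (i : ℕ) → IsAccurate ν φ μ Ψ.card δ (pre x i) (L.muHat i (pre x i)))
    (hxφ : x ∉ concentrationBad L M φ (reg γ₁ d H δ 1) δ N)
    (hxψ : x ∉ concentrationBad L M ψ (reg γ₂ d H δ 1) δ N) :
    L.avgGap M x ≤ regretBound γ₁ γ₂ δ d H Ψ.card N := by
  have hK : 1 ≤ Ψ.card := Finset.card_pos.2 ⟨_, hΨ.realizable ⟨0, hH⟩⟩
  set lam := min (reg γ₁ d H δ 1) (reg γ₂ d H δ 1) with hlam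
  -- For larger `N` the logarithm is at least `1/2`, which lets additive constants be absorbed into
  -- multiples of it.
  rcases le_or_gt (N : ℝ) (d * lam) with hlt | hgt
  · exact (L.avgGap_le_horizon M hN x).trans
      (horizon_le_regretBound hK hH hd hδ hδ1 hN hγ₁ hγ₂ hlt)
  have c1 := one_le_reg hγ₁ hd hH hδ hδ1 (le_refl 1)
  have c2 := one_le_reg hγ₂ hd hH hδ hδ1 (le_refl 1)
  have hl1 : 1 ≤ lam := le_min c1 c2
  have hN0 : (0 : ℝ) < N := by exact_mod_cast hN
  have hN1 : (1 : ℝ) ≤ N := by exact_mod_cast hN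
  have hd1 : (1 : ℝ) ≤ d := by exact_mod_cast hd
  have hH1 : (1 : ℝ) ≤ H := by exact_mod_cast hH
  set Lg := Real.log (1 + N / (d * lam)) with hLg
  have hLg2 : 1 / 2 ≤ Lg := by
    have h1 : (2 : ℝ) ≤ 1 + N / (d * lam) := by
      have : 1 ≤ N / (d * lam) := (one_le_div (by positivity)).2 hgt.le
      linarith
    have h2 := Real.log_le_log (by norm_num) h1
    have := Real.log_two_gt_d9
    linarith
  have hpot : ∀ {γ : ℝ} {v : Fin H → S × A × W → Vec d}, 2 ≤ γ → (∀ h x, ‖v h x‖ ≤ 1) →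
      lam ≤ reg γ d H δ 1 → x ∉ concentrationBad L M v (reg γ d H δ 1) δ N → ∀ h,
      ∑ i : Fin N, ∫ e, featNorm v (reg γ d H δ 1) (pre x i) h (visit e h) ^ 2
        ∂(L.stepLaw M i (pre x i)) ≤ 6 * d * Lg := by
    intro γ v hγ hv hle hbad h
    have hc := one_le_reg hγ hd hH hδ hδ1 (le_refl 1)
    refine (L.sum_integral_featNorm_sq_le M hv hc hd hbad h).trans ?_
    have e1 : Real.log (1 + N / (d * reg γ d H δ 1)) ≤ Lg := by
      refine Real.log_le_log (by positivity) ?_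
      gcongr
    -- The concentration error carries the same logarithm as the regularizer at `n = 1`, so dividing
    -- by the regularizer leaves a constant.
    have e2 : 2 * Real.log (2 * (1 : ℕ) * H / δ) / reg γ d H δ 1 ≤ 1 := by
      rw [div_le_one (by linarith)]
      have := half_le_log hH hδ hδ1 (le_refl 1)
      unfold reg
      have h3 : 2 ≤ γ * d := by nlinarith
      exact mul_le_mul_of_nonneg_right h3 (by linarith)
    have e3 : 4 * d * Real.log (1 + N / (d * reg γ d H δ 1)) ≤ 4 * d * Lg := by gcongr
    have e4 : (1 : ℝ) ≤ 2 * d * Lg := by nlinarith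
    linarith
  have p1 := hpot hγ₁ hM.φ_norm_le (min_le_left _ _) hxφ
  have p2 := hpot hγ₂ hM.ψ_norm_le (min_le_right _ _) hxψ
  rw [regretBound_eq, L.avgGap_eq, one_div, inv_mul_le_iff₀ hN0]
  set Y := radius γ₁ d H Ψ.card δ N with hY
  set β := beta γ₂ d H δ N with hβ
  have hY0 : 0 ≤ Y := radius_nonneg
  have hβ0 : 0 ≤ β := Real.sqrt_nonneg _
  set Eφ : Fin N → Fin H → ℝ := fun i h =>
    ∫ e, featNorm φ (reg γ₁ d H δ 1) (pre x i) h (visit e h) ^ 2 ∂(L.stepLaw M i (pre x i))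
  set Eψ : Fin N → Fin H → ℝ := fun i h =>
    ∫ e, featNorm ψ (reg γ₂ d H δ 1) (pre x i) h (visit e h) ^ 2 ∂(L.stepLaw M i (pre x i))
  have hEφ : ∀ h i, 0 ≤ Eφ i h := fun h i => integral_nonneg fun _ => sq_nonneg _
  have hEψ : ∀ h i, 0 ≤ Eψ i h := fun h i => integral_nonneg fun _ => sq_nonneg _
  set Q := √(2 * d * N * Lg) with hQ
  have hQ6 : √(N * (6 * d * Lg)) ≤ 2 * Q := by
    have e : (2 : ℝ) * Q = √(4 * (2 * d * N * Lg)) := by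
      rw [Real.sqrt_mul (by norm_num), show (4 : ℝ) = 2 ^ 2 by norm_num,
        Real.sqrt_sq (by norm_num)]
    rw [e]
    refine Real.sqrt_le_sqrt ?_
    have : 0 ≤ d * N * Lg := by positivity
    nlinarith
  have s1 : ∀ h, ∑ i, √(Eφ i h) ≤ 2 * Q := fun h =>
    (sum_sqrt_le_sqrt_card_mul (hEφ h) (p1 h)).trans hQ6
  have s2 : ∀ h, ∑ i, √(Eψ i h) ≤ 2 * Q := fun h =>
    (sum_sqrt_le_sqrt_card_mul (hEψ h) (p2 h)).trans hQ6
  -- The first policy (index 0) is arbitrary, so its gap is paid with the trivial bound `H`.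
  have hgap : ∀ i : Fin N, ∫ w, (M.optValue w - M.value w (L.policy i (pre x i) w)) ∂M.q ≤
      (if i = ⟨0, hN⟩ then (H : ℝ) else 0) +
        ∑ h, (11 * H * Y * √(Eφ i h) + 2 * β * √(Eψ i h)) := by
    intro i
    have hnn : 0 ≤ ∑ h, (11 * H * Y * √(Eφ i h) + 2 * β * √(Eψ i h)) :=
      Finset.sum_nonneg fun h _ => by positivity
    split_ifs with hi
    · have := L.integral_gap_le_horizon M i (pre x i)
      linarith
    · have hi1 : 1 ≤ (i : ℕ) := by
        by_contra h0
        exact hi (Fin.ext (by simp; omega))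
      rw [zero_add]
      exact (L.integral_gap_le hM hΨ hL hH hδ hδ1 hi1
        (one_le_reg hγ₁ hd hH hδ hδ1 (by omega)) (one_le_reg hγ₂ hd hH hδ hδ1 (by omega))
        (hx i hi1)).trans (L.integral_bonus_le hM hK hH hd hδ hδ1 hγ₁ hγ₂ i.isLt (pre x i))
  have hsum : ∑ i : Fin N, ∫ w, (M.optValue w - M.value w (L.policy i (pre x i) w)) ∂M.q ≤
      H + H * (11 * H * Y * (2 * Q) + 2 * β * (2 * Q)) := by
    refine (Finset.sum_le_sum fun i _ => hgap i).trans ?_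
    rw [Finset.sum_add_distrib, Finset.sum_ite_eq' Finset.univ, if_pos (Finset.mem_univ _),
      Finset.sum_comm]
    refine add_le_add le_rfl ?_
    calc ∑ h, ∑ i, (11 * H * Y * √(Eφ i h) + 2 * β * √(Eψ i h))
        ≤ ∑ _h : Fin H, (11 * H * Y * (2 * Q) + 2 * β * (2 * Q)) := by
          refine Finset.sum_le_sum fun h _ => ?_
          rw [Finset.sum_add_distrib, ← Finset.mul_sum, ← Finset.mul_sum]
          have := s1 h
          have := s2 h
          gcongr
      _ = _ := by simp [mul_add]
  refine hsum.trans ?_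
  have hY1 : 1 ≤ Y := by
    refine (one_le_sq_iff₀ hY0).1 ?_
    have h1 := two_mul_reg_le_radius_sq (d := d) hK hH hδ hδ1 hN (by linarith : 0 ≤ γ₁)
    have h2 := one_le_reg hγ₁ hd hH hδ hδ1 hN
    rw [← hY] at h1
    nlinarith
  have hQ1 : 1 ≤ Q := by
    refine Real.one_le_sqrt.2 ?_
    have h1 : 1 ≤ (d : ℝ) * N := by nlinarith
    nlinarith
  have hQe : N * (√(2 * d / N) * √Lg) = Q := by
    rw [hQ, ← Real.sqrt_mul (by positivity)]
    rw [show 2 * (d : ℝ) * N * Lg = N ^ 2 * (2 * d / N * Lg) by field_simp,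
      Real.sqrt_mul (by positivity : (0 : ℝ) ≤ N ^ 2), Real.sqrt_sq hN0.le]
  have hR : N * ((42 * H * Y + 6 * β) * (H * √(2 * d / N)) * √Lg) =
      (42 * H * Y + 6 * β) * H * Q := by rw [← hQe]; ring
  rw [hR]
  -- Since `H, Y, Q ≥ 1`, the first episode adds at most one to the coefficient `22 = 11 · 2`, well
  -- below 42; the reward part has `4 ≤ 6`.
  have h1 : (H : ℝ) ≤ H * (H * Y * Q) := by
    refine le_mul_of_one_le_right (by linarith) ?_
    exact one_le_mul_of_one_le_of_one_le (one_le_mul_of_one_le_of_one_le hH1 hY1) hQ1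
  have h2 : 0 ≤ H * (H * Y * Q) := by positivity
  have h3 : 0 ≤ H * (β * Q) := by positivity
  nlinarith

/-- With high probability the average gap is at most the regret bound. -/
lemma Learner.measure_avgGap_le (L : Learner H d W S A) (hM : IsModelI M ν φ ψ μ η)
    (hΨ : IsModelClass ν φ μ Ψ) (hL : L.RunsUCB M ν φ ψ Ψ γ₁ γ₂ δ) (hH : 1 ≤ H) (hd : 1 ≤ d)
    (hδ : 0 < δ) (hδ1 : δ < 1) (hγ₁ : 2 ≤ γ₁) (hγ₂ : 2 ≤ γ₂) {N : ℕ} (hN : 1 ≤ N) :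
    ENNReal.ofReal (1 - 3 * δ / 2) ≤
      L.runLaw M N {x | L.avgGap M x ≤ regretBound γ₁ γ₂ δ d H Ψ.card N} := by
  have c1 := one_le_reg hγ₁ hd hH hδ hδ1 (le_refl 1)
  have c2 := one_le_reg hγ₂ hd hH hδ hδ1 (le_refl 1)
  set G := {x : Fin N → Episode H W S A | L.avgGap M x ≤ regretBound γ₁ γ₂ δ d H Ψ.card N}
  set B₁ := {x : Fin N → Episode H W S A | ∃ i : Fin N, ∃ h, ∃ m ∈ Ψ,
      logLik φ (pre x i) h (μ h) ≤ logLik φ (pre x i) h m ∧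
      2 * Real.log (2 * ((i + 1 : ℕ) : ℝ) * H * Ψ.card / δ) < dataError ν φ μ (pre x i) h m}
  set B₂ := concentrationBad L M φ (reg γ₁ d H δ 1) δ N
  set B₃ := concentrationBad L M ψ (reg γ₂ d H δ 1) δ N
  have hcov : Gᶜ ⊆ B₁ ∪ B₂ ∪ B₃ := by
    intro x hx
    by_contra hcon
    simp only [Set.mem_union, not_or] at hcon
    obtain ⟨⟨h1, h2⟩, h3⟩ := hcon
    refine hx (L.avgGap_le_regretBound hM hΨ hL hH hd hδ hδ1 hγ₁ hγ₂ hN (fun i hi h => ?_) h2 h3)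
    by_contra hlt
    -- The true weights belong to the class, so the estimate is at least as likely; an inaccurate
    -- estimate would lie in the bad event.
    exact h1 ⟨i, h, _, hL.mle_mem i hi _ h, hL.mle_max i hi _ h _ (hΨ.realizable h),
      not_le.1 hlt⟩
  have hB : L.runLaw M N Gᶜ ≤ ENNReal.ofReal (3 * δ / 2) := by
    refine (measure_mono hcov).trans ((measure_union_le _ _).trans
      ((add_le_add_left (measure_union_le _ _) _).trans ?_))
    refine (add_le_add (add_le_add (L.measure_mle_bad_le hM hΨ hH hδ hδ1 N)
      (L.measure_concentrationBad_le M hM.φ_measurable hM.φ_norm_le (by linarith) hδ hH N))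
      (L.measure_concentrationBad_le M hM.ψ_measurable hM.ψ_norm_le (by linarith) hδ hH N)).trans ?_
    rw [← ENNReal.ofReal_add (by positivity) (by positivity),
      ← ENNReal.ofReal_add (by positivity) (by positivity)]
    exact ENNReal.ofReal_le_ofReal (by linarith)
  rw [ENNReal.ofReal_sub _ (by positivity), ENNReal.ofReal_one]
  refine tsub_le_iff_right.2 ?_
  -- Subadditivity alone suffices, so the good event need not be measurable.
  calc (1 : ℝ≥0∞) = L.runLaw M N Set.univ := measure_univ.symm
    _ = L.runLaw M N (G ∪ Gᶜ) := by rw [Set.union_compl_self]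
    _ ≤ L.runLaw M N G + L.runLaw M N Gᶜ := measure_union_le _ _
    _ ≤ _ := by gcongr

end Regret

/-! ### Sample complexity: solving the bound for the number of episodes -/

section SampleComplexity

/-- Apply `log s ≤ s - 1` to `s = t^(1/4)`. -/
lemma one_add_log_sq_le {t : ℝ} (ht : 1 ≤ t) : (1 + Real.log t) ^ 2 ≤ 16 * √t := by
  have h0 : 0 ≤ √t := Real.sqrt_nonneg t
  have h1 : Real.log t = 4 * Real.log √√t := by
    rw [Real.log_sqrt h0, Real.log_sqrt (by linarith)]; ring
  have h2 : Real.log √√t ≤ √√t - 1 :=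
    Real.log_le_sub_one_of_pos (Real.sqrt_pos.2 (Real.sqrt_pos.2 (by linarith)))
  have h3 : 0 ≤ Real.log t := Real.log_nonneg ht
  have h4 : 1 + Real.log t ≤ 4 * √√t := by linarith
  calc (1 + Real.log t) ^ 2 ≤ (4 * √√t) ^ 2 := by gcongr
    _ = 16 * √t := by rw [mul_pow, Real.sq_sqrt h0]; norm_num

/-- For `N = t X log²(2 + X)`, the quantity `1 + N` is at most `t (2 + X)⁴`. -/
lemma log_one_add_mul_log_sq_le {X t : ℝ} (hX : 0 < X) (ht : 1 ≤ t) :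
    Real.log (1 + t * (X * Real.log (2 + X) ^ 2)) ≤ Real.log t + 4 * Real.log (2 + X) := by
  set a := 2 + X with ha
  have ha2 : 2 ≤ a := by linarith
  set L := Real.log a
  have hL : 0 ≤ L := Real.log_nonneg (by linarith)
  have hLa : L ≤ a := (Real.log_le_sub_one_of_pos (by linarith)).trans (by linarith)
  have h2 : X * L ^ 2 ≤ a * a ^ 2 := by
    gcongr
    linarith
  have h3 : 1 + a * a ^ 2 ≤ a ^ 4 := by
    have h4 : 1 ≤ a ^ 3 := one_le_pow₀ (by linarith)
    nlinarith
  have h1 : 1 + t * (X * L ^ 2) ≤ t * a ^ 4 := by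
    calc 1 + t * (X * L ^ 2) ≤ t * 1 + t * (a * a ^ 2) := by gcongr; linarith
      _ = t * (1 + a * a ^ 2) := by ring
      _ ≤ t * a ^ 4 := by gcongr
  have h5 := Real.log_le_log (by positivity) h1
  rw [Real.log_mul (by positivity) (by positivity), Real.log_pow] at h5
  exact_mod_cast h5

/-- The three summands will bound `log (2H)`, `log N` and `log (K / δ)`. The lower bound on `l`
converts their sum into a product, so that the target keeps one factor `log (K / δ)`. -/
lemma add_le_mul_log {l L u : ℝ} (hl : 1 / 3 ≤ l) (hL : 1 / 2 ≤ L) (hu : 0 ≤ u) :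
    2 * L + u + l ≤ l * (8 * L + 3 * u) := by
  nlinarith [mul_le_mul_of_nonneg_right hl (by linarith : 0 ≤ 2 * L + u),
    mul_le_mul_of_nonneg_left hL (by linarith : 0 ≤ l)]

lemma log_poly_le {L u y : ℝ} (hL : 1 / 2 ≤ L) (hy : 0 ≤ y) (hu : 0 ≤ u) (huy : u ≤ y + 4 * L) :
    (8 * L + 3 * u) * u ≤ 80 * L ^ 2 * (1 + y) ^ 2 := by
  have h1 : u ≤ L * (4 + 2 * y) := by
    nlinarith [mul_le_mul_of_nonneg_right hL hy]
  calc (8 * L + 3 * u) * u ≤ (8 * L + 3 * (L * (4 + 2 * y))) * (L * (4 + 2 * y)) := by gcongr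
    _ = L ^ 2 * ((20 + 6 * y) * (4 + 2 * y)) := by ring
    _ ≤ L ^ 2 * (80 * (1 + y) ^ 2) := mul_le_mul_of_nonneg_left (by nlinarith) (sq_nonneg L)
    _ = _ := by ring

/-- The constant of the regret bound after collecting all logarithms. -/
noncomputable def regretConst (γ₁ γ₂ : ℝ) : ℝ := 2 * (1764 * (2 * γ₁ + 4) + 36 * γ₂)

/-- The constant of the sample complexity bound. -/
noncomputable def sampleConst (γ₁ γ₂ : ℝ) : ℝ := (2560 * regretConst γ₁ γ₂) ^ 2 + 1

/-- The constant makes `√t` exceed `2560 = 160 · 16` times `regretConst`, the 16 coming from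
`one_add_log_sq_le`. -/
lemma sampleConst_spec {γ₁ γ₂ t : ℝ} (h₁ : 2 ≤ γ₁) (h₂ : 2 ≤ γ₂) (ht : sampleConst γ₁ γ₂ ≤ t) :
    160 * regretConst γ₁ γ₂ * (1 + Real.log t) ^ 2 < t := by
  have hc : 0 < regretConst γ₁ γ₂ := by unfold regretConst; positivity
  have ht1 : 1 ≤ t := by
    refine le_trans ?_ ht
    unfold sampleConst
    nlinarith [sq_nonneg (2560 * regretConst γ₁ γ₂)]
  have hs : 2560 * regretConst γ₁ γ₂ < √t := by
    refine Real.lt_sqrt_of_sq_lt ?_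
    unfold sampleConst at ht
    linarith
  have h0 : 0 < √t := Real.sqrt_pos.2 (by linarith)
  calc 160 * regretConst γ₁ γ₂ * (1 + Real.log t) ^ 2
      ≤ 160 * regretConst γ₁ γ₂ * (16 * √t) := by gcongr; exact one_add_log_sq_le ht1
    _ = 2560 * regretConst γ₁ γ₂ * √t := by ring
    _ < √t * √t := by gcongr
    _ = t := Real.mul_self_sqrt (by linarith)

variable {γ₁ γ₂ δ ε : ℝ} {d H K N : ℕ}

/-- Use `(a + b)² ≤ 2 (a² + b²)`, with `42² = 1764` and `6² = 36`. Squared radius and `beta` are at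
most multiples of `d²` times one common logarithm, and the prefactor supplies `2 H² d / N`. -/
lemma regretBound_sq_le (hH : 1 ≤ H) (hd : 1 ≤ d) (hK : 1 ≤ K) (hδ : 0 < δ) (hδ1 : δ < 1)
    (hγ₁ : 2 ≤ γ₁) (hγ₂ : 2 ≤ γ₂) (hN : 1 ≤ N) :
    regretBound γ₁ γ₂ δ d H K N ^ 2 ≤ 2 * regretConst γ₁ γ₂ * (H ^ 4 * d ^ 3) *
      Real.log (2 * N * H * K / δ) * Real.log (1 + N) / N := by
  have hN0 : (0 : ℝ) < N := by exact_mod_cast hN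
  have hd1 : (1 : ℝ) ≤ d := by exact_mod_cast hd
  have hH1 : (1 : ℝ) ≤ H := by exact_mod_cast hH
  have hK1 : (1 : ℝ) ≤ K := by exact_mod_cast hK
  have c1 := one_le_reg hγ₁ hd hH hδ hδ1 (le_refl 1)
  have c2 := one_le_reg hγ₂ hd hH hδ hδ1 (le_refl 1)
  have hl1 : 1 ≤ min (reg γ₁ d H δ 1) (reg γ₂ d H δ 1) := le_min c1 c2
  set lam := min (reg γ₁ d H δ 1) (reg γ₂ d H δ 1)
  set G := Real.log (2 * N * H * K / δ) with hG
  have hlog0 := half_le_log hH hδ hδ1 hN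
  have hlogG : Real.log (2 * N * H / δ) ≤ G := by
    refine Real.log_le_log (by positivity) ?_
    rw [mul_div_right_comm (2 * (N : ℝ) * H)]
    exact le_mul_of_one_le_right (by positivity) hK1
  have hG0 : 0 ≤ G := by linarith
  have hY : radius γ₁ d H K δ N ^ 2 ≤ (2 * γ₁ + 4) * d ^ 2 * G := by
    have hreg : reg γ₁ d H δ N ≤ γ₁ * d * G := by unfold reg; gcongr
    have h0 : 0 ≤ reg γ₁ d H δ N := by unfold reg; positivity
    rw [radius, Real.sq_sqrt (by positivity), ← hG]
    calc 2 * reg γ₁ d H δ N * d + 4 * G ≤ 2 * (γ₁ * d * G) * d + 4 * (d ^ 2 * G) := by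
          have : 1 ≤ (d : ℝ) ^ 2 := one_le_pow₀ hd1
          gcongr
          exact le_mul_of_one_le_left hG0 this
      _ = _ := by ring
  have hβ : beta γ₂ d H δ N ^ 2 ≤ γ₂ * d ^ 2 * G := by
    have hreg : reg γ₂ d H δ N ≤ γ₂ * d * G := by unfold reg; gcongr
    have h0 : 0 ≤ reg γ₂ d H δ N := by unfold reg; positivity
    rw [beta, Real.sq_sqrt (by positivity)]
    calc d * reg γ₂ d H δ N ≤ d * (γ₂ * d * G) := by gcongr
      _ = _ := by ring
  have hS : (42 * H * radius γ₁ d H K δ N + 6 * beta γ₂ d H δ N) ^ 2 ≤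
      regretConst γ₁ γ₂ * (H ^ 2 * d ^ 2 * G) := by
    set Y := radius γ₁ d H K δ N
    set β := beta γ₂ d H δ N
    have h1 : (42 * H * Y + 6 * β) ^ 2 ≤ 2 * (1764 * H ^ 2 * Y ^ 2 + 36 * β ^ 2) := by
      nlinarith [sq_nonneg (42 * H * Y - 6 * β)]
    have h2 : 1764 * H ^ 2 * Y ^ 2 ≤ 1764 * H ^ 2 * ((2 * γ₁ + 4) * d ^ 2 * G) := by gcongr
    have h3 : γ₂ * d ^ 2 * G ≤ H ^ 2 * (γ₂ * d ^ 2 * G) :=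
      le_mul_of_one_le_left (by positivity) (one_le_pow₀ hH1)
    calc (42 * H * Y + 6 * β) ^ 2
        ≤ 2 * (1764 * H ^ 2 * ((2 * γ₁ + 4) * d ^ 2 * G) + 36 * (H ^ 2 * (γ₂ * d ^ 2 * G))) := by
          linarith
      _ = _ := by unfold regretConst; ring
  have hLg : Real.log (1 + N / (d * lam)) ≤ Real.log (1 + N) := by
    refine Real.log_le_log (by positivity) ?_
    gcongr
    exact div_le_self hN0.le (one_le_mul_of_one_le_of_one_le hd1 hl1)
  have hLg0 : 0 ≤ Real.log (1 + N / (d * lam)) := by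
    refine Real.log_nonneg ?_
    have : 0 ≤ N / (d * lam) := by positivity
    linarith
  have hc0 : 0 < regretConst γ₁ γ₂ := by unfold regretConst; positivity
  rw [regretBound_eq, mul_pow, mul_pow, mul_pow, Real.sq_sqrt (by positivity), Real.sq_sqrt hLg0]
  calc (42 * H * radius γ₁ d H K δ N + 6 * beta γ₂ d H δ N) ^ 2 * (H ^ 2 * (2 * d / N)) *
        Real.log (1 + N / (d * lam))
      ≤ regretConst γ₁ γ₂ * (H ^ 2 * d ^ 2 * G) * (H ^ 2 * (2 * d / N)) * Real.log (1 + N) := by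
        gcongr
    _ = _ := by field_simp

lemma regretBound_lt (hH : 1 ≤ H) (hd : 1 ≤ d) (hK : 1 ≤ K) (hδ : 0 < δ) (hδ1 : δ < 2 / 3)
    (hγ₁ : 2 ≤ γ₁) (hγ₂ : 2 ≤ γ₂) (hε : 0 < ε) (hεH : ε ≤ H) (hN : 1 ≤ N)
    (hCN : sampleConst γ₁ γ₂ * (H ^ 4 * d ^ 3 * Real.log (K / δ) / ε ^ 2) *
      Real.log (2 + H ^ 4 * d ^ 3 * Real.log (K / δ) / ε ^ 2) ^ 2 ≤ N) :
    regretBound γ₁ γ₂ δ d H K N < ε := by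
  have hN0 : (0 : ℝ) < N := by exact_mod_cast hN
  have hd1 : (1 : ℝ) ≤ d := by exact_mod_cast hd
  have hH1 : (1 : ℝ) ≤ H := by exact_mod_cast hH
  have hK1 : (1 : ℝ) ≤ K := by exact_mod_cast hK
  set l := Real.log (K / δ) with hl
  -- The class may be a singleton, so `δ < 2/3` is what keeps `log (K / δ)` away from 0.
  have hl3 : 1 / 3 ≤ l := by
    have h1 : (3 / 2 : ℝ) ≤ K / δ := by
      rw [le_div_iff₀ hδ]; linarith
    have h2 := Real.one_sub_inv_le_log_of_pos (by norm_num : (0 : ℝ) < 3 / 2)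
    have h3 := Real.log_le_log (by norm_num) h1
    norm_num at h2
    linarith
  set X := H ^ 4 * d ^ 3 * l / ε ^ 2 with hX
  -- This uses `ε ≤ H`, and lets `log (2H)` be absorbed into `log (2 + X)`.
  have hXH : (H : ℝ) ^ 2 ≤ 3 * X := by
    have h1 : (H : ℝ) ^ 2 * d ^ 3 * l ≤ X := by
      rw [hX, le_div_iff₀ (by positivity)]
      have : ε ^ 2 ≤ (H : ℝ) ^ 2 := by gcongr
      calc (H : ℝ) ^ 2 * d ^ 3 * l * ε ^ 2 ≤ H ^ 2 * d ^ 3 * l * H ^ 2 := by gcongr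
        _ = _ := by ring
    have h2 : (H : ℝ) ^ 2 * (1 / 3) ≤ H ^ 2 * d ^ 3 * l := by
      have : 1 ≤ (d : ℝ) ^ 3 := one_le_pow₀ hd1
      have h3 : (H : ℝ) ^ 2 ≤ H ^ 2 * d ^ 3 := le_mul_of_one_le_right (by positivity) this
      gcongr
    linarith
  have hX0 : 0 < X := by nlinarith
  set a := 2 + X with ha
  have ha2 : 2 ≤ a := by linarith
  set L := Real.log a with hL
  have hL2 : 1 / 2 ≤ L := by
    have h2 := Real.log_le_log (by norm_num) ha2
    have := Real.log_two_gt_d9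
    linarith
  set t := N / (X * L ^ 2) with ht
  have hXL : 0 < X * L ^ 2 := by positivity
  have htC : sampleConst γ₁ γ₂ ≤ t := by
    rw [ht, le_div_iff₀ hXL, ← mul_assoc]; exact hCN
  have ht1 : 1 ≤ t := by
    refine le_trans ?_ htC
    unfold sampleConst
    nlinarith [sq_nonneg (2560 * regretConst γ₁ γ₂)]
  have hNt : (N : ℝ) = t * (X * L ^ 2) := by rw [ht]; field_simp
  set u := Real.log (1 + N) with hu
  set y := Real.log t with hy
  have hy0 : 0 ≤ y := Real.log_nonneg ht1
  have hu0 : 0 ≤ u := Real.log_nonneg (by linarith)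
  have hu4 : u ≤ y + 4 * L := by
    rw [hu, hNt]
    exact log_one_add_mul_log_sq_le hX0 ht1
  have hG : Real.log (2 * N * H * K / δ) ≤ l * (8 * L + 3 * u) := by
    have e : 2 * (N : ℝ) * H * K / δ = (2 * H) * N * (K / δ) := by ring
    rw [e, Real.log_mul (by positivity) (by positivity), Real.log_mul (by positivity)
      (by positivity), ← hl]
    have h1 : Real.log (2 * H) ≤ 2 * L := by
      have h2 : 2 * (H : ℝ) ≤ a ^ 2 := by nlinarith [sq_nonneg ((H : ℝ) - 1)]
      have h3 := Real.log_le_log (by positivity) h2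
      rw [Real.log_pow] at h3
      push_cast at h3
      exact h3
    have h4 : Real.log N ≤ u := Real.log_le_log hN0 (by linarith)
    have h5 := add_le_mul_log hl3 hL2 hu0
    linarith
  have hpoly := log_poly_le hL2 hy0 hu0 hu4
  have hc0 : 0 < regretConst γ₁ γ₂ := by unfold regretConst; positivity
  have hsq := regretBound_sq_le hH hd hK hδ (by linarith) hγ₁ hγ₂ hN
  have hfin : regretBound γ₁ γ₂ δ d H K N ^ 2 < ε ^ 2 := by
    refine hsq.trans_lt ?_
    rw [div_lt_iff₀ hN0]
    calc 2 * regretConst γ₁ γ₂ * (H ^ 4 * d ^ 3) * Real.log (2 * N * H * K / δ) * u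
        ≤ 2 * regretConst γ₁ γ₂ * (H ^ 4 * d ^ 3) * (l * (8 * L + 3 * u)) * u := by gcongr
      _ = 2 * regretConst γ₁ γ₂ * (ε ^ 2 * X) * ((8 * L + 3 * u) * u) := by
          rw [hX]; field_simp
      _ ≤ 2 * regretConst γ₁ γ₂ * (ε ^ 2 * X) * (80 * L ^ 2 * (1 + y) ^ 2) := by gcongr
      _ = ε ^ 2 * (160 * regretConst γ₁ γ₂ * (1 + y) ^ 2 * (X * L ^ 2)) := by ring
      _ < ε ^ 2 * (t * (X * L ^ 2)) := by
          have := sampleConst_spec hγ₁ hγ₂ htC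
          gcongr
      _ = ε ^ 2 * N := by rw [← hNt]
  exact lt_of_pow_lt_pow_left₀ 2 hε.le hfin

end SampleComplexity

/-- In dimension 0 all densities vanish and cannot integrate to 1. -/
lemma IsModelI.one_le_dim {H d : ℕ} {W S A : Type*} [MeasurableSpace W] [MeasurableSpace S]
    [MeasurableSpace A] [Nonempty A] {M : CMDP H W S A} {ν : Measure S}
    {φ ψ : Fin H → S × A × W → Vec d} {μ : Fin H → S → Vec d} {η : Fin H → Vec d}
    (hM : IsModelI M ν φ ψ μ η) (hH : 1 ≤ H) : 1 ≤ d := by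
  by_contra hd
  obtain rfl : d = 0 := by omega
  obtain ⟨a⟩ := ‹Nonempty A›
  obtain ⟨w⟩ : Nonempty W := nonempty_of_isProbabilityMeasure M.q
  have h := (hM.weight ⟨0, hH⟩).integral_eq_one (M.s₁, a, w)
  have e : φ ⟨0, hH⟩ (M.s₁, a, w) = 0 := Subsingleton.elim _ _
  simp [e] at h

end CMDPModelI

/-! ### Assembly of the theorem -/

open CMDPModelI in
theorem theorem1 :
    ∃ γ₀ : ℝ, 0 < γ₀ ∧ ∀ γ₁ γ₂ : ℝ, γ₀ ≤ γ₁ → γ₀ ≤ γ₂ → ∃ C : ℝ, 0 < C ∧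
      ∀ (W S A : Type*) [MeasurableSpace W] [MeasurableSpace S] [MeasurableSpace A]
        [Fintype A] [Nonempty A] [MeasurableSingletonClass A]
        (H d : ℕ) (_ : 1 ≤ H) (M : CMDP H W S A)
        (ν : MeasureTheory.Measure S) [MeasureTheory.SigmaFinite ν]
        (φ ψ : Fin H → S × A × W → Vec d) (μ : Fin H → S → Vec d) (η : Fin H → Vec d)
        (Ψ : Finset (S → Vec d)) (δ : ℝ) (L : Learner H d W S A),
        IsModelI M ν φ ψ μ η → IsModelClass ν φ μ Ψ → 0 < δ → δ < 1 →
        L.RunsUCB M ν φ ψ Ψ γ₁ γ₂ δ →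
        (∀ N : ℕ, 1 ≤ N →
          ENNReal.ofReal (1 - 3 * δ / 2) ≤ L.runLaw M N {x | L.avgGap M x ≤
            (42 * H * √(2 * d * reg γ₁ d H δ N + 4 * Real.log (2 * H * N * Ψ.card / δ))
                + 6 * √(d * reg γ₂ d H δ N))
              * (H * √(2 * d / N))
              * √(Real.log (1 + N / (d * min (reg γ₁ d H δ 1) (reg γ₂ d H δ 1))))}) ∧
        (∀ ε : ℝ, 0 < ε → ∀ N : ℕ, 1 ≤ N →
          C * (H ^ 4 * d ^ 3 * Real.log (Ψ.card / δ) / ε ^ 2)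
              * Real.log (2 + H ^ 4 * d ^ 3 * Real.log (Ψ.card / δ) / ε ^ 2) ^ 2 ≤ N →
          ENNReal.ofReal (1 - 3 * δ / 2) ≤ L.runLaw M N {x | L.avgGap M x < ε}) := by
  refine ⟨2, by norm_num, fun γ₁ γ₂ hγ₁ hγ₂ => ⟨sampleConst γ₁ γ₂, ?_, ?_⟩⟩
  · unfold sampleConst
    positivity
  intro W S A _ _ _ _ _ _ H d hH M ν _ φ ψ μ η Ψ δ L hM hΨ hδ hδ1 hL
  have hd := hM.one_le_dim hH
  have hK : 1 ≤ Ψ.card := Finset.card_pos.2 ⟨_, hΨ.realizable ⟨0, hH⟩⟩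
  have regret := fun (N : ℕ) (hN : 1 ≤ N) =>
    L.measure_avgGap_le hM hΨ hL hH hd hδ hδ1 hγ₁ hγ₂ hN
  refine ⟨regret, fun ε hε N hN hCN => ?_⟩
  -- For `δ ≥ 2/3` the claimed probability is not positive. Below, `ε > H` is trivial because the
  -- average gap never exceeds `H`.
  rcases le_or_gt (2 / 3) δ with hδ2 | hδ2
  · rw [ENNReal.ofReal_of_nonpos (by linarith)]
    exact zero_le
  rcases le_or_gt ε H with hεH | hεH
  · refine (regret N hN).trans (measure_mono fun x hx => ?_)
    exact lt_of_le_of_lt hx (regretBound_lt hH hd hK hδ hδ2 hγ₁ hγ₂ hε hεH hN hCN)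
  · have huniv : {x : Fin N → Episode H W S A | L.avgGap M x < ε} = Set.univ :=
      Set.eq_univ_of_forall fun x => (L.avgGap_le_horizon M hN x).trans_lt hεH
    rw [huniv, measure_univ, ← ENNReal.ofReal_one]
    exact ENNReal.ofReal_le_ofReal (by linarith)
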